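/- Let $K$ be a field and $q\in K$ with $q\neq 0$ and $q^2\neq 1$ (for instance $K=\mathbb C(q)$ with $q$ an indeterminate, or $K=\mathbb C$). In a $K$-algebra put $[A,B]=AB-BA$ and $[A,B]_q=\frac{1}{q-q^{-1}}(qAB-q^{-1}BA)$. A subset of $\{1,\dots,n\}$ is connected if it is a non-empty set of consecutive integers. A sequence $(I_1,\dots,I_k)$ of connected subsets is called monotonic adjacent if $I_1<\dots<I_k$ or $I_1>\dots>I_k$ (elementwise) and each $I_l\cup I_{l+1}$ is connected. Let $\mathfrak{aw}(n)$, $n\ge 0$, be the unital associative $K$-algebra generated by elements $C_I$, $I\subseteq\{1,\dots,n\}$ connected, with the relations below, where $C_\varnothing:=1$, and, for disjoint $I,J$, each connected or empty, $C_{IJ}:=C_{I\cup J}$ if $I=\varnothing$, $J=\varnothing$ or $I\cup J$ is connected, and otherwise $C_{IJ}:=-[C_{I\cup H},C_{H\cup J}]_q+C_IC_J+C_HC_{I\cup H\cup J}$ with $H$ the hole between $I$ and $J$: * $[C_I,C_J]=0$ if $I\cap J=\varnothing$ or $I\subseteq J$; * $C_{I_1\cup I_2}=-[C_{I_2\cup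 I_3},C_{I_1I_3}]_q+C_{I_1}C_{I_2}+C_{I_3}C_{I_1\cup I_2\cup I_3}$ for every monotonic adjacent $(I_1,I_2,I_3)$; * $C_{I_1I_4}=-[C_{I_1I_3},C_{I_3\cup I_4}]_q+C_{I_1}C_{I_4}+C_{I_3}C_{I_1\,(I_3\cup I_4)}$ for every monotonic adjacent $(I_1,I_2,I_3,I_4)$. Write $C_{j\dots k}=C_{\{j,\dots,k\}}$. **(1)** For all $n\ge 0$ and $a\in\{0,\dots,n\}$ there is a morphism of algebras $\delta_a:\mathfrak{aw}(n)\to\mathfrak{aw}(n+1)$ with, for $1\le j\le k\le n$, $$\delta_a(C_{j\dots k})=\begin{cases}C_{j\dots k}& k<a,\\ C_{j\dots k+1}& j\le a\le k,\\ C_{j+1\dots k+1}& a<j.\end{cases}$$ **(2)** Assume moreover $q^2\neq -1$. For every $n$ there is an algebra anti-automorphism $X\mapsto X^{\rm up}$ of $\mathfrak{aw}(n)$ fixing every $C_I$, and for $0\le i\le n-1$ there are algebra automorphisms $r_i,\overline r_i$ of $\mathfrak{aw}(n)$ such that $\overline r_i(C_I)=(r_i(C_I))^{\rm up}$ for every connected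 $I$, and $r_i$ is given on generators as follows. For $i\ge1$: $r_i(C_{i+1\dots k})=C_{\{i\}\{i+2,\dots,k\}}$, $r_i(C_{j\dots i})=C_{\{i+1\}\{j,\dots,i-1\}}$, and $r_i$ fixes the other generators. For $i=0$: $r_0(C_{1\dots k})=C_{\{k+1,\dots,n\}\{1\}}$, and $r_0$ fixes the other generators. As morphisms $\mathfrak{aw}(n)\to\mathfrak{aw}(n+1)$, for every $n\ge0$, $$\begin{aligned} & r_i\delta_i=\delta_i, && \delta_i=\overline r_i\delta_i && (0\le i\le n),\\ & \delta_i r_i=r_{i+1}r_i\delta_{i+1}, && \overline r_i\overline r_{i+1}\delta_i=\delta_{i+1}\overline r_i && (0\le i\le n-1),\\ & \delta_{i+1}r_i=r_ir_{i+1}\delta_i, && \overline r_{i+1}\overline r_i\delta_{i+1}=\delta_i\overline r_i && (0\le i\le n-1),\\ & \delta_i r_j=r_j\delta_i, && \delta_i\overline r_j=\overline r_j\delta_i && (0\le i\le n,\ 0\le j<i-1),\\ & \delta_i r_j=r_{j+1}\delta_i, && \delta_i\overline r_j=\overline r_{j+1}\delta_i && (0\le i\le n,\ i<j\le n-1). \end{aligned}$$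 -/

import Mathlib

namespace AskeyWilson

/-- A connected subset of `{1, …, n}`: a non-empty set of consecutive integers. -/
def IsConn (n : ℕ) (I : Finset ℕ) : Prop :=
  I.Nonempty ∧ ∃ j k : ℕ, 1 ≤ j ∧ k ≤ n ∧ I = Finset.Icc j k

/-- `I < J`: all elements of `I` are strictly smaller than all elements of `J`. -/
def SetLT (I J : Finset ℕ) : Prop := ∀ x ∈ I, ∀ y ∈ J, x < y

/-- A monotonic sequence (increasing or decreasing) of adjacent non-empty connected subsets of
`{1, …, n}`: the union of any two consecutive terms is connected. -/
def IsMonoAdjSeq (n : ℕ) (l : List (Finset ℕ)) : Prop :=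
  (∀ I ∈ l, IsConn n I) ∧
  (l.Pairwise SetLT ∨ l.Pairwise (fun I J => SetLT J I)) ∧
  l.IsChain (fun I J => IsConn n (I ∪ J))

section General

variable {K : Type*} [Field K] {A : Type*} [Ring A] [Algebra K A]

/-- The `q`-commutator `[x, y]_q = (q x y - q⁻¹ y x) / (q - q⁻¹)`. -/
def qComm (q : K) (x y : A) : A := (q - q⁻¹)⁻¹ • (q • (x * y) - q⁻¹ • (y * x))

/-- Given the elements `c I = C_I` for connected `I` (and `c ∅ = 1`), the element `C_{I J}`, where
`I` and `J` are disjoint sets, each connected or empty, and `H` is the hole between them. If one of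
the three sets is empty, then `C_{I J}` just stands for `C_{I ∪ J}`. -/
def twoBlock (q : K) (c : Finset ℕ → A) (I H J : Finset ℕ) : A :=
  if I = ∅ ∨ H = ∅ ∨ J = ∅ then c (I ∪ J)
  else -qComm q (c (I ∪ H)) (c (H ∪ J)) + c I * c J + c H * c (I ∪ H ∪ J)

end General

/-- The free generators of `aw(n)` are indexed by the connected subsets of `{1, …, n}`; here
`C_∅ = 1`. The value at the other sets is never used. -/
noncomputable def freeC (K : Type*) [Field K] (n : ℕ) (I : Finset ℕ) :
    FreeAlgebra K {I : Finset ℕ // IsConn n I} :=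
  open Classical in if h : IsConn n I then FreeAlgebra.ι K ⟨I, h⟩ else 1

/-- The defining relations of `aw(n)`. -/
inductive Rel (K : Type*) [Field K] (q : K) (n : ℕ) :
    FreeAlgebra K {I : Finset ℕ // IsConn n I} →
    FreeAlgebra K {I : Finset ℕ // IsConn n I} → Prop
  /-- `[C_I, C_J] = 0` if `I ∩ J = ∅` or `I ⊆ J`. -/
  | comm (I J : Finset ℕ) (hI : IsConn n I) (hJ : IsConn n J) (h : Disjoint I J ∨ I ⊆ J) :
      Rel K q n (freeC K n I * freeC K n J) (freeC K n J * freeC K n I)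
  /-- `C_{I₁I₂} = -[C_{I₂I₃}, C_{I₁I₃}]_q + C_{I₁} C_{I₂} + C_{I₃} C_{I₁I₂I₃}`. -/
  | three (I₁ I₂ I₃ : Finset ℕ) (h : IsMonoAdjSeq n [I₁, I₂, I₃]) :
      Rel K q n (freeC K n (I₁ ∪ I₂))
        (-qComm q (freeC K n (I₂ ∪ I₃)) (twoBlock q (freeC K n) I₁ I₂ I₃)
          + freeC K n I₁ * freeC K n I₂ + freeC K n I₃ * freeC K n (I₁ ∪ I₂ ∪ I₃))
  /-- `C_{I₁I₄} = -[C_{I₁I₃}, C_{I₃I₄}]_q + C_{I₁} C_{I₄} + C_{I₃} C_{I₁I₃I₄}`. -/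
  | four (I₁ I₂ I₃ I₄ : Finset ℕ) (h : IsMonoAdjSeq n [I₁, I₂, I₃, I₄]) :
      Rel K q n (twoBlock q (freeC K n) I₁ (I₂ ∪ I₃) I₄)
        (-qComm q (twoBlock q (freeC K n) I₁ I₂ I₃) (freeC K n (I₃ ∪ I₄))
          + freeC K n I₁ * freeC K n I₄
          + freeC K n I₃ * twoBlock q (freeC K n) I₁ I₂ (I₃ ∪ I₄))

/-- The Askey–Wilson algebra `aw(n)` over `K` with parameter `q`. -/
abbrev AW (K : Type*) [Field K] (q : K) (n : ℕ) : Type _ := RingQuot (Rel K q n)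

/-- The element `C_I` of `aw(n)`. -/
noncomputable def C (K : Type*) [Field K] (q : K) (n : ℕ) (I : Finset ℕ) : AW K q n :=
  RingQuot.mkAlgHom K (Rel K q n) (freeC K n I)

section Maps

variable {K : Type*} [Field K] {q : K} {n : ℕ}

/-- `f` takes on the generators `C_{j…k}` of `aw(n)` the values prescribed for the coproduct
map `δ_a`: the index `a` is doubled and the larger indices are shifted by one. -/
def IsCoproductMap (a : ℕ) (f : AW K q n →ₐ[K] AW K q (n + 1)) : Prop :=
  ∀ j k : ℕ, 1 ≤ j → j ≤ k → k ≤ n →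
    f (C K q n (Finset.Icc j k)) =
      if k < a then C K q (n + 1) (Finset.Icc j k)
      else if j ≤ a then C K q (n + 1) (Finset.Icc j (k + 1))
      else C K q (n + 1) (Finset.Icc (j + 1) (k + 1))

/-- `f` is the identity on the generators, as a map to the opposite algebra (that is, as an
anti-morphism). -/
def IsUpMap (f : AW K q n →ₐ[K] (AW K q n)ᵐᵒᵖ) : Prop :=
  ∀ j k : ℕ, 1 ≤ j → j ≤ k → k ≤ n →
    f (C K q n (Finset.Icc j k)) = MulOpposite.op (C K q n (Finset.Icc j k))

/-- `f` takes on the generators `C_{j…k}` of `aw(n)` the values prescribed for `r_i`.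
For `i = 0`: `C_{1…k} ↦ C_{{k+1…n},1}`, the other generators being fixed.
For `i ≥ 1`: `C_{i+1…k} ↦ C_{i,i+2…k}` and `C_{j…i} ↦ C_{i+1,i-1…j}`, the other generators being
fixed. -/
def IsBraidMap (i : ℕ) (f : AW K q n →ₐ[K] AW K q n) : Prop :=
  ∀ j k : ℕ, 1 ≤ j → j ≤ k → k ≤ n →
    f (C K q n (Finset.Icc j k)) =
      if i = 0 then
        if j = 1 then twoBlock q (C K q n) (Finset.Icc (k + 1) n) (Finset.Icc 2 k) {1}
        else C K q n (Finset.Icc j k)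
      else if j = i + 1 then twoBlock q (C K q n) {i} {i + 1} (Finset.Icc (i + 2) k)
      else if k = i then twoBlock q (C K q n) {i + 1} {i} (Finset.Icc j (i - 1))
      else C K q n (Finset.Icc j k)

/-- `g` takes on the generators the values prescribed for `r̄_i`, namely `r̄_i(C_I) = (r_i(C_I))^up`,
where `f` is the map `r_i` and `up` the anti-morphism `x ↦ x^up`. -/
def IsBarBraidMap (up : AW K q n →ₐ[K] (AW K q n)ᵐᵒᵖ) (f g : AW K q n →ₐ[K] AW K q n) : Prop :=
  ∀ j k : ℕ, 1 ≤ j → j ≤ k → k ≤ n →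
    g (C K q n (Finset.Icc j k)) = MulOpposite.unop (up (f (C K q n (Finset.Icc j k))))

end Maps

end AskeyWilson

/-! Attach `C_{i+1…j}` to the chord `(i, j)` of an `(n + 1)`-gon with vertices `0, …, n`, and `1` to
degenerate chords. The elements `C_i` and `C_{1…n}` then sit on the sides, and chords that do not
cross commute. After substituting the definition of `C_{IJ}`, the three-block relation becomes a
cubic relation between the two diagonals of a quadrangle, and the four-block relation becomes one
relation between the five diagonals of a pentagon.

The main point is that these relations are invariant under all rotations of the polygon, although
the presentation singles out the vertex `0`. For quadrangles, a rotation exchanges the increasing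
and the decreasing relation. For pentagons (`PentRel.rotate`), let `Y` be the difference of the two
sides of the rotated relation; the known relations give `[a, Y]_q = 0` and `[a, [Y, a]_q]_q = Y` for
a diagonal `a`, and rebracketing yields `Y = [[a, Y]_q, a]_q = 0`.

In this picture `δ_a` is a relabelling: it is induced by the increasing injection of vertices that
omits `a`. The map `r_k` is the half twist that exchanges the two sides at the vertex `k`. It fixes
the chords that do not end at `k` and sends `X k y` to `-[X (k-1) (k+1), X k y]_q + X (k-1) k * X
(k+1) y + X k (k+1) * X (k-1) y`. By rotation one may take `k = 0`. A relation that is linear in the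
chords at `0` survives the twist, because it also holds with `0` replaced by `1` and by `-1`. Two
cases remain. Two twisted chords commute by comparing a pentagon relation with its mirror image,
which requires division by `q + q⁻¹`; this is the only use of `q² ≠ -1`. The cubic relation whose
repeated diagonal is twisted is computed directly for quadrangles containing the vertex `1`, and is
carried over to the others through a pentagon by `PentCubic.of_pentRel`.

The anti-automorphism exists because passing to the opposite algebra exchanges increasing and
decreasing relations. Conjugation by it turns `r_k` into `r̄_k`, which is the inverse of `r_k` by
the cubic relation. Of the identities between `δ` and `r`, most are relabellings; the two in which
the half twist meets the doubled index are pentagon relations, read as four-block relations.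
Conjugation gives the barred identities. -/

namespace AskeyWilson

/-! ### Calculus of the `q`-commutator -/

section Bracket

variable {K : Type*} [Field K] {A : Type*} [Ring A] [Algebra K A] {q : K}

theorem qComm_add_left (x y z : A) : qComm q (x + y) z = qComm q x z + qComm q y z := by
  simp only [qComm, add_mul, mul_add]; module

theorem qComm_add_right (x y z : A) : qComm q x (y + z) = qComm q x y + qComm q x z := by
  simp only [qComm, add_mul, mul_add]; module

theorem qComm_sub_left (x y z : A) : qComm q (x - y) z = qComm q x z - qComm q y z := by
  simp only [qComm, sub_mul, mul_sub]; module

theorem qComm_sub_right (x y z : A) : qComm q x (y - z) = qComm q x y - qComm q x z := by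
  simp only [qComm, sub_mul, mul_sub]; module

theorem qComm_neg_left (x y : A) : qComm q (-x) y = -qComm q x y := by
  simp only [qComm, neg_mul, mul_neg]; module

theorem qComm_neg_right (x y : A) : qComm q x (-y) = -qComm q x y := by
  simp only [qComm, neg_mul, mul_neg]; module

theorem qComm_zero_left (x : A) : qComm q 0 x = 0 := by simp [qComm]

/-- The normalisation of the `q`-commutator is made for this: on commuting elements it is the plain
product. This is why the relations stay true when vertices of a polygon merge. -/
theorem qComm_of_commute (hq : q - q⁻¹ ≠ 0) {x y : A} (h : Commute x y) :
    qComm q x y = x * y := by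
  rw [qComm, ← h.eq, ← sub_smul, smul_smul, inv_mul_cancel₀ hq, one_smul]

theorem _root_.Commute.qComm_right {x y z : A} (h : Commute x y) (h' : Commute x z) :
    Commute x (qComm q y z) := by
  unfold qComm
  exact (((h.mul_right h').smul_right _).sub_right ((h'.mul_right h).smul_right _)).smul_right _

theorem _root_.Commute.qComm_left {x y z : A} (h : Commute x z) (h' : Commute y z) :
    Commute (qComm q x y) z :=
  (h.symm.qComm_right h'.symm).symm

/-- Bracketing with `x` on the left and with `z` on the right are operators that commute as soon as
`x` and `z` do. Most rearrangements of nested brackets below rest on this or on the next two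
variants. -/
theorem qComm_assoc {x z : A} (h : Commute x z) (y : A) :
    qComm q (qComm q x y) z = qComm q x (qComm q y z) := by
  have h1 : z * (x * y) = x * (z * y) := by rw [← mul_assoc, ← h.eq, mul_assoc]
  have h2 : y * (x * z) = y * (z * x) := by rw [h.eq]
  simp only [qComm, sub_mul, mul_sub, smul_mul_assoc, mul_smul_comm, mul_assoc, h1, h2]
  module

theorem qComm_right_comm {y z : A} (h : Commute y z) (x : A) :
    qComm q (qComm q x y) z = qComm q (qComm q x z) y := by
  have h1 : z * (y * x) = y * (z * x) := by rw [← mul_assoc, ← h.eq, mul_assoc]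
  have h2 : x * (y * z) = x * (z * y) := by rw [h.eq]
  simp only [qComm, sub_mul, mul_sub, smul_mul_assoc, mul_smul_comm, mul_assoc, h1, h2]
  module

theorem qComm_left_comm {x y : A} (h : Commute x y) (z : A) :
    qComm q x (qComm q y z) = qComm q y (qComm q x z) := by
  have h1 : x * (y * z) = y * (x * z) := by rw [← mul_assoc, h.eq, mul_assoc]
  have h2 : z * (y * x) = z * (x * y) := by rw [h.eq]
  simp only [qComm, sub_mul, mul_sub, smul_mul_assoc, mul_smul_comm, mul_assoc, h1, h2]
  module

theorem qComm_mul_left {z y : A} (h : Commute z y) (x : A) :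
    qComm q (z * x) y = z * qComm q x y := by
  have h1 : y * (z * x) = z * (y * x) := by rw [← mul_assoc, ← h.eq, mul_assoc]
  simp only [qComm, mul_sub, mul_smul_comm, mul_assoc, h1]

theorem qComm_mul_right {x z : A} (h : Commute z x) (y : A) :
    qComm q x (z * y) = z * qComm q x y := by
  have h1 : x * (z * y) = z * (x * y) := by rw [← mul_assoc, ← h.eq, mul_assoc]
  simp only [qComm, mul_sub, mul_smul_comm, mul_assoc, h1]

theorem qComm_mul_right' {x z : A} (h : Commute z x) (y : A) :
    qComm q x (y * z) = qComm q x y * z := by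
  have h1 : y * (z * x) = y * (x * z) := by rw [h.eq]
  simp only [qComm, sub_mul, smul_mul_assoc, mul_assoc, h1]

theorem qComm_op (x y : A) :
    qComm q (MulOpposite.op x) (MulOpposite.op y) = MulOpposite.op (qComm q y x) := by
  simp [qComm]

theorem map_qComm {B F : Type*} [Ring B] [Algebra K B] [FunLike F A B] [AlgHomClass F K A B]
    (f : F) (x y : A) : f (qComm q x y) = qComm q (f x) (f y) := by
  simp [qComm]

variable {R : Type*} [CommRing R] [Algebra K R] [Algebra R A] [IsScalarTower K R A]

theorem qComm_smul_left (r : R) (x y : A) : qComm q (r • x) y = r • qComm q x y := by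
  simp only [qComm, smul_sub, smul_mul_assoc, mul_smul_comm, smul_comm _ r]

theorem qComm_smul_right (r : R) (x y : A) : qComm q x (r • y) = r • qComm q x y := by
  simp only [qComm, smul_sub, smul_mul_assoc, mul_smul_comm, smul_comm _ r]

end Bracket

/-! ### Relations in a pentagon whose sides are scalars of a commutative ring -/

section Pentagon

variable {K : Type*} [Field K] {A : Type*} [Ring A] [Algebra K A]
  {R : Type*} [CommRing R] [Algebra K R] [Algebra R A] [IsScalarTower K R A]

/-- The five diagonals of a pentagon, labelled such that consecutive ones cross. -/
structure PentComm (a b c d e : A) : Prop where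
  ac : Commute a c
  ad : Commute a d
  bd : Commute b d
  be : Commute b e
  ce : Commute c e

/-- The cubic relation between the crossing diagonals `y` and `x` of a pentagon with central
sides; the diagonal `z` crosses neither of them. -/
def PentCubic (q : K) (y x z : A) (r s t : R) : Prop :=
  qComm q x (qComm q y x) = y + (r * t) • x + s • (z * x) - (r * s) • (1 : A) - t • z

/-- The relation involving all the five diagonals of a pentagon with central sides. -/
def PentRel (q : K) (a b c d e : A) (c₀ c₂ c₃ : R) : Prop :=
  qComm q a (qComm q b c) + qComm q d e =
    c₀ • b + c₂ • qComm q d c + c₃ • qComm q a e - (c₀ * c₂ * c₃) • (1 : A)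

variable {q : K} {a b c d e : A} {c₀ c₁ c₂ c₃ c₄ : R}

theorem PentComm.rotate (h : PentComm a b c d e) : PentComm b c d e a :=
  ⟨h.bd, h.be, h.ce, h.ac.symm, h.ad.symm⟩

theorem PentComm.reflect (h : PentComm a b c d e) : PentComm c b a e d :=
  ⟨h.ac.symm, h.ce, h.be, h.bd, h.ad⟩

/-- An identity can thus be proved by testing the difference `y` of its sides against a single
element `x`. -/
theorem eq_zero_of_qComm (x y : A) (h : qComm q x y = 0) (h' : qComm q x (qComm q y x) = y) :
    y = 0 := by
  rw [← qComm_assoc (Commute.refl x), h, qComm_zero_left] at h'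
  exact h'.symm

/-- The pentagon relation may be rotated. -/
theorem PentRel.rotate (hq : q - q⁻¹ ≠ 0) (h : PentComm a b c d e)
    (hde : PentCubic q e d b c₁ c₀ c₄) (hdc : PentCubic q c d a c₃ c₄ c₀)
    (hae : PentCubic q e a c c₀ c₁ c₂) (hab : PentCubic q b a d c₃ c₂ c₁)
    (H : PentRel q a b c d e c₀ c₂ c₃) : PentRel q b c d e a c₁ c₃ c₄ := by
  unfold PentCubic at *
  unfold PentRel at *
  rw [← sub_eq_zero]
  have had := qComm_of_commute hq h.ad
  have hac := qComm_of_commute hq h.ac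
  have hbd := qComm_of_commute hq h.bd
  have h1 (x : A) : qComm q x (1 : A) = x := by
    rw [qComm_of_commute hq (Commute.one_right x), mul_one]
  have h1' (x : A) : qComm q (1 : A) x = x := by
    rw [qComm_of_commute hq (Commute.one_left x), one_mul]
  -- The difference of the two sides is tested against the diagonal `a`. In the first test,
  -- rebracketing the leading term exposes `[a, [b, c]]`, which `H` replaces; in the second, the
  -- brackets with `a` are moved inwards until they act on `b` or `e`, where the cubic relations
  -- apply.
  refine eq_zero_of_qComm (q := q) a _ ?_ ?_
  · have e1 : qComm q a (qComm q b (qComm q c d)) =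
        qComm q (qComm q a (qComm q b c) + qComm q d e) d - qComm q d (qComm q e d) := by
      rw [qComm_add_left, qComm_assoc h.ad, qComm_assoc h.bd, qComm_assoc (Commute.refl d)]
      abel
    rw [H, hde] at e1
    have e2 : qComm q (qComm q d c) d = _ := (qComm_assoc (Commute.refl d) c).trans hdc
    have e3 : qComm q (qComm q a e) d = _ := qComm_assoc h.ad e
    simp only [qComm_add_left, qComm_sub_left, qComm_smul_left, e2, e3, h1', hbd] at e1
    simp only [qComm_add_right, qComm_sub_right, qComm_smul_right, e1, hae, hab, hac, h1,
      h.ad.eq, h.ac.eq]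
    module
  · have e1 : qComm q a (qComm q (qComm q b (qComm q c d)) a) =
        qComm q (qComm q a (qComm q b a)) (qComm q c d) := by
      have hz : Commute a (qComm q c d) := h.ac.qComm_right h.ad
      rw [qComm_right_comm hz.symm, qComm_assoc hz]
    have e2 : qComm q a (qComm q (qComm q e a) a) = qComm q (qComm q a (qComm q e a)) a :=
      (qComm_assoc (Commute.refl a) _).symm
    have e2' : qComm q a (qComm q (qComm q b a) a) = qComm q (qComm q a (qComm q b a)) a :=
      (qComm_assoc (Commute.refl a) _).symm
    have e3 : qComm q a (qComm q (qComm q e d) a) = qComm q (qComm q a (qComm q e a)) d := by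
      rw [qComm_right_comm h.ad.symm, qComm_assoc h.ad]
    have e4 : qComm q a (a * c) = a * a * c := by
      rw [qComm_of_commute hq ((Commute.refl a).mul_right h.ac), mul_assoc]
    have hz : Commute a (qComm q c d) := h.ac.qComm_right h.ad
    have e5 : qComm q a (qComm q c d) = a * qComm q c d := qComm_of_commute hq hz
    have e6 : qComm q (d * a) (qComm q c d) = a * qComm q d (qComm q c d) := by
      rw [← h.ad.eq, qComm_mul_left hz]
    have e7 : qComm q (c * a) a = a * a * c := by
      rw [← h.ac.eq, qComm_mul_left (Commute.refl a), qComm_of_commute hq h.ac.symm, ← h.ac.eq,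
        mul_assoc]
    have e8 : qComm q (d * a) a = a * a * d := by
      rw [← h.ad.eq, qComm_mul_left (Commute.refl a), qComm_of_commute hq h.ad.symm, ← h.ad.eq,
        mul_assoc]
    have e9 : qComm q c a = a * c := by rw [qComm_of_commute hq h.ac.symm, h.ac.eq]
    have e10 : qComm q d a = a * d := by rw [qComm_of_commute hq h.ad.symm, h.ad.eq]
    have e11 : qComm q (c * a) d = a * qComm q c d := by
      rw [← h.ac.eq, qComm_mul_left h.ad]
    have e12 : qComm q a a = a * a := qComm_of_commute hq (Commute.refl a)
    simp only [qComm_add_right, qComm_sub_right, qComm_smul_right, qComm_add_left,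
      qComm_sub_left, qComm_smul_left, e1, e2, e2', e3, e4, hae, hab, had, h1', e5, e6,
      e7, e8, e9, e10, e11, e12, hdc, mul_add, mul_sub, mul_smul_comm, mul_one, mul_assoc]
    module


/-- A cubic relation obtained from the others and two of the pentagon relations. -/
theorem PentCubic.of_pentRel (hq : q - q⁻¹ ≠ 0) (h : PentComm a b c d e)
    (hbc : PentCubic q c b e c₄ c₃ c₂) (hba : PentCubic q a b d c₁ c₂ c₃)
    (hde : PentCubic q e d b c₁ c₀ c₄) (Ha : PentRel q e a b c d c₄ c₁ c₂)
    (He : PentRel q d e a b c c₃ c₀ c₁) : PentCubic q c d a c₃ c₄ c₀ := by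
  unfold PentCubic at *
  unfold PentRel at *
  have h1 (x : A) : qComm q x (1 : A) = x := by
    rw [qComm_of_commute hq (Commute.one_right x), mul_one]
  have h1' (x : A) : qComm q (1 : A) x = x := by
    rw [qComm_of_commute hq (Commute.one_left x), one_mul]
  have e1 : qComm q d (qComm q e (qComm q a b)) = qComm q (qComm q d (qComm q e a)) b := by
    rw [← qComm_assoc h.be.symm, qComm_assoc h.bd.symm]
  have e2 : qComm q (qComm q b c) b = _ := (qComm_assoc (Commute.refl b) c).trans hbc
  have e3 : qComm q (qComm q b a) b = _ := (qComm_assoc (Commute.refl b) a).trans hba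
  have e4 : qComm q (qComm q d c) b = _ := qComm_assoc h.bd.symm c
  have hbe := qComm_of_commute hq h.be.symm
  have had := qComm_of_commute hq h.ad.symm
  -- `Ha` expresses `[c, d]` through `[e, [a, b]]`. Its bracket with `d` is `[[d, [e, a]], b]`,
  -- which `He` reduces to `[[b, c], b]` and simpler terms, all known by the three given cubic
  -- relations.
  rw [eq_sub_of_add_eq' Ha]
  simp only [qComm_add_right, qComm_sub_right, qComm_smul_right, e1, eq_sub_of_add_eq He,
    qComm_add_left, qComm_sub_left, qComm_smul_left, e2, e3, e4, h1, h1', hde, hbe, had,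
    h.ad.eq, h.bd.eq]
  module

theorem qComm_sub_swap (x y : A) :
    qComm q x y - qComm q y x = ((q - q⁻¹)⁻¹ * (q + q⁻¹)) • (x * y - y * x) := by
  simp only [qComm]; module

theorem qComm_qComm_sub_swap (hq : q - q⁻¹ ≠ 0) {x z : A} (h : Commute x z) (y : A) :
    qComm q x (qComm q y z) - qComm q z (qComm q y x) =
      ((q - q⁻¹)⁻¹ * (q + q⁻¹)) • (x * y * z - z * y * x) := by
  have h1 : z * (x * y) = x * (z * y) := by rw [← mul_assoc, ← h.eq, mul_assoc]
  have h2 : y * (x * z) = y * (z * x) := by rw [h.eq]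
  simp only [qComm, sub_mul, mul_sub, smul_mul_assoc, mul_smul_comm, mul_assoc, h1, h2]
  have h3 := inv_mul_cancel₀ hq
  generalize (q - q⁻¹)⁻¹ = t at h3 ⊢
  generalize q⁻¹ = p at h3 ⊢
  match_scalars <;> first
    | ring1
    | linear_combination t * (q + p) * h3
    | linear_combination -t * (q + p) * h3

/-- A Jacobi identity in which the inner brackets are `q`-commutators and the outer ones ordinary
commutators; it needs no commutation of the arguments. -/
theorem commutator_qComm (x y z : A) :
    x * qComm q y z - qComm q y z * x =
      (qComm q x y * z - z * qComm q x y) - (y * qComm q z x - qComm q z x * y) := by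
  simp only [qComm, sub_mul, mul_sub, smul_mul_assoc, mul_smul_comm, mul_assoc]
  module

theorem commutator_qComm_add (hq : q - q⁻¹ ≠ 0) {x z : A} (h : Commute x z) (y : A) :
    (x * qComm q z y - qComm q z y * x) + (qComm q x y * z - z * qComm q x y) =
      x * y * z - z * y * x := by
  have h1 : z * (x * y) = x * (z * y) := by rw [← mul_assoc, ← h.eq, mul_assoc]
  have h2 : y * (x * z) = y * (z * x) := by rw [h.eq]
  simp only [qComm, sub_mul, mul_sub, smul_mul_assoc, mul_smul_comm, mul_assoc, h1, h2]
  have h3 := inv_mul_cancel₀ hq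
  generalize (q - q⁻¹)⁻¹ = t at h3 ⊢
  generalize q⁻¹ = p at h3 ⊢
  match_scalars <;> first
    | ring1
    | linear_combination h3
    | linear_combination -h3

/-- The image of a diagonal under the half twist along the crossing diagonal `e`; the diagonal
`c` crosses neither of them. -/
def pentTwist (q : K) (e a c : A) (r s : R) : A := -qComm q e a + r • c + s • (1 : A)

theorem qComm_pentTwist (hq : q - q⁻¹ ≠ 0)
    (He : PentRel q d e a b c c₃ c₀ c₁) :
    qComm q d (pentTwist q e a c c₁ (c₀ * c₂)) =
      qComm q b c - c₃ • e - c₀ • qComm q b a + (c₀ * c₁ * c₃) • (1 : A) + (c₀ * c₂) • d := by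
  unfold PentRel at He
  have h1 (x : A) : qComm q x (1 : A) = x := by
    rw [qComm_of_commute hq (Commute.one_right x), mul_one]
  simp only [pentTwist, qComm_add_right, qComm_neg_right, qComm_smul_right,
    eq_sub_of_add_eq He, h1]
  module

/-- The half twist preserves the commutation of the diagonals `a` and `d`. -/
theorem PentComm.commute_pentTwist (hq : q - q⁻¹ ≠ 0) (hq' : q + q⁻¹ ≠ 0)
    (h : PentComm a b c d e) (hea : PentCubic q a e c c₂ c₁ c₀)
    (Ha : PentRel q e a b c d c₄ c₁ c₂) (Ha' : PentRel q b a e d c c₄ c₂ c₁)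
    (He : PentRel q d e a b c c₃ c₀ c₁) :
    Commute (pentTwist q e a c c₁ (c₀ * c₂)) (pentTwist q e d b c₀ (c₁ * c₄)) := by
  have h1' (x : A) : qComm q (1 : A) x = x := by
    rw [qComm_of_commute hq (Commute.one_left x), one_mul]
  -- Subtracting the reflected pentagon relation `Ha'` from `Ha` leaves only ordinary commutators,
  -- with the common factor `(q + q⁻¹) / (q - q⁻¹)`. Cancelling this factor is where `q² ≠ -1` is
  -- needed.
  have key : e * a * b - b * a * e + (c * d - d * c) - c₁ • (c * b - b * c)
      - c₂ • (e * d - d * e) = 0 := by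
    have e0 : (q - q⁻¹)⁻¹ * (q + q⁻¹) ≠ 0 := mul_ne_zero (inv_ne_zero hq) hq'
    unfold PentRel at Ha Ha'
    have e1 := qComm_qComm_sub_swap hq h.be.symm a
    have e2 := qComm_sub_swap (q := q) c d
    have e3 := qComm_sub_swap (q := q) c b
    have e4 := qComm_sub_swap (q := q) e d
    have e5 : ((q - q⁻¹)⁻¹ * (q + q⁻¹)) • (e * a * b - b * a * e + (c * d - d * c)
        - c₁ • (c * b - b * c) - c₂ • (e * d - d * e)) = 0 := by
      rw [smul_sub, smul_sub, smul_add, smul_comm _ c₁, smul_comm _ c₂, ← e1, ← e2, ← e3, ← e4]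
      linear_combination (norm := module) Ha - Ha'
    exact (smul_eq_zero_iff_right e0).mp e5
  -- Bracketing back with `e` undoes the twist: the cubic relation reduces the double bracket to
  -- terms without brackets.
  have hP : qComm q (pentTwist q e a c c₁ (c₀ * c₂)) e =
      c₀ • c + (c₁ * c₂) • (1 : A) - a := by
    unfold PentCubic at hea
    simp only [pentTwist, qComm_add_left, qComm_neg_left, qComm_smul_left, h1',
      qComm_assoc (Commute.refl e), hea, qComm_of_commute hq h.ce]
    module
  have hM := qComm_pentTwist (c₂ := c₂) hq He
  have e1 := commutator_qComm (q := q) (pentTwist q e a c c₁ (c₀ * c₂)) e d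
  rw [hP, hM] at e1
  have e2 : pentTwist q e a c c₁ (c₀ * c₂) * b - b * pentTwist q e a c c₁ (c₀ * c₂) =
      -(qComm q e a * b - b * qComm q e a) + c₁ • (c * b - b * c) := by
    simp only [pentTwist, add_mul, mul_add, neg_mul, mul_neg, smul_mul_assoc, mul_smul_comm,
      one_mul, mul_one]
    module
  have e3 := commutator_qComm_add hq h.be.symm a
  have hbc : e * qComm q b c = qComm q b c * e := (h.be.symm.qComm_right h.ce.symm).eq
  rw [commute_iff_eq, ← sub_eq_zero]
  have e4 : ∀ x : A, x * pentTwist q e d b c₀ (c₁ * c₄) - pentTwist q e d b c₀ (c₁ * c₄) * x =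
      -(x * qComm q e d - qComm q e d * x) + c₀ • (x * b - b * x) := by
    intro x
    simp only [pentTwist, add_mul, mul_add, neg_mul, mul_neg, smul_mul_assoc, mul_smul_comm,
      one_mul, mul_one]
    module
  rw [e4, e1, e2]
  have e5 : c₀ • (e * a * b - b * a * e + (c * d - d * c) - c₁ • (c * b - b * c)
      - c₂ • (e * d - d * e)) = 0 := by rw [key, smul_zero]
  simp only [add_mul, mul_add, sub_mul, mul_sub, smul_mul_assoc, mul_smul_comm,
      one_mul, mul_one, hbc, h.ad.eq] at e5 e3 ⊢
  linear_combination (norm := module) -e5 - c₀ • e3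

/-- The half twist preserves the cubic relation between the diagonals `b` and `a`. -/
theorem PentComm.pentCubic_pentTwist (hq : q - q⁻¹ ≠ 0) (h : PentComm a b c d e)
    (hae : PentCubic q e a c c₀ c₁ c₂) (hcb : PentCubic q b c e c₂ c₃ c₄)
    (Ha : PentRel q e a b c d c₄ c₁ c₂) (He : PentRel q d e a b c c₃ c₀ c₁)
    (Hb : PentRel q c b a e d c₀ c₃ c₂)
    (hc : Commute (pentTwist q e a c c₁ (c₀ * c₂)) (pentTwist q e d b c₀ (c₁ * c₄))) :
    PentCubic q b (pentTwist q e a c c₁ (c₀ * c₂)) (pentTwist q e d b c₀ (c₁ * c₄)) c₃ c₂ c₀ := by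
  have h1 (x : A) : qComm q x (1 : A) = x := by
    rw [qComm_of_commute hq (Commute.one_right x), mul_one]
  have h1' (x : A) : qComm q (1 : A) x = x := by
    rw [qComm_of_commute hq (Commute.one_left x), one_mul]
  have hM := qComm_pentTwist (c₂ := c₂) hq He
  unfold PentCubic PentRel at *
  have e1 : qComm q (pentTwist q e a c c₁ (c₀ * c₂)) b =
      qComm q c d - c₄ • a + c₂ • pentTwist q e d b c₀ (c₁ * c₄) := by
    simp only [pentTwist, qComm_add_left, qComm_neg_left, qComm_smul_left, h1',
      qComm_assoc h.be.symm, eq_sub_of_add_eq Ha]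
    module
  have e2 : qComm q (qComm q c d) (pentTwist q e a c c₁ (c₀ * c₂)) =
      qComm q c (qComm q d (pentTwist q e a c c₁ (c₀ * c₂))) := by
    refine qComm_assoc ?_ d
    unfold pentTwist
    exact ((h.ce.qComm_right h.ac.symm).neg_right.add_right
      ((Commute.refl c).smul_right _)).add_right ((Commute.one_right c).smul_right _)
  have e3 : qComm q a (pentTwist q e a c c₁ (c₀ * c₂)) = -e + (c₀ * c₁) • (1 : A) + c₂ • c := by
    simp only [pentTwist, qComm_add_right, qComm_neg_right, qComm_smul_right, h1, hae,
      qComm_of_commute hq h.ac, h.ac.eq]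
    module
  -- The double bracket is read as `[[P, b], P]` with `P` the twisted `a`. By `e1`, `[P, b]`
  -- consists of `[c, d]`, `a` and the twisted `d`, and each of these has a known bracket with `P`:
  -- through `[d, P]`, through `[a, P]`, and through the commutation `hc`.
  rw [← qComm_assoc (Commute.refl _), e1, qComm_add_left, qComm_sub_left, e2, qComm_smul_left,
    qComm_smul_left, e3, hM, qComm_of_commute hq hc.symm]
  simp only [qComm_add_right, qComm_sub_right, qComm_smul_right, h1, hcb, eq_sub_of_add_eq Hb,
    qComm_of_commute hq h.ce, h.ce.eq]
  generalize pentTwist q e d b c₀ (c₁ * c₄) * pentTwist q e a c c₁ (c₀ * c₂) = y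
  unfold pentTwist
  module

end Pentagon

/-! ### Pentagons whose sides are elements of the algebra -/

section PentagonElements

variable {K : Type*} [Field K] {A : Type*} [Ring A] [Algebra K A]

/-- The sides of a pentagon commute with each other and with the diagonals. -/
structure PentSides (a b c d e c₀ c₁ c₂ c₃ c₄ : A) : Prop where
  diag : ∀ s ∈ [c₀, c₁, c₂, c₃, c₄], ∀ x ∈ [a, b, c, d, e], Commute s x
  side : ∀ s ∈ [c₀, c₁, c₂, c₃, c₄], ∀ t ∈ [c₀, c₁, c₂, c₃, c₄], Commute s t

/-- `PentCubic` with sides that are elements of the algebra. -/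
def MulPentCubic (q : K) (y x z r s t : A) : Prop :=
  qComm q x (qComm q y x) = y + r * t * x + s * (z * x) - r * s - t * z

/-- `PentRel` with sides that are elements of the algebra. -/
def MulPentRel (q : K) (a b c d e c₀ c₂ c₃ : A) : Prop :=
  qComm q a (qComm q b c) + qComm q d e =
    c₀ * b + c₂ * qComm q d c + c₃ * qComm q a e - c₀ * c₂ * c₃

/-- `pentTwist` with sides that are elements of the algebra. -/
def mulPentTwist (q : K) (e a c r s : A) : A := -qComm q e a + r * c + s

variable {q : K} {a b c d e c₀ c₁ c₂ c₃ c₄ : A}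

theorem PentSides.rotate (h : PentSides a b c d e c₀ c₁ c₂ c₃ c₄) :
    PentSides b c d e a c₁ c₂ c₃ c₄ c₀ where
  diag s hs x hx := h.diag s (by simp at hs ⊢; tauto) x (by simp at hx ⊢; tauto)
  side s hs t ht := h.side s (by simp at hs ⊢; tauto) t (by simp at ht ⊢; tauto)

theorem PentSides.reflect (h : PentSides a b c d e c₀ c₁ c₂ c₃ c₄) :
    PentSides c b a e d c₀ c₄ c₃ c₂ c₁ where
  diag s hs x hx := h.diag s (by simp at hs ⊢; tauto) x (by simp at hx ⊢; tauto)
  side s hs t ht := h.side s (by simp at hs ⊢; tauto) t (by simp at ht ⊢; tauto)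

/-- The sides are not central in `A`, but they are central in their common centralizer, which
contains the diagonals. Inside it the centre serves as the ring of scalars of the previous part. -/
theorem PentSides.exists_lift (K : Type*) [Field K] [Algebra K A]
    (h : PentSides a b c d e c₀ c₁ c₂ c₃ c₄) :
    ∃ (B : Subalgebra K A) (a' b' c' d' e' : B) (c₀' c₁' c₂' c₃' c₄' : Subalgebra.center K B),
      (a' : A) = a ∧ (b' : A) = b ∧ (c' : A) = c ∧ (d' : A) = d ∧ (e' : A) = e ∧
      ((c₀' : B) : A) = c₀ ∧ ((c₁' : B) : A) = c₁ ∧ ((c₂' : B) : A) = c₂ ∧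
      ((c₃' : B) : A) = c₃ ∧ ((c₄' : B) : A) = c₄ := by
  set S : Set A := {s | s ∈ [c₀, c₁, c₂, c₃, c₄]} with hS
  have hd : ∀ x ∈ [a, b, c, d, e], x ∈ Subalgebra.centralizer K S := fun x hx =>
    (Subalgebra.mem_centralizer_iff K).2 fun s hs => (h.diag s hs x hx).eq
  have hc : ∀ x (hx : x ∈ [c₀, c₁, c₂, c₃, c₄]),
      ∃ y : Subalgebra.center K (Subalgebra.centralizer K S), ((y : _) : A) = x := by
    intro x hx
    refine ⟨⟨⟨x, (Subalgebra.mem_centralizer_iff K).2 fun s hs => (h.side s hs x hx).eq⟩,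
      Subalgebra.mem_center_iff.2 fun y => Subtype.ext ?_⟩, rfl⟩
    exact ((Subalgebra.mem_centralizer_iff K).1 y.2 x hx).symm
  obtain ⟨y₀, h₀⟩ := hc c₀ (by simp)
  obtain ⟨y₁, h₁⟩ := hc c₁ (by simp)
  obtain ⟨y₂, h₂⟩ := hc c₂ (by simp)
  obtain ⟨y₃, h₃⟩ := hc c₃ (by simp)
  obtain ⟨y₄, h₄⟩ := hc c₄ (by simp)
  exact ⟨_, ⟨a, hd a (by simp)⟩, ⟨b, hd b (by simp)⟩, ⟨c, hd c (by simp)⟩, ⟨d, hd d (by simp)⟩,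
    ⟨e, hd e (by simp)⟩, y₀, y₁, y₂, y₃, y₄, rfl, rfl, rfl, rfl, rfl, h₀, h₁, h₂, h₃, h₄⟩

noncomputable instance centerAlgebra : Algebra (Subalgebra.center K A) A where
  algebraMap := (Subalgebra.center K A).val.toRingHom
  commutes' r x := (Subalgebra.mem_center_iff.1 r.2 x).symm
  smul_def' _ _ := rfl

theorem center_smul (r : Subalgebra.center K A) (x : A) : r • x = r * x := rfl

theorem coe_qComm {B : Subalgebra K A} (x y : B) :
    ((qComm q x y : B) : A) = qComm q (x : A) (y : A) :=
  map_qComm B.val x y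

theorem pentCubic_coe {B : Subalgebra K A} (y x z : B) (r s t : Subalgebra.center K B) :
    MulPentCubic q (y : A) x z (r : B) (s : B) (t : B) ↔ PentCubic q y x z r s t := by
  rw [PentCubic, ← Subtype.coe_inj]
  simp [coe_qComm, center_smul, MulPentCubic]

theorem pentRel_coe {B : Subalgebra K A} (a b c d e : B) (r s t : Subalgebra.center K B) :
    MulPentRel q (a : A) b c d e (r : B) (s : B) (t : B) ↔ PentRel q a b c d e r s t := by
  rw [PentRel, ← Subtype.coe_inj]
  simp [coe_qComm, center_smul, MulPentRel]

theorem pentTwist_coe {B : Subalgebra K A} (e a c : B) (r s : Subalgebra.center K B) :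
    ((pentTwist q e a c r s : B) : A) = mulPentTwist q (e : A) a c (r : B) (s : B) := by
  simp [pentTwist, mulPentTwist, coe_qComm, center_smul]

theorem commute_coe {B : Subalgebra K A} {x y : B} : Commute (x : A) y ↔ Commute x y := by
  rw [commute_iff_eq, commute_iff_eq, ← Subtype.coe_inj]; rfl

theorem pentComm_coe {B : Subalgebra K A} {a b c d e : B} :
    PentComm (a : A) b c d e ↔ PentComm a b c d e := by
  constructor <;> rintro ⟨h1, h2, h3, h4, h5⟩ <;> constructor
  all_goals first | exact commute_coe.1 (by assumption) | exact commute_coe.2 (by assumption)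

theorem MulPentRel.rotate (hq : q - q⁻¹ ≠ 0) (h : PentComm a b c d e)
    (hs : PentSides a b c d e c₀ c₁ c₂ c₃ c₄)
    (hde : MulPentCubic q e d b c₁ c₀ c₄) (hdc : MulPentCubic q c d a c₃ c₄ c₀)
    (hae : MulPentCubic q e a c c₀ c₁ c₂) (hab : MulPentCubic q b a d c₃ c₂ c₁)
    (H : MulPentRel q a b c d e c₀ c₂ c₃) : MulPentRel q b c d e a c₁ c₃ c₄ := by
  obtain ⟨B, a, b, c, d, e, c₀, c₁, c₂, c₃, c₄, rfl, rfl, rfl, rfl, rfl, rfl, rfl, rfl, rfl, rfl⟩ :=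
    hs.exists_lift K
  simp only [pentComm_coe, pentCubic_coe, pentRel_coe] at *
  exact H.rotate hq h hde hdc hae hab

theorem MulPentCubic.of_pentRel (hq : q - q⁻¹ ≠ 0) (h : PentComm a b c d e)
    (hs : PentSides a b c d e c₀ c₁ c₂ c₃ c₄)
    (hbc : MulPentCubic q c b e c₄ c₃ c₂) (hba : MulPentCubic q a b d c₁ c₂ c₃)
    (hde : MulPentCubic q e d b c₁ c₀ c₄) (Ha : MulPentRel q e a b c d c₄ c₁ c₂)
    (He : MulPentRel q d e a b c c₃ c₀ c₁) : MulPentCubic q c d a c₃ c₄ c₀ := by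
  obtain ⟨B, a, b, c, d, e, c₀, c₁, c₂, c₃, c₄, rfl, rfl, rfl, rfl, rfl, rfl, rfl, rfl, rfl, rfl⟩ :=
    hs.exists_lift K
  simp only [pentComm_coe, pentCubic_coe, pentRel_coe] at *
  exact .of_pentRel hq h hbc hba hde Ha He

theorem PentComm.commute_mulPentTwist (hq : q - q⁻¹ ≠ 0) (hq' : q + q⁻¹ ≠ 0)
    (h : PentComm a b c d e) (hs : PentSides a b c d e c₀ c₁ c₂ c₃ c₄)
    (hea : MulPentCubic q a e c c₂ c₁ c₀)
    (Ha : MulPentRel q e a b c d c₄ c₁ c₂) (Ha' : MulPentRel q b a e d c c₄ c₂ c₁)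
    (He : MulPentRel q d e a b c c₃ c₀ c₁) :
    Commute (mulPentTwist q e a c c₁ (c₀ * c₂)) (mulPentTwist q e d b c₀ (c₁ * c₄)) := by
  obtain ⟨B, a, b, c, d, e, c₀, c₁, c₂, c₃, c₄, rfl, rfl, rfl, rfl, rfl, rfl, rfl, rfl, rfl, rfl⟩ :=
    hs.exists_lift K
  simp only [pentComm_coe, pentCubic_coe, pentRel_coe] at *
  simpa only [← commute_coe, pentTwist_coe, MulMemClass.coe_mul] using
    h.commute_pentTwist hq hq' hea Ha Ha' He

theorem PentComm.mulPentCubic_mulPentTwist (hq : q - q⁻¹ ≠ 0) (h : PentComm a b c d e)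
    (hs : PentSides a b c d e c₀ c₁ c₂ c₃ c₄)
    (hae : MulPentCubic q e a c c₀ c₁ c₂) (hcb : MulPentCubic q b c e c₂ c₃ c₄)
    (Ha : MulPentRel q e a b c d c₄ c₁ c₂) (He : MulPentRel q d e a b c c₃ c₀ c₁)
    (Hb : MulPentRel q c b a e d c₀ c₃ c₂)
    (hc : Commute (mulPentTwist q e a c c₁ (c₀ * c₂)) (mulPentTwist q e d b c₀ (c₁ * c₄))) :
    MulPentCubic q b (mulPentTwist q e a c c₁ (c₀ * c₂)) (mulPentTwist q e d b c₀ (c₁ * c₄))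
      c₃ c₂ c₀ := by
  obtain ⟨B, a, b, c, d, e, c₀, c₁, c₂, c₃, c₄, rfl, rfl, rfl, rfl, rfl, rfl, rfl, rfl, rfl, rfl⟩ :=
    hs.exists_lift K
  have e1 := pentTwist_coe (q := q) e a c c₁ (c₀ * c₂)
  have e2 := pentTwist_coe (q := q) e d b c₀ (c₁ * c₄)
  push_cast at e1 e2
  rw [← e1, ← e2] at hc ⊢
  simp only [pentComm_coe, pentCubic_coe, pentRel_coe, commute_coe] at *
  exact h.pentCubic_pentTwist hq hae hcb Ha He Hb hc

end PentagonElements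

/-! ### Families indexed by the chords of a polygon -/

section Families

variable {K : Type*} [Field K] {A : Type*} [Ring A] [Algebra K A]

/-- The relations between the elements `x i j = C_{i+1…j}` of `aw(n)`, where `i < j ≤ n`. -/
structure IsAW (q : K) (n : ℕ) (x : ℕ → ℕ → A) : Prop where
  comm_disj : ∀ i j k l, i < j → j ≤ k → k < l → l ≤ n → Commute (x i j) (x k l)
  comm_nest : ∀ i j k l, i ≤ k → k < l → l ≤ j → j ≤ n → Commute (x i j) (x k l)
  cubic : ∀ i j k l, i < j → j < k → k < l → l ≤ n →
    qComm q (x j l) (qComm q (x i k) (x j l)) =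
      x i k + (x i j * x k l) * x j l + x j k * x i l * x j l - x i j * x j k - x k l * x i l
  cubic' : ∀ i j k l, i < j → j < k → k < l → l ≤ n →
    qComm q (x i k) (qComm q (x j l) (x i k)) =
      x j l + (x i j * x k l) * x i k + x j k * x i l * x i k - x k l * x j k - x i j * x i l
  pent : ∀ i j k l m, i < j → j < k → k < l → l < m → m ≤ n →
    MulPentRel q (x i k) (x j l) (x k m) (x i l) (x j m) (x i m) (x j k) (x k l)
  pent' : ∀ i j k l m, i < j → j < k → k < l → l < m → m ≤ n →
    MulPentRel q (x k m) (x j l) (x i k) (x j m) (x i l) (x i m) (x k l) (x j k)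

/-- A family of elements indexed by the chords of an `N`-gon such that the elements of
non-crossing chords commute. -/
structure CycComm (N : ℤ) (X : ℤ → ℤ → A) : Prop where
  symm : ∀ i j, X i j = X j i
  periodic : ∀ i j, X (i + N) j = X i j
  diag : ∀ i, X i i = 1
  comm : ∀ i j k l, i ≤ j → j ≤ k → k ≤ l → l ≤ i + N → Commute (X i j) (X k l)

/-- The cubic relation of the chords of a quadrangle. -/
def Cubic (q : K) (X : ℤ → ℤ → A) (i j k l : ℤ) : Prop :=
  qComm q (X j l) (qComm q (X i k) (X j l)) =
    X i k + (X i j * X k l) * X j l + X j k * X i l * X j l - X i j * X j k - X k l * X i l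

/-- The relation of the chords of a pentagon. -/
def Pent (q : K) (X : ℤ → ℤ → A) (i j k l m : ℤ) : Prop :=
  MulPentRel q (X i k) (X j l) (X k m) (X i l) (X j m) (X i m) (X j k) (X k l)

/-- The reflected relation of the chords of a pentagon. -/
def Pent' (q : K) (X : ℤ → ℤ → A) (i j k l m : ℤ) : Prop :=
  MulPentRel q (X k m) (X j l) (X i k) (X j m) (X i l) (X i m) (X k l) (X j k)

/-- A family of elements indexed by the chords of an `N`-gon which satisfies the relations that
involve at most four vertices. -/
structure CycCubic (q : K) (N : ℤ) (X : ℤ → ℤ → A) : Prop extends CycComm N X where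
  cubic : ∀ i j k l, i ≤ j → j ≤ k → k ≤ l → l ≤ i + N → Cubic q X i j k l

/-- A family of elements indexed by the chords of an `N`-gon which satisfies the relations of the
Askey–Wilson algebra in a form that is invariant under the rotations of the polygon. -/
structure CycAW (q : K) (N : ℤ) (X : ℤ → ℤ → A) : Prop extends CycCubic q N X where
  pent : ∀ i j k l m, i ≤ j → j ≤ k → k ≤ l → l ≤ m → m ≤ i + N → Pent q X i j k l m
  pent' : ∀ i j k l m, i ≤ j → j ≤ k → k ≤ l → l ≤ m → m ≤ i + N → Pent' q X i j k l m

variable {q : K} {N : ℤ} {X : ℤ → ℤ → A}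

namespace CycComm

variable (H : CycComm N X)
include H

theorem periodic' (i j : ℤ) : X i (j + N) = X i j := by
  rw [H.symm, H.periodic, H.symm]

theorem periodic_sub (i j : ℤ) : X (i - N) j = X i j := by
  rw [← H.periodic (i - N), sub_add_cancel]

/-- Up to a full turn the chord `(i, l)` is `(l, i + N)`, so nested chords are a case of consecutive
ones. -/
theorem comm' {i j k l : ℤ} (h₁ : i ≤ j) (h₂ : j ≤ k) (h₃ : k ≤ l) (h₄ : l ≤ i + N) :
    Commute (X i l) (X j k) := by
  rw [H.symm i l, ← H.periodic' l i]
  exact (H.comm j k l (i + N) h₂ h₃ h₄ (by omega)).symm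

theorem pentComm {i j k l m : ℤ} (h₁ : i ≤ j) (h₂ : j ≤ k) (h₃ : k ≤ l) (h₄ : l ≤ m)
    (h₅ : m ≤ i + N) : PentComm (X i k) (X j l) (X k m) (X i l) (X j m) where
  ac := H.comm _ _ _ _ (by omega) le_rfl (by omega) h₅
  ad := (H.comm' le_rfl (by omega) h₃ (by omega)).symm
  bd := (H.comm' h₁ (by omega) le_rfl (by omega)).symm
  be := (H.comm' le_rfl (by omega) h₄ (by omega)).symm
  ce := (H.comm' h₂ (by omega) le_rfl (by omega)).symm

theorem pentSides {i j k l m : ℤ} (h₁ : i ≤ j) (h₂ : j ≤ k) (h₃ : k ≤ l) (h₄ : l ≤ m)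
    (h₅ : m ≤ i + N) : PentSides (X i k) (X j l) (X k m) (X i l) (X j m)
      (X i m) (X i j) (X j k) (X k l) (X l m) := by
  constructor <;> intro s hs x hx <;>
    simp only [List.mem_cons, List.not_mem_nil, or_false] at hs hx <;>
    rcases hs with rfl | rfl | rfl | rfl | rfl <;> rcases hx with rfl | rfl | rfl | rfl | rfl
  all_goals first
    | exact H.comm _ _ _ _ (by omega) (by omega) (by omega) (by omega)
    | exact (H.comm _ _ _ _ (by omega) (by omega) (by omega) (by omega)).symm
    | exact H.comm' (by omega) (by omega) (by omega) (by omega)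
    | exact (H.comm' (by omega) (by omega) (by omega) (by omega)).symm

end CycComm

/-- A property of quadruples that is invariant under the translation by `N` needs to be checked
only for the rotations of quadruples in `{0, …, N - 1}`. -/
theorem cyclic_four {N : ℤ} (hN : 0 < N) {P : ℤ → ℤ → ℤ → ℤ → Prop}
    (hP : ∀ i j k l, P (i + N) (j + N) (k + N) (l + N) ↔ P i j k l)
    (h : ∀ i j k l, 0 ≤ i → i ≤ j → j ≤ k → k ≤ l → l < N →
      P i j k l ∧ P j k l (i + N) ∧ P k l (i + N) (j + N) ∧ P l (i + N) (j + N) (k + N))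
    {i j k l : ℤ} (h₁ : i ≤ j) (h₂ : j ≤ k) (h₃ : k ≤ l) (h₄ : l ≤ i + N) : P i j k l := by
  have hs : ∀ t i j k l : ℤ, P (i + t * N) (j + t * N) (k + t * N) (l + t * N) ↔ P i j k l := by
    intro t
    induction t with
    | zero => simp
    | succ t ih =>
      intro i j k l
      have := hP (i + t * N) (j + t * N) (k + t * N) (l + t * N)
      rw [ih] at this
      simpa only [add_mul, one_mul, add_assoc] using this
    | pred t ih =>
      intro i j k l
      rw [← ih i, ← hP]
      simp only [sub_mul, one_mul, add_assoc, sub_add_cancel]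
  wlog hi : 0 ≤ i ∧ i < N generalizing i j k l
  · rw [← hs (-(i / N))]
    have e1 := Int.emod_nonneg i hN.ne'
    have e2 := Int.emod_lt_of_pos i hN
    have e3 : i + -(i / N) * N = i % N := by rw [Int.emod_def]; ring
    exact this (by omega) (by omega) (by omega) (by omega) (by omega)
  -- Vertices that are at least `N` are moved back by a full turn and put in front; their number
  -- decides which of the rotations is used.
  obtain ⟨hi0, hiN⟩ := hi
  rcases lt_or_ge l N with hl | hl
  · exact (h i j k l hi0 h₁ h₂ h₃ hl).1
  rcases lt_or_ge k N with hk | hk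
  · simpa using (h (l - N) i j k (by omega) (by omega) h₁ h₂ hk).2.1
  rcases lt_or_ge j N with hj | hj
  · simpa using (h (k - N) (l - N) i j (by omega) (by omega) (by omega) h₁ hj).2.2.1
  · simpa using (h (j - N) (k - N) (l - N) i (by omega) (by omega) (by omega) (by omega) hiN).2.2.2

/-- A property of quintuples that is invariant under the translation by `N` needs to be checked
only for the rotations of quintuples in `{0, …, N - 1}`. -/
theorem cyclic_five {N : ℤ} (hN : 0 < N) {P : ℤ → ℤ → ℤ → ℤ → ℤ → Prop}
    (hP : ∀ i j k l m, P (i + N) (j + N) (k + N) (l + N) (m + N) ↔ P i j k l m)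
    (h : ∀ i j k l m, 0 ≤ i → i ≤ j → j ≤ k → k ≤ l → l ≤ m → m < N →
      P i j k l m ∧ P j k l m (i + N) ∧ P k l m (i + N) (j + N) ∧
      P l m (i + N) (j + N) (k + N) ∧ P m (i + N) (j + N) (k + N) (l + N))
    {i j k l m : ℤ} (h₁ : i ≤ j) (h₂ : j ≤ k) (h₃ : k ≤ l) (h₄ : l ≤ m) (h₅ : m ≤ i + N) :
    P i j k l m := by
  have hs : ∀ t i j k l m : ℤ,
      P (i + t * N) (j + t * N) (k + t * N) (l + t * N) (m + t * N) ↔ P i j k l m := by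
    intro t
    induction t with
    | zero => simp
    | succ t ih =>
      intro i j k l m
      have := hP (i + t * N) (j + t * N) (k + t * N) (l + t * N) (m + t * N)
      rw [ih] at this
      simpa only [add_mul, one_mul, add_assoc] using this
    | pred t ih =>
      intro i j k l m
      rw [← ih i, ← hP]
      simp only [sub_mul, one_mul, add_assoc, sub_add_cancel]
  wlog hi : 0 ≤ i ∧ i < N generalizing i j k l m
  · rw [← hs (-(i / N))]
    have e1 := Int.emod_nonneg i hN.ne'
    have e2 := Int.emod_lt_of_pos i hN
    have e3 : i + -(i / N) * N = i % N := by rw [Int.emod_def]; ring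
    exact this (by omega) (by omega) (by omega) (by omega) (by omega) (by omega)
  obtain ⟨hi0, hiN⟩ := hi
  rcases lt_or_ge m N with hm | hm
  · exact (h i j k l m hi0 h₁ h₂ h₃ h₄ hm).1
  rcases lt_or_ge l N with hl | hl
  · simpa using (h (m - N) i j k l (by omega) (by omega) h₁ h₂ h₃ hl).2.1
  rcases lt_or_ge k N with hk | hk
  · simpa using (h (l - N) (m - N) i j k (by omega) (by omega) (by omega) h₁ h₂ hk).2.2.1
  rcases lt_or_ge j N with hj | hj
  · simpa using
      (h (k - N) (l - N) (m - N) i j (by omega) (by omega) (by omega) (by omega) h₁ hj).2.2.2.1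
  · simpa using (h (j - N) (k - N) (l - N) (m - N) i (by omega) (by omega) (by omega) (by omega)
      (by omega) hiN).2.2.2.2

namespace CycCubic

variable (H : CycCubic q N X)
include H

theorem mulPentCubic {i j k l : ℤ} (h₁ : i ≤ j) (h₂ : j ≤ k) (h₃ : k ≤ l) (h₄ : l ≤ i + N) :
    MulPentCubic q (X i k) (X j l) (X i l) (X i j) (X j k) (X k l) := by
  have := H.cubic i j k l h₁ h₂ h₃ h₄
  simpa only [Cubic, MulPentCubic, mul_assoc] using this

/-- Rotating a quadrangle by one vertex exchanges its diagonals, so the cubic relation with the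
other diagonal repeated is the relation of `(j, k, l, i + N)`. -/
theorem mulPentCubic' {i j k l : ℤ} (h₁ : i ≤ j) (h₂ : j ≤ k) (h₃ : k ≤ l) (h₄ : l ≤ i + N) :
    MulPentCubic q (X j l) (X i k) (X i l) (X k l) (X j k) (X i j) := by
  have := H.cubic j k l (i + N) h₂ h₃ h₄ (by omega)
  simp only [Cubic, H.periodic', H.symm k i, H.symm l i, H.symm j i] at this
  rw [MulPentCubic, this, (H.comm j k k l h₂ le_rfl h₃ (by omega)).eq,
    (H.comm' (i := i) (l := l) le_rfl h₁ (by omega) h₄).eq]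
  simp only [mul_assoc]
  abel

theorem pent_rotate (hq : q - q⁻¹ ≠ 0) {i j k l m : ℤ} (h₁ : i ≤ j) (h₂ : j ≤ k) (h₃ : k ≤ l)
    (h₄ : l ≤ m) (h₅ : m ≤ i + N) (h : Pent q X i j k l m) : Pent q X j k l m (i + N) := by
  have hde := H.mulPentCubic' (i := l) (j := m) (k := i + N) (l := j + N) h₄ h₅ (by omega)
    (by omega)
  have hdc := H.mulPentCubic (i := k) (j := l) (k := m) (l := i + N) h₃ h₄ h₅ (by omega)
  have hae := H.mulPentCubic (i := m) (j := i + N) (k := j + N) (l := k + N) h₅ (by omega)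
    (by omega) (by omega)
  have hab := H.mulPentCubic' (i := i) (j := j) (k := k) (l := l) h₁ h₂ h₃ (by omega)
  simp only [H.periodic, H.periodic', H.symm l j, H.symm l i, H.symm m j, H.symm m i, H.symm m k,
    H.symm k i] at hde hdc hae
  have := MulPentRel.rotate hq (H.pentComm h₁ h₂ h₃ h₄ h₅) (H.pentSides h₁ h₂ h₃ h₄ h₅)
    hde hdc hae hab h
  simpa only [Pent, H.periodic', H.symm l i, H.symm k i, H.symm j i] using this

/-- The reflected relation is the pentagon relation for the reversed cyclic order. The rotation
lemma, applied to the reflected labels, therefore moves the vertices in the opposite direction. -/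
theorem pent'_rotate (hq : q - q⁻¹ ≠ 0) {i j k l m : ℤ} (h₁ : i ≤ j) (h₂ : j ≤ k) (h₃ : k ≤ l)
    (h₄ : l ≤ m) (h₅ : m ≤ i + N) (h : Pent' q X i j k l m) :
    Pent' q X (m - N) i j k l := by
  have hde := H.mulPentCubic (i := l) (j := m) (k := i + N) (l := j + N) h₄ h₅ (by omega)
    (by omega)
  have hdc := H.mulPentCubic' (i := m) (j := i + N) (k := j + N) (l := k + N) h₅ (by omega)
    (by omega) (by omega)
  have hae := H.mulPentCubic' (i := k) (j := l) (k := m) (l := i + N) h₃ h₄ h₅ (by omega)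
  have hab := H.mulPentCubic (i := j) (j := k) (k := l) (l := m) h₂ h₃ h₄ (by omega)
  simp only [H.periodic, H.periodic', H.symm l j, H.symm l i, H.symm m j, H.symm m i, H.symm m k,
    H.symm k i] at hde hdc hae
  have := MulPentRel.rotate hq (H.pentComm h₁ h₂ h₃ h₄ h₅).reflect
    (H.pentSides h₁ h₂ h₃ h₄ h₅).reflect hde hdc hae hab h
  simpa only [Pent', H.periodic_sub, H.symm m j, H.symm m k, H.symm m l] using this

end CycCubic

/-! ### Quadrangles and pentagons with merged vertices -/

section Degenerate

/-- When two neighbouring vertices merge, the diagonals no longer cross and every bracket is a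
product. Admitting such quadrangles spares case distinctions later, where chosen vertices may
coincide modulo `N`. -/
theorem CycComm.cubic_of_lt (hq : q - q⁻¹ ≠ 0) (H : CycComm N X)
    (h : ∀ i j k l, i < j → j < k → k < l → l < i + N → Cubic q X i j k l)
    {i j k l : ℤ} (h₁ : i ≤ j) (h₂ : j ≤ k) (h₃ : k ≤ l) (h₄ : l ≤ i + N) : Cubic q X i j k l := by
  rcases h₁.eq_or_lt with rfl | h₁'
  · have h5 : Commute (X i k) (X i l) := (H.comm' h₁ h₂ h₃ h₄).symm
    rw [Cubic, H.diag, qComm_of_commute hq h5,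
      qComm_of_commute hq (h5.symm.mul_right (Commute.refl _)), ← mul_assoc, ← h5.eq]
    simp only [one_mul]
    abel
  rcases h₂.eq_or_lt with rfl | h₂'
  · have h5 : Commute (X i j) (X j l) := H.comm _ _ _ _ h₁ h₂ h₃ h₄
    have h6 : Commute (X i l) (X j l) := H.comm' h₁ h₃ le_rfl h₄
    rw [Cubic, H.diag, qComm_of_commute hq h5,
      qComm_of_commute hq (h5.symm.mul_right (Commute.refl _)), ← mul_assoc, ← h5.eq, one_mul,
      mul_one, h6.eq]
    abel
  rcases h₃.eq_or_lt with rfl | h₃'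
  · have h5 : Commute (X i k) (X j k) := H.comm' h₁ h₂ le_rfl h₄
    rw [Cubic, H.diag, qComm_of_commute hq h5,
      qComm_of_commute hq (h5.symm.mul_right (Commute.refl _)), one_mul, mul_one, mul_assoc]
    abel
  rcases h₄.eq_or_lt with rfl | h₄'
  · have h5 : Commute (X i k) (X i j) := H.comm' le_rfl h₁ h₂ (by omega)
    have h6 : Commute (X k i) (X j i) := by
      rw [H.symm k i, H.symm j i]
      exact h5
    have h7 : Commute (X j k) (X j i) := by
      rw [H.symm j i]
      exact (H.comm _ _ _ _ h₁ le_rfl h₂ h₃).symm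
    rw [Cubic, H.periodic', H.periodic', H.periodic', H.diag, H.symm i k, H.symm i j,
      qComm_of_commute hq h6, qComm_of_commute hq (h6.symm.mul_right (Commute.refl _))]
    simp only [mul_one, mul_assoc, h6.eq, h7.eq]
    abel
  exact h i j k l h₁' h₂' h₃' h₄'

variable {a b c d e c₀ c₂ c₃ : A}

theorem mulPentRel_of_eq₁ (hq : q - q⁻¹ ≠ 0) (hab : Commute a b) (hac : Commute a c)
    (hbe : Commute b e) (hae : Commute a e) (h3a : Commute c₃ a) (h3e : Commute c₃ e) :
    MulPentRel q a b c b e e a c₃ := by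
  rw [MulPentRel, qComm_of_commute hq (hab.qComm_right hac), qComm_of_commute hq hbe,
    qComm_of_commute hq hae, (h3a.mul_right h3e).eq, hbe.eq, hae.eq]
  abel

theorem mulPentRel_of_eq₂ (hq : q - q⁻¹ ≠ 0) (hab : Commute a b) (hbe : Commute b e) :
    MulPentRel q a b e d e c₀ 1 b := by
  rw [MulPentRel, qComm_of_commute hq hbe, qComm_mul_right hab.symm, one_mul, mul_one]
  abel

theorem mulPentRel_of_eq₃ (hq : q - q⁻¹ ≠ 0) (hab : Commute a b) (hbc : Commute b c) :
    MulPentRel q a b c a e c₀ b 1 := by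
  rw [MulPentRel, qComm_of_commute hq hbc, qComm_mul_right hab.symm, one_mul, mul_one]
  abel

theorem mulPentRel_of_eq₄ (hq : q - q⁻¹ ≠ 0) (hbc : Commute b c) (hac : Commute a c)
    (hdb : Commute d b) (hdc : Commute d c) (h2d : Commute c₂ d) :
    MulPentRel q a b c d b d c₂ c := by
  rw [MulPentRel, qComm_of_commute hq hbc, hbc.eq, qComm_mul_right hac.symm,
    qComm_of_commute hq hdb, qComm_of_commute hq hdc, ← h2d.eq, mul_assoc]
  abel

theorem mulPentRel_of_eq₅ (hq : q - q⁻¹ ≠ 0) (hde : Commute d e) (hda : Commute d a)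
    (hae : Commute a e)
    (h : qComm q a (qComm q b a) = b + c₂ * d * a + c₃ * e * a - c₂ * c₃ - d * e) :
    MulPentRel q a b a d e 1 c₂ c₃ := by
  rw [MulPentRel, h, qComm_of_commute hq hde, qComm_of_commute hq hda, qComm_of_commute hq hae,
    hae.eq]
  simp only [one_mul, mul_assoc]
  abel

/-- Merging two neighbouring vertices makes the relation a consequence of commutation, except when
the last one meets the first after a full turn: then `k` is the vertex opposite the merged one, and
a cubic relation remains. -/
theorem CycCubic.pent_of_lt (hq : q - q⁻¹ ≠ 0) (H : CycCubic q N X)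
    (h : ∀ i j k l m, i < j → j < k → k < l → l < m → m < i + N → Pent q X i j k l m)
    {i j k l m : ℤ} (h₁ : i ≤ j) (h₂ : j ≤ k) (h₃ : k ≤ l) (h₄ : l ≤ m) (h₅ : m ≤ i + N) :
    Pent q X i j k l m := by
  have hc := H.pentComm h₁ h₂ h₃ h₄ h₅
  have hs := H.pentSides h₁ h₂ h₃ h₄ h₅
  rcases h₁.eq_or_lt with rfl | h₁'
  · exact mulPentRel_of_eq₁ hq hc.ad hc.ac hc.be (hs.diag _ (by simp) _ (by simp))
      (hs.diag _ (by simp) _ (by simp)) (hs.diag _ (by simp) _ (by simp))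
  rcases h₂.eq_or_lt with rfl | h₂'
  · rw [Pent, H.diag]
    exact mulPentRel_of_eq₂ hq (hs.diag _ (by simp) _ (by simp)).symm hc.be
  rcases h₃.eq_or_lt with rfl | h₃'
  · rw [Pent, H.diag]
    exact mulPentRel_of_eq₃ hq (hs.diag _ (by simp) _ (by simp)).symm
      (hs.diag _ (by simp) _ (by simp))
  rcases h₄.eq_or_lt with rfl | h₄'
  · exact mulPentRel_of_eq₄ hq hc.ce.symm hc.ac hc.bd.symm (hs.diag _ (by simp) _ (by simp))
      (hs.diag _ (by simp) _ (by simp))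
  rcases h₅.eq_or_lt with rfl | h₅'
  · rw [Pent, H.periodic', H.periodic', H.periodic', H.diag, H.symm k i, H.symm j i]
    simp only [H.periodic', H.symm j i] at hs
    refine mulPentRel_of_eq₅ hq (hs.diag _ (by simp) _ (by simp)).symm hc.ad.symm
      (hs.diag _ (by simp) _ (by simp)).symm ?_
    rw [H.mulPentCubic' h₁ h₂ h₃ (by omega),
      (hs.side (X i j) (by simp) (X i l) (by simp [H.symm l i])).eq,
      (hs.side (X k l) (by simp) (X j k) (by simp)).eq]
    simp only [mul_assoc]
    abel
  exact h i j k l m h₁' h₂' h₃' h₄' h₅'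

theorem CycCubic.pent'_of_lt (hq : q - q⁻¹ ≠ 0) (H : CycCubic q N X)
    (h : ∀ i j k l m, i < j → j < k → k < l → l < m → m < i + N → Pent' q X i j k l m)
    {i j k l m : ℤ} (h₁ : i ≤ j) (h₂ : j ≤ k) (h₃ : k ≤ l) (h₄ : l ≤ m) (h₅ : m ≤ i + N) :
    Pent' q X i j k l m := by
  have hc := H.pentComm h₁ h₂ h₃ h₄ h₅
  have hs := H.pentSides h₁ h₂ h₃ h₄ h₅
  rcases h₁.eq_or_lt with rfl | h₁'
  · exact mulPentRel_of_eq₄ hq hc.ad.symm hc.ac.symm hc.be.symm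
      (hs.diag _ (by simp) _ (by simp)) (hs.diag _ (by simp) _ (by simp))
  rcases h₂.eq_or_lt with rfl | h₂'
  · rw [Pent', H.diag]
    exact mulPentRel_of_eq₃ hq (hs.diag _ (by simp) _ (by simp)).symm
      (hs.diag _ (by simp) _ (by simp))
  rcases h₃.eq_or_lt with rfl | h₃'
  · rw [Pent', H.diag]
    exact mulPentRel_of_eq₂ hq (hs.diag _ (by simp) _ (by simp)).symm hc.bd
  rcases h₄.eq_or_lt with rfl | h₄'
  · exact mulPentRel_of_eq₁ hq hc.ce hc.ac.symm hc.bd (hs.diag _ (by simp) _ (by simp))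
      (hs.diag _ (by simp) _ (by simp)) (hs.diag _ (by simp) _ (by simp))
  rcases h₅.eq_or_lt with rfl | h₅'
  · rw [Pent', H.periodic', H.periodic', H.periodic', H.diag, H.symm k i, H.symm j i]
    simp only [H.periodic', H.symm j i] at hs
    refine mulPentRel_of_eq₅ hq (hs.diag _ (by simp) _ (by simp))
      (hs.diag _ (by simp) _ (by simp)) hc.ad ?_
    rw [H.mulPentCubic' h₁ h₂ h₃ (by omega)]
    simp only [mul_assoc]
  exact h i j k l m h₁' h₂' h₃' h₄' h₅'

end Degenerate

end Families

/-! ### Rotation invariance of the defining relations -/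

section Extension

variable {K : Type*} [Field K] {A : Type*} [Ring A] [Algebra K A] {q : K} {n : ℕ}
  {x : ℕ → ℕ → A}

/-- The extension of a family `x i j`, where `i < j ≤ n`, to the chords of an `(n + 1)`-gon. -/
def chordExt (n : ℕ) (x : ℕ → ℕ → A) (i j : ℤ) : A :=
  if (i % (n + 1)).toNat = (j % (n + 1)).toNat then 1
  else x (min (i % (n + 1)).toNat (j % (n + 1)).toNat) (max (i % (n + 1)).toNat (j % (n + 1)).toNat)

theorem chordExt_coe {i j : ℕ} (h : i < j) (hj : j ≤ n) : chordExt n x i j = x i j := by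
  have e1 : ((i : ℤ) % (n + 1)).toNat = i := by
    rw [Int.emod_eq_of_lt (by omega) (by omega), Int.toNat_natCast]
  have e2 : ((j : ℤ) % (n + 1)).toNat = j := by
    rw [Int.emod_eq_of_lt (by omega) (by omega), Int.toNat_natCast]
  rw [chordExt, e1, e2, if_neg h.ne, min_eq_left h.le, max_eq_right h.le]

theorem chordExt_symm (i j : ℤ) : chordExt n x i j = chordExt n x j i := by
  simp only [chordExt, min_comm (i % _).toNat, max_comm (i % _).toNat, eq_comm (a := (i % _).toNat)]

theorem chordExt_periodic (i j : ℤ) : chordExt n x (i + (n + 1)) j = chordExt n x i j := by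
  simp only [chordExt, Int.add_emod_right]

theorem chordExt_diag (i : ℤ) : chordExt n x i i = 1 := by
  simp [chordExt]

theorem IsAW.chordExt_comm (h : IsAW q n x) {i j k l : ℕ} (h₁ : i ≤ j) (h₂ : j ≤ k) (h₃ : k ≤ l)
    (h₄ : l ≤ n) : Commute (chordExt n x i j) (chordExt n x k l) := by
  rcases h₁.eq_or_lt with rfl | h₁
  · rw [chordExt_diag]; exact Commute.one_left _
  rcases h₃.eq_or_lt with rfl | h₃
  · rw [chordExt_diag]; exact Commute.one_right _
  rw [chordExt_coe h₁ (by omega), chordExt_coe h₃ (by omega)]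
  exact h.comm_disj i j k l h₁ h₂ h₃ h₄

theorem IsAW.chordExt_comm' (h : IsAW q n x) {i j k l : ℕ} (h₁ : i ≤ j) (h₂ : j ≤ k) (h₃ : k ≤ l)
    (h₄ : l ≤ n) : Commute (chordExt n x i l) (chordExt n x j k) := by
  rcases (h₁.trans (h₂.trans h₃)).eq_or_lt with rfl | h₁'
  · rw [chordExt_diag]; exact Commute.one_left _
  rcases h₂.eq_or_lt with rfl | h₂
  · rw [chordExt_diag]; exact Commute.one_right _
  rw [chordExt_coe h₁' (by omega), chordExt_coe h₂ (by omega)]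
  exact h.comm_nest i l j k h₁ h₂ h₃ h₄

theorem IsAW.cycComm (h : IsAW q n x) : CycComm (n + 1) (chordExt n x) where
  symm := chordExt_symm
  periodic := chordExt_periodic
  diag := chordExt_diag
  comm i j k l h₁ h₂ h₃ h₄ := by
    have hper' : ∀ i j : ℤ, chordExt n x i (j + (n + 1)) = chordExt n x i j := fun i j => by
      rw [chordExt_symm, chordExt_periodic, chordExt_symm]
    refine cyclic_four (by omega)
      (P := fun i j k l => Commute (chordExt n x i j) (chordExt n x k l)) ?_ ?_ h₁ h₂ h₃ h₄
    · intro i j k l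
      simp only [chordExt_periodic, hper']
    · clear h₁ h₂ h₃ h₄ i j k l
      intro i j k l h₀ h₁ h₂ h₃ h₄
      lift i to ℕ using h₀
      lift j to ℕ using by omega
      lift k to ℕ using by omega
      lift l to ℕ using by omega
      simp only [chordExt_periodic, hper', chordExt_symm l i]
      norm_cast at *
      have e1 := h.chordExt_comm h₁ h₂ h₃ (by omega)
      have e2 := h.chordExt_comm' h₁ h₂ h₃ (by omega)
      exact ⟨e1, e2.symm, e1.symm, e2⟩

theorem IsAW.cycCubic (hq : q - q⁻¹ ≠ 0) (h : IsAW q n x) :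
    CycCubic q (n + 1) (chordExt n x) where
  __ := h.cycComm
  cubic i j k l h₁ h₂ h₃ h₄ := by
    have H := h.cycComm
    refine H.cubic_of_lt hq ?_ h₁ h₂ h₃ h₄
    clear h₁ h₂ h₃ h₄ i j k l
    intro i j k l h₁ h₂ h₃ h₄
    refine cyclic_four (N := n + 1) (by omega) (P := fun i j k l => i < j → j < k → k < l →
      l < i + (n + 1) → Cubic q (chordExt n x) i j k l) ?_ ?_ h₁.le h₂.le h₃.le h₄.le h₁ h₂ h₃ h₄
    · intro i j k l
      simp only [Cubic, H.periodic, H.periodic', add_lt_add_iff_right]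
    · clear h₁ h₂ h₃ h₄ i j k l
      intro i j k l h₀ h₁ h₂ h₃ h₄
      by_cases hlt : i < j ∧ j < k ∧ k < l
      swap
      · refine ⟨?_, ?_, ?_, ?_⟩ <;> intros <;> omega
      clear h₁ h₂ h₃
      obtain ⟨h₁, h₂, h₃⟩ := hlt
      have c1 := H.comm i j k l h₁.le h₂.le h₃.le (by omega)
      have c2 := H.comm' h₁.le h₂.le h₃.le (by omega)
      have c3 := H.comm j k k l h₂.le le_rfl h₃.le (by omega)
      have c4 := H.comm' (i := i) (l := l) le_rfl h₁.le (by omega) (by omega)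
      lift i to ℕ using h₀
      lift j to ℕ using by omega
      lift k to ℕ using by omega
      lift l to ℕ using by omega
      simp only [Cubic, H.periodic, H.periodic', H.symm l i, H.symm l j, H.symm k i, H.symm k j,
        H.symm j i, H.symm l k]
      norm_cast at *
      have e1 := h.cubic i j k l h₁ h₂ h₃ (by omega)
      have e2 := h.cubic' i j k l h₁ h₂ h₃ (by omega)
      rw [← chordExt_coe (x := x) (i := i) (j := j) (n := n) (by omega) (by omega),
        ← chordExt_coe (x := x) (i := i) (j := k) (n := n) (by omega) (by omega),
        ← chordExt_coe (x := x) (i := i) (j := l) (n := n) (by omega) (by omega),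
        ← chordExt_coe (x := x) (i := j) (j := k) (n := n) (by omega) (by omega),
        ← chordExt_coe (x := x) (i := j) (j := l) (n := n) (by omega) (by omega),
        ← chordExt_coe (x := x) (i := k) (j := l) (n := n) (by omega) (by omega)] at e1 e2
      -- Each rotation exchanges the diagonals, so the two cubic relations alternate; up to the
      -- order of commuting factors nothing else changes.
      refine ⟨fun _ _ _ _ => e1, fun _ _ _ _ => e2.trans ?_, fun _ _ _ _ => e1.trans ?_,
        fun _ _ _ _ => e2.trans ?_⟩
      · rw [c1.eq, c3.eq, c4.eq]; abel
      · rw [c1.eq, ← c2.eq]; abel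
      · rw [c2.eq, c3.eq, c4.eq]; abel

theorem IsAW.cycAW (hq : q - q⁻¹ ≠ 0) (h : IsAW q n x) : CycAW q (n + 1) (chordExt n x) where
  __ := h.cycCubic hq
  pent i j k l m h₁ h₂ h₃ h₄ h₅ := by
    have H := h.cycCubic hq
    refine H.pent_of_lt hq ?_ h₁ h₂ h₃ h₄ h₅
    clear h₁ h₂ h₃ h₄ h₅ i j k l m
    intro i j k l m h₁ h₂ h₃ h₄ h₅
    refine cyclic_five (N := n + 1) (by omega) (P := fun i j k l m => i < j → j < k → k < l →
      l < m → m < i + (n + 1) → Pent q (chordExt n x) i j k l m) ?_ ?_ h₁.le h₂.le h₃.le h₄.le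
      h₅.le h₁ h₂ h₃ h₄ h₅
    · intro i j k l m
      simp only [Pent, H.periodic, H.periodic', add_lt_add_iff_right]
    · clear h₁ h₂ h₃ h₄ h₅ i j k l m
      intro i j k l m h₀ h₁ h₂ h₃ h₄ h₅
      by_cases hlt : i < j ∧ j < k ∧ k < l ∧ l < m
      swap
      · refine ⟨?_, ?_, ?_, ?_, ?_⟩ <;> intros <;> omega
      clear h₁ h₂ h₃ h₄
      obtain ⟨h₁, h₂, h₃, h₄⟩ := hlt
      have e1 : Pent q (chordExt n x) i j k l m := by
        lift i to ℕ using h₀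
        lift j to ℕ using by omega
        lift k to ℕ using by omega
        lift l to ℕ using by omega
        lift m to ℕ using by omega
        norm_cast at *
        have := h.pent i j k l m h₁ h₂ h₃ h₄ (by omega)
        rw [Pent]
        repeat rw [chordExt_coe (by omega) (by omega)]
        exact this
      have e2 := H.pent_rotate hq h₁.le h₂.le h₃.le h₄.le (by omega) e1
      have e3 := H.pent_rotate hq h₂.le h₃.le h₄.le (by omega) (by omega) e2
      have e4 := H.pent_rotate hq h₃.le h₄.le (by omega) (by omega) (by omega) e3
      have e5 := H.pent_rotate hq h₄.le (by omega) (by omega) (by omega) (by omega) e4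
      exact ⟨fun _ _ _ _ _ => e1, fun _ _ _ _ _ => e2, fun _ _ _ _ _ => e3,
        fun _ _ _ _ _ => e4, fun _ _ _ _ _ => e5⟩
  pent' i j k l m h₁ h₂ h₃ h₄ h₅ := by
    have H := h.cycCubic hq
    refine H.pent'_of_lt hq ?_ h₁ h₂ h₃ h₄ h₅
    clear h₁ h₂ h₃ h₄ h₅ i j k l m
    intro i j k l m h₁ h₂ h₃ h₄ h₅
    have hP : ∀ i j k l m : ℤ, Pent' q (chordExt n x) (i + (n + 1)) (j + (n + 1)) (k + (n + 1))
        (l + (n + 1)) (m + (n + 1)) ↔ Pent' q (chordExt n x) i j k l m := by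
      intro i j k l m
      simp only [Pent', H.periodic, H.periodic']
    refine cyclic_five (N := n + 1) (by omega) (P := fun i j k l m => i < j → j < k → k < l →
      l < m → m < i + (n + 1) → Pent' q (chordExt n x) i j k l m) ?_ ?_ h₁.le h₂.le h₃.le h₄.le
      h₅.le h₁ h₂ h₃ h₄ h₅
    · intro i j k l m
      simp only [hP, add_lt_add_iff_right]
    · clear h₁ h₂ h₃ h₄ h₅ i j k l m
      intro i j k l m h₀ h₁ h₂ h₃ h₄ h₅
      by_cases hlt : i < j ∧ j < k ∧ k < l ∧ l < m
      swap
      · refine ⟨?_, ?_, ?_, ?_, ?_⟩ <;> intros <;> omega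
      clear h₁ h₂ h₃ h₄
      obtain ⟨h₁, h₂, h₃, h₄⟩ := hlt
      have e1 : Pent' q (chordExt n x) i j k l m := by
        lift i to ℕ using h₀
        lift j to ℕ using by omega
        lift k to ℕ using by omega
        lift l to ℕ using by omega
        lift m to ℕ using by omega
        norm_cast at *
        have := h.pent' i j k l m h₁ h₂ h₃ h₄ (by omega)
        rw [Pent']
        repeat rw [chordExt_coe (by omega) (by omega)]
        exact this
      have r : ∀ {i j k l m : ℤ}, i ≤ j → j ≤ k → k ≤ l → l ≤ m + (n + 1) → m ≤ i →
          Pent' q (chordExt n x) i j k l (m + (n + 1)) → Pent' q (chordExt n x) m i j k l := by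
        intro i j k l m h₁ h₂ h₃ h₄ h₅ e
        simpa using H.pent'_rotate hq h₁ h₂ h₃ h₄ (by omega) e
      -- Reflected relations rotate backwards, so the chain starts from the translate of `e1` by a
      -- full turn and reaches the remaining rotations in descending order.
      have e5 := r (by omega) (by omega) (by omega) (by omega) (by omega) ((hP ..).2 e1)
      have e4 := r (by omega) (by omega) (by omega) (by omega) (by omega) e5
      have e3 := r (by omega) (by omega) (by omega) (by omega) (by omega) e4
      have e2 := r (by omega) (by omega) (by omega) (by omega) (by omega) e3
      exact ⟨fun _ _ _ _ _ => e1, fun _ _ _ _ _ => e2, fun _ _ _ _ _ => e3,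
        fun _ _ _ _ _ => e4, fun _ _ _ _ _ => e5⟩

end Extension

/-! ### The half twist as a linear operation on relations -/

section HalfTwist

variable {K : Type*} [Field K] {A : Type*} [Ring A] [Algebra K A]

/-- The combination that describes the effect of a half twist on a generator. -/
def halfTwist (q : K) (e p r x z w : A) : A := -qComm q e x + p * z + r * w

/-- `y` commutes with the three elements `e`, `p`, `r` that define a half twist. -/
structure TwistFixed (e p r y : A) : Prop where
  e : Commute e y
  p : Commute p y
  r : Commute r y

variable {q : K} {e p r x z w x' z' w' y y' : A}

theorem TwistFixed.qComm (h : TwistFixed e p r y) (h' : TwistFixed e p r y') :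
    TwistFixed e p r (qComm q y y') :=
  ⟨h.e.qComm_right h'.e, h.p.qComm_right h'.p, h.r.qComm_right h'.r⟩

theorem halfTwist_add : halfTwist q e p r x z w + halfTwist q e p r x' z' w' =
    halfTwist q e p r (x + x') (z + z') (w + w') := by
  simp only [halfTwist, qComm_add_right, mul_add]; abel

theorem halfTwist_sub : halfTwist q e p r x z w - halfTwist q e p r x' z' w' =
    halfTwist q e p r (x - x') (z - z') (w - w') := by
  simp only [halfTwist, qComm_sub_right, mul_sub]; abel

/-- Bracketing or multiplying by an element that commutes with `e`, `p` and `r` passes through the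
half twist. Hence a relation that is linear in the twisted entries holds for them if it holds for
the triples `x`, `z`, `w` separately. -/
theorem TwistFixed.qComm_halfTwist (h : TwistFixed e p r y) (x z w : A) :
    AskeyWilson.qComm q y (halfTwist q e p r x z w) =
      halfTwist q e p r (AskeyWilson.qComm q y x) (AskeyWilson.qComm q y z)
        (AskeyWilson.qComm q y w) := by
  simp only [halfTwist, qComm_add_right, qComm_neg_right, qComm_left_comm h.e.symm,
    qComm_mul_right h.p, qComm_mul_right h.r]

theorem TwistFixed.halfTwist_qComm (h : TwistFixed e p r y) (x z w : A) :
    AskeyWilson.qComm q (halfTwist q e p r x z w) y =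
      halfTwist q e p r (AskeyWilson.qComm q x y) (AskeyWilson.qComm q z y)
        (AskeyWilson.qComm q w y) := by
  simp only [halfTwist, qComm_add_left, qComm_neg_left, qComm_assoc h.e,
    qComm_mul_left h.p, qComm_mul_left h.r]

theorem TwistFixed.mul_halfTwist (h : TwistFixed e p r y) (x z w : A) :
    y * halfTwist q e p r x z w = halfTwist q e p r (y * x) (y * z) (y * w) := by
  simp only [halfTwist, mul_add, mul_neg, qComm_mul_right h.e.symm, h.p.left_comm, h.r.left_comm]

theorem TwistFixed.halfTwist_mul (h : TwistFixed e p r y) (x z w : A) :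
    halfTwist q e p r x z w * y = halfTwist q e p r (x * y) (z * y) (w * y) := by
  simp only [halfTwist, add_mul, neg_mul, qComm_mul_right' h.e.symm, mul_assoc]

theorem commute_halfTwist (h : TwistFixed e p r y) (hx : Commute x y) (hz : Commute z y)
    (hw : Commute w y) : Commute (halfTwist q e p r x z w) y :=
  (((h.e.qComm_left hx).neg_left).add_left (h.p.mul_left hz)).add_left (h.r.mul_left hw)

variable {x₁ x₂ x₃ z₁ z₂ z₃ w₁ w₂ w₃ s t u v y₁ y₂ y₃ y₄ y₅ : A}

theorem MulPentCubic.halfTwist (h₁ : TwistFixed e p r y₁) (h₂ : TwistFixed e p r y₂)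
    (h₃ : TwistFixed e p r y₃) (hx : MulPentCubic q x₁ y₁ x₂ x₃ y₂ y₃)
    (hz : MulPentCubic q z₁ y₁ z₂ z₃ y₂ y₃) (hw : MulPentCubic q w₁ y₁ w₂ w₃ y₂ y₃) :
    MulPentCubic q (halfTwist q e p r x₁ z₁ w₁) y₁ (halfTwist q e p r x₂ z₂ w₂)
      (halfTwist q e p r x₃ z₃ w₃) y₂ y₃ := by
  unfold MulPentCubic at *
  simp only [h₁.halfTwist_qComm, h₁.qComm_halfTwist, h₁.halfTwist_mul, h₂.halfTwist_mul,
    h₂.mul_halfTwist, h₃.halfTwist_mul, h₃.mul_halfTwist, halfTwist_add, halfTwist_sub, hx, hz, hw]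

theorem MulPentRel.halfTwist_ade (h₁ : TwistFixed e p r y₁) (h₂ : TwistFixed e p r y₂)
    (h₃ : TwistFixed e p r y₃) (h₄ : TwistFixed e p r y₄) (h₅ : TwistFixed e p r y₅)
    (hx : MulPentRel q x₁ y₁ y₂ x₂ y₃ x₃ y₄ y₅) (hz : MulPentRel q z₁ y₁ y₂ z₂ y₃ z₃ y₄ y₅)
    (hw : MulPentRel q w₁ y₁ y₂ w₂ y₃ w₃ y₄ y₅) :
    MulPentRel q (halfTwist q e p r x₁ z₁ w₁) y₁ y₂ (halfTwist q e p r x₂ z₂ w₂) y₃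
      (halfTwist q e p r x₃ z₃ w₃) y₄ y₅ := by
  unfold MulPentRel at *
  simp only [(h₁.qComm h₂).halfTwist_qComm, h₂.halfTwist_qComm, h₃.halfTwist_qComm,
    h₁.halfTwist_mul, h₄.halfTwist_mul, h₄.mul_halfTwist, h₅.halfTwist_mul, h₅.mul_halfTwist,
    halfTwist_add, halfTwist_sub, hx, hz, hw]

theorem MulPentRel.halfTwist_ce (h₁ : TwistFixed e p r y₁) (h₂ : TwistFixed e p r y₂)
    (h₃ : TwistFixed e p r y₃) (h₄ : TwistFixed e p r y₄) (h₅ : TwistFixed e p r y₅)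
    (hx : MulPentRel q y₁ y₂ x₁ y₃ x₂ x₃ y₄ y₅) (hz : MulPentRel q y₁ y₂ z₁ y₃ z₂ z₃ y₄ y₅)
    (hw : MulPentRel q y₁ y₂ w₁ y₃ w₂ w₃ y₄ y₅) :
    MulPentRel q y₁ y₂ (halfTwist q e p r x₁ z₁ w₁) y₃ (halfTwist q e p r x₂ z₂ w₂)
      (halfTwist q e p r x₃ z₃ w₃) y₄ y₅ := by
  unfold MulPentRel at *
  simp only [h₁.qComm_halfTwist, h₂.qComm_halfTwist, h₃.qComm_halfTwist,
    h₂.halfTwist_mul, h₄.halfTwist_mul, h₄.mul_halfTwist, h₅.halfTwist_mul, h₅.mul_halfTwist,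
    halfTwist_add, halfTwist_sub, hx, hz, hw]

theorem MulPentRel.halfTwist_be (h₁ : TwistFixed e p r y₁) (h₂ : TwistFixed e p r y₂)
    (h₃ : TwistFixed e p r y₃) (h₄ : TwistFixed e p r y₄) (h₅ : TwistFixed e p r y₅)
    (hx : MulPentRel q y₁ x₁ y₂ y₃ x₂ y₄ x₃ y₅) (hz : MulPentRel q y₁ z₁ y₂ y₃ z₂ y₄ z₃ y₅)
    (hw : MulPentRel q y₁ w₁ y₂ y₃ w₂ y₄ w₃ y₅) :
    MulPentRel q y₁ (halfTwist q e p r x₁ z₁ w₁) y₂ y₃ (halfTwist q e p r x₂ z₂ w₂) y₄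
      (halfTwist q e p r x₃ z₃ w₃) y₅ := by
  unfold MulPentRel at *
  simp only [h₂.halfTwist_qComm, h₁.qComm_halfTwist, h₃.qComm_halfTwist, h₄.mul_halfTwist,
    (h₃.qComm h₂).halfTwist_mul, h₅.halfTwist_mul, h₅.mul_halfTwist,
    halfTwist_add, halfTwist_sub, hx, hz, hw]

theorem MulPentRel.halfTwist_bd (h₁ : TwistFixed e p r y₁) (h₂ : TwistFixed e p r y₂)
    (h₃ : TwistFixed e p r y₃) (h₄ : TwistFixed e p r y₄) (h₅ : TwistFixed e p r y₅)
    (hx : MulPentRel q y₁ x₁ y₂ x₂ y₃ y₄ y₅ x₃) (hz : MulPentRel q y₁ z₁ y₂ z₂ y₃ y₄ y₅ z₃)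
    (hw : MulPentRel q y₁ w₁ y₂ w₂ y₃ y₄ y₅ w₃) :
    MulPentRel q y₁ (halfTwist q e p r x₁ z₁ w₁) y₂ (halfTwist q e p r x₂ z₂ w₂) y₃ y₄ y₅
      (halfTwist q e p r x₃ z₃ w₃) := by
  unfold MulPentRel at *
  simp only [mul_assoc] at *
  simp only [h₂.halfTwist_qComm, h₃.halfTwist_qComm, h₁.qComm_halfTwist, h₄.mul_halfTwist,
    (h₁.qComm h₃).halfTwist_mul, h₅.mul_halfTwist, halfTwist_add, halfTwist_sub, hx, hz, hw]

/-- The cubic relation depends on the sides of its quadrangle only through two sums: that of the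
products of opposite sides, and that of the products of the two sides meeting at each end of the
repeated diagonal. Relabelling the quadrangle preserves both. -/
theorem MulPentCubic.congr (h : MulPentCubic q y x z s t u) (hγ : s * u + t * z = x₁ * x₃ + x₂ * v)
    (hα : s * t + u * z = x₁ * x₂ + x₃ * v) : MulPentCubic q y x v x₁ x₂ x₃ := by
  have e1 : (s * u + t * z) * x = (x₁ * x₃ + x₂ * v) * x := by rw [hγ]
  have e2 : y + s * u * x + t * (z * x) - s * t - u * z =
      y + (s * u + t * z) * x - (s * t + u * z) := by
    rw [add_mul, mul_assoc t z x]; abel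
  unfold MulPentCubic at *
  rw [h, e2, e1, hα, add_mul, mul_assoc x₂]
  abel

end HalfTwist

/-! ### The half twist preserves the relations -/

section TwistFamily

variable {K : Type*} [Field K] {A : Type*} [Ring A] [Algebra K A] {q : K} {N : ℤ}
  {X : ℤ → ℤ → A}

/-- The image of the chord `(0, y)` under the half twist that exchanges the sides at the
vertex `0`. -/
def chordTwist (q : K) (X : ℤ → ℤ → A) (y : ℤ) : A :=
  halfTwist q (X (-1) 1) (X (-1) 0) (X 0 1) (X 0 y) (X 1 y) (X (-1) y)

namespace CycAW

variable (H : CycAW q N X)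
include H

/-- In the pentagon relation every vertex except the middle one occurs once in each term. This
rotation and the next are further forms that are linear in the chords at `i`, ready for the half
twist at `i = 0`. -/
theorem pent_last {i j k l m : ℤ} (h₁ : i ≤ j) (h₂ : j ≤ k) (h₃ : k ≤ l) (h₄ : l ≤ m)
    (h₅ : m ≤ i + N) :
    MulPentRel q (X j m) (X i k) (X j l) (X k m) (X i l) (X l m) (X i j) (X j k) := by
  have := H.pent (m - N) i j k l (by omega) h₁ h₂ h₃ (by omega)
  simpa only [Pent, H.periodic_sub, H.symm m] using this

theorem pent_middle {i j k l m : ℤ} (h₁ : i ≤ j) (h₂ : j ≤ k) (h₃ : k ≤ l) (h₄ : l ≤ m)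
    (h₅ : m ≤ i + N) :
    MulPentRel q (X k m) (X i l) (X j m) (X i k) (X j l) (X j k) (X l m) (X i m) := by
  have := H.pent k l m (i + N) (j + N) h₃ h₄ h₅ (by omega) (by omega)
  simp only [Pent, H.periodic', H.symm l i, H.symm m j, H.symm k i, H.symm l j,
    H.symm k j, H.symm m i] at this
  exact this

theorem twistFixed {k l : ℤ} (h₁ : 1 ≤ k) (h₂ : k ≤ l) (h₃ : l < N) :
    TwistFixed (X (-1) 1) (X (-1) 0) (X 0 1) (X k l) where
  e := H.comm _ _ _ _ (by omega) h₁ h₂ (by omega)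
  p := H.comm _ _ _ _ (by omega) (by omega) h₂ (by omega)
  r := H.comm _ _ _ _ (by omega) h₁ h₂ (by omega)

theorem chordTwist_comm {j k l : ℤ} (h₁ : 1 ≤ j) (h₂ : j ≤ k) (h₃ : k ≤ l) (h₄ : l < N) :
    Commute (chordTwist q X j) (X k l) :=
  commute_halfTwist (H.twistFixed (by omega) h₃ h₄)
    (H.comm _ _ _ _ (by omega) h₂ h₃ (by omega)) (H.comm _ _ _ _ h₁ h₂ h₃ (by omega))
    (H.comm _ _ _ _ (by omega) h₂ h₃ (by omega))

theorem chordTwist_comm' {j k l : ℤ} (h₁ : 1 ≤ j) (h₂ : j ≤ k) (h₃ : k ≤ l) (h₄ : l < N) :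
    Commute (chordTwist q X l) (X j k) :=
  commute_halfTwist (H.twistFixed h₁ h₂ (by omega))
    (H.comm' (by omega) h₂ h₃ (by omega)) (H.comm' h₁ h₂ h₃ (by omega))
    (H.comm' (by omega) h₂ h₃ (by omega))

/-- The side `(0, 1)` goes to the side `(-1, 0)`: it commutes with `X (-1) 1`, so the bracket is a
product and cancels against the last term. -/
theorem chordTwist_one (hq : q - q⁻¹ ≠ 0) (hN : 2 ≤ N) : chordTwist q X 1 = X (-1) 0 := by
  have h : Commute (X (-1) 1) (X 0 1) := H.comm' (by omega) (by omega) le_rfl (by omega)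
  rw [chordTwist, halfTwist, qComm_of_commute hq h, h.eq, H.diag]
  noncomm_ring

theorem chordTwist_commute (hq : q - q⁻¹ ≠ 0) (hq' : q + q⁻¹ ≠ 0) {y z : ℤ} (h₁ : 1 ≤ y)
    (h₂ : y ≤ z) (h₃ : z < N) : Commute (chordTwist q X y) (chordTwist q X z) := by
  have h := (H.pentComm (i := -1) (j := 0) (k := 1) (l := y) (m := z) (by omega) (by omega) h₁ h₂
    (by omega)).rotate
  have hs := (H.pentSides (i := -1) (j := 0) (k := 1) (l := y) (m := z) (by omega) (by omega) h₁ h₂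
    (by omega)).rotate
  have := h.commute_mulPentTwist hq hq' hs
    (H.mulPentCubic' (by omega) (by omega) h₁ (by omega))
    (H.pent (-1) 0 1 y z (by omega) (by omega) h₁ h₂ (by omega))
    (H.pent' (-1) 0 1 y z (by omega) (by omega) h₁ h₂ (by omega))
    (H.pent_last (by omega) (by omega) h₁ h₂ (by omega))
  rw [mulPentTwist, add_right_comm] at this
  exact this

/-- The repeated diagonal is twisted, so linearity does not apply. The quadrangle `0, 1, y, z` is
enlarged by the vertex `-1` to the pentagon in which the twist takes place; there the relation is
computed directly. The side `X (-1) 0` is the twisted `(0, 1)`. -/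
theorem chordTwist_cubic_one (hq : q - q⁻¹ ≠ 0) (hq' : q + q⁻¹ ≠ 0) {y z : ℤ} (h₁ : 1 ≤ y)
    (h₂ : y ≤ z) (h₃ : z < N) : MulPentCubic q (X 1 z) (chordTwist q X y) (chordTwist q X z)
      (X y z) (X 1 y) (X (-1) 0) := by
  have h := (H.pentComm (i := -1) (j := 0) (k := 1) (l := y) (m := z) (by omega) (by omega) h₁ h₂
    (by omega)).rotate
  have hs := (H.pentSides (i := -1) (j := 0) (k := 1) (l := y) (m := z) (by omega) (by omega) h₁ h₂
    (by omega)).rotate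
  have hcb := H.mulPentCubic (i := 1) (j := y) (k := z) (l := -1 + N) h₁ h₂ (by omega) (by omega)
  have hb := H.pent' 0 1 y z (-1 + N) (by omega) h₁ h₂ (by omega) (by omega)
  simp only [Pent', H.periodic', H.symm y (-1), H.symm 1 (-1), H.symm z (-1), H.symm 0 (-1)]
    at hcb hb
  have e1 : chordTwist q X y = mulPentTwist q (X (-1) 1) (X 0 y) (X (-1) y) (X 0 1)
      (X (-1) 0 * X 1 y) := by
    simp only [chordTwist, halfTwist, mulPentTwist]
    abel
  have hc := H.chordTwist_commute hq hq' h₁ h₂ h₃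
  rw [e1] at hc ⊢
  exact h.mulPentCubic_mulPentTwist hq hs
    (H.mulPentCubic (by omega) (by omega) h₁ (by omega)) hcb
    (H.pent (-1) 0 1 y z (by omega) (by omega) h₁ h₂ (by omega))
    (H.pent_last (by omega) (by omega) h₁ h₂ (by omega)) hb hc

/-- The repeated diagonal `X j l` avoids the vertex `0`, so the relation is linear in the chords at
`0`. -/
theorem chordTwist_cubic {j k l : ℤ} (h₁ : 1 ≤ j) (h₂ : j ≤ k) (h₃ : k ≤ l) (h₄ : l < N) :
    MulPentCubic q (chordTwist q X k) (X j l) (chordTwist q X l) (chordTwist q X j) (X j k)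
      (X k l) :=
  .halfTwist (H.twistFixed h₁ (by omega) h₄) (H.twistFixed h₁ h₂ (by omega))
    (H.twistFixed (by omega) h₃ h₄) (H.mulPentCubic (by omega) h₂ h₃ (by omega))
    (H.mulPentCubic h₁ h₂ h₃ (by omega)) (H.mulPentCubic (by omega) h₂ h₃ (by omega))

theorem chordTwist_pent {j k l m : ℤ} (h₁ : 1 ≤ j) (h₂ : j ≤ k) (h₃ : k ≤ l) (h₄ : l ≤ m)
    (h₅ : m < N) : MulPentRel q (chordTwist q X k) (X j l) (X k m) (chordTwist q X l) (X j m)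
      (chordTwist q X m) (X j k) (X k l) :=
  .halfTwist_ade (H.twistFixed h₁ (by omega) (by omega)) (H.twistFixed (by omega) (by omega) h₅)
    (H.twistFixed h₁ (by omega) h₅) (H.twistFixed h₁ h₂ (by omega))
    (H.twistFixed (by omega) h₃ (by omega))
    (H.pent _ _ _ _ _ (by omega) h₂ h₃ h₄ (by omega)) (H.pent _ _ _ _ _ h₁ h₂ h₃ h₄ (by omega))
    (H.pent _ _ _ _ _ (by omega) h₂ h₃ h₄ (by omega))

theorem chordTwist_pent' {j k l m : ℤ} (h₁ : 1 ≤ j) (h₂ : j ≤ k) (h₃ : k ≤ l) (h₄ : l ≤ m)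
    (h₅ : m < N) : MulPentRel q (X k m) (X j l) (chordTwist q X k) (X j m) (chordTwist q X l)
      (chordTwist q X m) (X k l) (X j k) :=
  .halfTwist_ce (H.twistFixed (by omega) (by omega) h₅) (H.twistFixed h₁ (by omega) (by omega))
    (H.twistFixed h₁ (by omega) h₅) (H.twistFixed (by omega) h₃ (by omega))
    (H.twistFixed h₁ h₂ (by omega))
    (H.pent' _ _ _ _ _ (by omega) h₂ h₃ h₄ (by omega)) (H.pent' _ _ _ _ _ h₁ h₂ h₃ h₄ (by omega))
    (H.pent' _ _ _ _ _ (by omega) h₂ h₃ h₄ (by omega))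

theorem chordTwist_pent_last {j k l m : ℤ} (h₁ : 1 ≤ j) (h₂ : j ≤ k) (h₃ : k ≤ l) (h₄ : l ≤ m)
    (h₅ : m < N) : MulPentRel q (X j m) (chordTwist q X k) (X j l) (X k m) (chordTwist q X l)
      (X l m) (chordTwist q X j) (X j k) :=
  .halfTwist_be (H.twistFixed h₁ (by omega) h₅) (H.twistFixed h₁ (by omega) (by omega))
    (H.twistFixed (by omega) (by omega) h₅) (H.twistFixed (by omega) h₄ h₅)
    (H.twistFixed h₁ h₂ (by omega)) (H.pent_last (by omega) h₂ h₃ h₄ (by omega))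
    (H.pent_last h₁ h₂ h₃ h₄ (by omega)) (H.pent_last (by omega) h₂ h₃ h₄ (by omega))

theorem chordTwist_pent_middle {j k l m : ℤ} (h₁ : 1 ≤ j) (h₂ : j ≤ k) (h₃ : k ≤ l) (h₄ : l ≤ m)
    (h₅ : m < N) : MulPentRel q (X k m) (chordTwist q X l) (X j m) (chordTwist q X k) (X j l)
      (X j k) (X l m) (chordTwist q X m) :=
  .halfTwist_bd (H.twistFixed (by omega) (by omega) h₅) (H.twistFixed h₁ (by omega) h₅)
    (H.twistFixed h₁ (by omega) (by omega)) (H.twistFixed h₁ h₂ (by omega))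
    (H.twistFixed (by omega) h₄ h₅) (H.pent_middle (by omega) h₂ h₃ h₄ (by omega))
    (H.pent_middle h₁ h₂ h₃ h₄ (by omega)) (H.pent_middle (by omega) h₂ h₃ h₄ (by omega))

theorem chordTwist_pentComm (hq : q - q⁻¹ ≠ 0) (hq' : q + q⁻¹ ≠ 0) {j k l : ℤ} (h₁ : 1 ≤ j)
    (h₂ : j ≤ k) (h₃ : k ≤ l) (h₄ : l < N) :
    PentComm (chordTwist q X j) (X 1 k) (X j l) (chordTwist q X k) (X 1 l) where
  ac := H.chordTwist_comm h₁ le_rfl (by omega) h₄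
  ad := H.chordTwist_commute hq hq' h₁ h₂ (by omega)
  bd := (H.chordTwist_comm' le_rfl (by omega) le_rfl (by omega)).symm
  be := (H.comm' le_rfl (by omega) h₃ (by omega)).symm
  ce := (H.comm' h₁ (by omega) le_rfl (by omega)).symm

theorem chordTwist_pentSides (hq : q - q⁻¹ ≠ 0) (hq' : q + q⁻¹ ≠ 0) {j k l : ℤ} (h₁ : 1 ≤ j)
    (h₂ : j ≤ k) (h₃ : k ≤ l) (h₄ : l < N) :
    PentSides (chordTwist q X j) (X 1 k) (X j l) (chordTwist q X k) (X 1 l)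
      (chordTwist q X l) (chordTwist q X 1) (X 1 j) (X j k) (X k l) := by
  constructor <;> intro s hs x hx <;>
    simp only [List.mem_cons, List.not_mem_nil, or_false] at hs hx <;>
    rcases hs with rfl | rfl | rfl | rfl | rfl <;> rcases hx with rfl | rfl | rfl | rfl | rfl
  all_goals first
    | exact H.comm _ _ _ _ (by omega) (by omega) (by omega) (by omega)
    | exact (H.comm _ _ _ _ (by omega) (by omega) (by omega) (by omega)).symm
    | exact H.comm' (by omega) (by omega) (by omega) (by omega)
    | exact (H.comm' (by omega) (by omega) (by omega) (by omega)).symm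
    | exact H.chordTwist_comm (by omega) (by omega) (by omega) (by omega)
    | exact (H.chordTwist_comm (by omega) (by omega) (by omega) (by omega)).symm
    | exact H.chordTwist_comm' (by omega) (by omega) (by omega) (by omega)
    | exact (H.chordTwist_comm' (by omega) (by omega) (by omega) (by omega)).symm
    | exact H.chordTwist_commute hq hq' (by omega) (by omega) (by omega)
    | exact (H.chordTwist_commute hq hq' (by omega) (by omega) (by omega)).symm

/-- The vertex `1` is added to the twisted quadrangle `0, j, k, l`. In the resulting pentagon the
cubic relations involving `1` are known from `chordTwist_cubic_one` and from linearity, and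
`MulPentCubic.of_pentRel` yields the missing one. -/
theorem chordTwist_cubic' (hq : q - q⁻¹ ≠ 0) (hq' : q + q⁻¹ ≠ 0) (hN : 2 ≤ N) {j k l : ℤ}
    (h₁ : 1 ≤ j) (h₂ : j ≤ k) (h₃ : k ≤ l) (h₄ : l < N) :
    MulPentCubic q (X j l) (chordTwist q X k) (chordTwist q X j) (X j k) (X k l)
      (chordTwist q X l) := by
  have hc := H.chordTwist_pentComm hq hq' h₁ h₂ h₃ h₄
  have hs := H.chordTwist_pentSides hq hq' h₁ h₂ h₃ h₄
  have c (s t : A) (hs' : s ∈ [chordTwist q X l, chordTwist q X 1, X 1 j, X j k, X k l])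
      (ht : t ∈ [chordTwist q X l, chordTwist q X 1, X 1 j, X j k, X k l]) : s * t = t * s :=
    hs.side s hs' t ht
  have d (s t : A) (hs' : s ∈ [chordTwist q X l, chordTwist q X 1, X 1 j, X j k, X k l])
      (ht : t ∈ [chordTwist q X j, X 1 k, X j l, chordTwist q X k, X 1 l]) : s * t = t * s :=
    hs.diag s hs' t ht
  have e1 := H.chordTwist_one hq hN
  have hde := (H.chordTwist_cubic_one hq hq' (h₁.trans h₂) h₃ h₄).congr
    (x₁ := chordTwist q X 1) (x₂ := chordTwist q X l) (x₃ := X k l) (v := X 1 k)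
    (by rw [← e1, c (X k l) _ (by simp) (by simp), d (chordTwist q X l) _ (by simp) (by simp)])
    (by rw [← e1, d (X k l) _ (by simp) (by simp)]; abel)
  have hab := (H.chordTwist_cubic_one hq hq' h₁ h₂ (by omega)).congr
    (x₁ := X j k) (x₂ := X 1 j) (x₃ := chordTwist q X 1) (v := chordTwist q X k)
    (by rw [e1]) (by rw [e1])
  have hae := (H.chordTwist_cubic_one hq hq' h₁ (h₂.trans h₃) h₄).congr
    (x₁ := chordTwist q X l) (x₂ := chordTwist q X 1) (x₃ := X 1 j) (v := X j l)
    (by rw [← e1, d (chordTwist q X 1) _ (by simp) (by simp),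
      c (chordTwist q X l) (X 1 j) (by simp) (by simp)]; abel)
    (by rw [← e1, d (X 1 j) _ (by simp) (by simp),
      c (chordTwist q X l) (chordTwist q X 1) (by simp) (by simp)]; abel)
  have hdc := (H.chordTwist_cubic h₁ h₂ h₃ h₄).congr
    (x₁ := chordTwist q X l) (x₂ := X k l) (x₃ := X j k) (v := chordTwist q X j)
    (by rw [d (X k l) _ (by simp) (by simp), c (chordTwist q X l) (X j k) (by simp) (by simp)]
        abel)
    (by rw [d (X j k) _ (by simp) (by simp), c (chordTwist q X l) (X k l) (by simp) (by simp)]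
        abel)
  -- Here the twisted vertex `0` is the middle one, hence quadratic. The relation is therefore not
  -- obtained by linearity but by rotating one that is.
  have He := MulPentRel.rotate hq hc.rotate.rotate hs.rotate.rotate hab hae
    (H.mulPentCubic h₁ h₂ h₃ (by omega)) hdc
    (H.chordTwist_pent_middle le_rfl h₁ h₂ h₃ h₄)
  exact .of_pentRel hq hc hs (H.mulPentCubic' h₁ h₂ h₃ (by omega))
    (H.chordTwist_cubic le_rfl h₁ h₂ (by omega)) hde
    (H.chordTwist_pent_last le_rfl h₁ h₂ h₃ h₄) He

end CycAW

/-- The image of the chords of a polygon under the half twist that exchanges the sides at the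
vertex `0`. -/
def twistFamily (q : K) (X : ℤ → ℤ → A) (i j : ℕ) : A :=
  if i = 0 then chordTwist q X j else X i j

theorem CycAW.isAW_twistFamily (hq : q - q⁻¹ ≠ 0) (hq' : q + q⁻¹ ≠ 0) {n : ℕ}
    (H : CycAW q (n + 1) X) : IsAW q n (twistFamily q X) where
  comm_disj i j k l h₁ h₂ h₃ h₄ := by
    rw [twistFamily, twistFamily, if_neg (by omega : k ≠ 0)]
    split_ifs with hi
    · exact H.chordTwist_comm (by omega) (by omega) (by omega) (by omega)
    · exact H.comm _ _ _ _ (by omega) (by omega) (by omega) (by omega)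
  comm_nest i j k l h₁ h₂ h₃ h₄ := by
    rw [twistFamily, twistFamily]
    split_ifs with hi hk
    · exact (H.chordTwist_commute hq hq' (by omega) (by omega) (by omega)).symm
    · exact H.chordTwist_comm' (by omega) (by omega) (by omega) (by omega)
    · omega
    · exact H.comm' (by omega) (by omega) (by omega) (by omega)
  cubic i j k l h₁ h₂ h₃ h₄ := by
    simp only [twistFamily, if_neg (by omega : j ≠ 0), if_neg (by omega : k ≠ 0)]
    split_ifs with hi
    · have := H.chordTwist_cubic (j := j) (k := k) (l := l) (by omega) (by omega) (by omega)
        (by omega)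
      simpa only [MulPentCubic, mul_assoc] using this
    · exact H.cubic _ _ _ _ (by omega) (by omega) (by omega) (by omega)
  cubic' i j k l h₁ h₂ h₃ h₄ := by
    simp only [twistFamily, if_neg (by omega : j ≠ 0), if_neg (by omega : k ≠ 0)]
    split_ifs with hi
    · have := (H.chordTwist_cubic' hq hq' (by omega) (j := j) (k := k) (l := l) (by omega)
        (by omega) (by omega) (by omega)).congr (x₁ := X k l) (x₂ := X j k)
          (x₃ := chordTwist q X j) (v := chordTwist q X l) ?_ ?_
      · rw [this, (H.chordTwist_comm (j := j) (k := k) (l := l) (by omega) (by omega) (by omega)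
          (by omega)).eq, mul_assoc (X j k)]
      · abel
      · rw [(H.chordTwist_commute hq hq' (y := j) (z := l) (by omega) (by omega) (by omega)).eq,
          (H.comm j k k l (by omega) le_rfl (by omega) (by omega)).eq]
    · have := H.mulPentCubic' (i := i) (j := j) (k := k) (l := l) (by omega) (by omega) (by omega)
        (by omega)
      rw [this, (H.comm i j k l (by omega) (by omega) (by omega) (by omega)).eq,
        mul_assoc (X j k)]
  pent i j k l m h₁ h₂ h₃ h₄ h₅ := by
    simp only [twistFamily, if_neg (by omega : j ≠ 0), if_neg (by omega : k ≠ 0)]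
    split_ifs with hi
    · exact H.chordTwist_pent (by omega) (by omega) (by omega) (by omega) (by omega)
    · exact H.pent _ _ _ _ _ (by omega) (by omega) (by omega) (by omega) (by omega)
  pent' i j k l m h₁ h₂ h₃ h₄ h₅ := by
    simp only [twistFamily, if_neg (by omega : j ≠ 0), if_neg (by omega : k ≠ 0)]
    split_ifs with hi
    · exact H.chordTwist_pent' (by omega) (by omega) (by omega) (by omega) (by omega)
    · exact H.pent' _ _ _ _ _ (by omega) (by omega) (by omega) (by omega) (by omega)

end TwistFamily

/-! ### Connected sets as half-open intervals -/

section Blocks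

theorem isConn_iff {n : ℕ} {I : Finset ℕ} :
    IsConn n I ↔ ∃ i j, i < j ∧ j ≤ n ∧ I = Finset.Ioc i j := by
  constructor
  · rintro ⟨hne, j, k, hj, hk, rfl⟩
    have := Finset.nonempty_Icc.1 hne
    exact ⟨j - 1, k, by omega, hk, by ext; simp; omega⟩
  · rintro ⟨i, j, hij, hj, rfl⟩
    exact ⟨Finset.nonempty_Ioc.2 hij, i + 1, j, by omega, hj, by ext; simp⟩

theorem isConn_Ioc {n i j : ℕ} (h : i < j) (hj : j ≤ n) : IsConn n (Finset.Ioc i j) :=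
  isConn_iff.2 ⟨i, j, h, hj, rfl⟩

/-- A connected union has no gap, so `j + 1` lies in one of the two blocks, and it can only be the
start of the second. -/
theorem SetLT.eq_of_isConn {n i j k l : ℕ} (hij : i < j) (hkl : k < l)
    (h : SetLT (Finset.Ioc i j) (Finset.Ioc k l))
    (hc : IsConn n (Finset.Ioc i j ∪ Finset.Ioc k l)) : j = k := by
  obtain ⟨a, b, -, -, hab⟩ := isConn_iff.1 hc
  have h1 := h j (by simp; omega) (k + 1) (by simp; omega)
  by_contra hne
  have h2 : j ∈ Finset.Ioc a b := hab ▸ (by simp; omega)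
  have h3 : l ∈ Finset.Ioc a b := hab ▸ (by simp; omega)
  have h4 : j + 1 ∈ Finset.Ioc i j ∪ Finset.Ioc k l := by
    rw [hab]; simp at *; omega
  simp at h4
  omega

theorem setLT_Ioc {i j k l : ℕ} (h : j ≤ k) : SetLT (Finset.Ioc i j) (Finset.Ioc k l) := by
  intro x hx y hy
  simp at hx hy
  omega

theorem Ioc_union {i j k : ℕ} (h₁ : i < j) (h₂ : j < k) :
    Finset.Ioc i j ∪ Finset.Ioc j k = Finset.Ioc i k :=
  Finset.Ioc_union_Ioc_eq_Ioc h₁.le h₂.le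

theorem Ioc_union' {i j k : ℕ} (h₁ : i < j) (h₂ : j < k) :
    Finset.Ioc j k ∪ Finset.Ioc i j = Finset.Ioc i k := by
  rw [Finset.union_comm, Ioc_union h₁ h₂]

theorem IsMonoAdjSeq.exists_three {n : ℕ} {I₁ I₂ I₃ : Finset ℕ}
    (h : IsMonoAdjSeq n [I₁, I₂, I₃]) : ∃ i j k l, i < j ∧ j < k ∧ k < l ∧ l ≤ n ∧
      (I₁ = Finset.Ioc i j ∧ I₂ = Finset.Ioc j k ∧ I₃ = Finset.Ioc k l ∨
        I₃ = Finset.Ioc i j ∧ I₂ = Finset.Ioc j k ∧ I₁ = Finset.Ioc k l) := by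
  obtain ⟨h1, h2, h3⟩ := h
  simp only [List.mem_cons, List.not_mem_nil, or_false, forall_eq_or_imp, forall_eq] at h1
  obtain ⟨c₁, c₂, c₃⟩ := h1
  obtain ⟨i₁, j₁, hij₁, hj₁, rfl⟩ := isConn_iff.1 c₁
  obtain ⟨i₂, j₂, hij₂, hj₂, rfl⟩ := isConn_iff.1 c₂
  obtain ⟨i₃, j₃, hij₃, hj₃, rfl⟩ := isConn_iff.1 c₃
  simp only [List.pairwise_cons, List.mem_cons, List.not_mem_nil, or_false, forall_eq_or_imp,
    forall_eq, List.isChain_cons_cons, List.isChain_singleton, and_true] at h2 h3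
  obtain ⟨u₁, u₂⟩ := h3
  rcases h2 with h2 | h2
  · obtain rfl := h2.1.1.eq_of_isConn hij₁ hij₂ u₁
    obtain rfl := h2.2.1.eq_of_isConn hij₂ hij₃ u₂
    exact ⟨_, _, _, _, hij₁, hij₂, hij₃, hj₃, Or.inl ⟨rfl, rfl, rfl⟩⟩
  · rw [Finset.union_comm] at u₁ u₂
    obtain rfl := h2.1.1.eq_of_isConn hij₂ hij₁ u₁
    obtain rfl := h2.2.1.eq_of_isConn hij₃ hij₂ u₂
    exact ⟨_, _, _, _, hij₃, hij₂, hij₁, hj₁, Or.inr ⟨rfl, rfl, rfl⟩⟩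

theorem IsMonoAdjSeq.exists_four {n : ℕ} {I₁ I₂ I₃ I₄ : Finset ℕ}
    (h : IsMonoAdjSeq n [I₁, I₂, I₃, I₄]) :
    ∃ i j k l m, i < j ∧ j < k ∧ k < l ∧ l < m ∧ m ≤ n ∧
      (I₁ = Finset.Ioc i j ∧ I₂ = Finset.Ioc j k ∧ I₃ = Finset.Ioc k l ∧ I₄ = Finset.Ioc l m ∨
        I₄ = Finset.Ioc i j ∧ I₃ = Finset.Ioc j k ∧ I₂ = Finset.Ioc k l ∧
          I₁ = Finset.Ioc l m) := by
  obtain ⟨h1, h2, h3⟩ := h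
  simp only [List.mem_cons, List.not_mem_nil, or_false, forall_eq_or_imp, forall_eq] at h1
  obtain ⟨c₁, c₂, c₃, c₄⟩ := h1
  obtain ⟨i₁, j₁, hij₁, hj₁, rfl⟩ := isConn_iff.1 c₁
  obtain ⟨i₂, j₂, hij₂, hj₂, rfl⟩ := isConn_iff.1 c₂
  obtain ⟨i₃, j₃, hij₃, hj₃, rfl⟩ := isConn_iff.1 c₃
  obtain ⟨i₄, j₄, hij₄, hj₄, rfl⟩ := isConn_iff.1 c₄
  simp only [List.pairwise_cons, List.mem_cons, List.not_mem_nil, or_false, forall_eq_or_imp,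
    forall_eq, List.isChain_cons_cons, List.isChain_singleton, and_true] at h2 h3
  obtain ⟨u₁, u₂, u₃⟩ := h3
  rcases h2 with h2 | h2
  · obtain rfl := h2.1.1.eq_of_isConn hij₁ hij₂ u₁
    obtain rfl := h2.2.1.1.eq_of_isConn hij₂ hij₃ u₂
    obtain rfl := h2.2.2.1.eq_of_isConn hij₃ hij₄ u₃
    exact ⟨_, _, _, _, _, hij₁, hij₂, hij₃, hij₄, hj₄, Or.inl ⟨rfl, rfl, rfl, rfl⟩⟩
  · rw [Finset.union_comm] at u₁ u₂ u₃
    obtain rfl := h2.1.1.eq_of_isConn hij₂ hij₁ u₁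
    obtain rfl := h2.2.1.1.eq_of_isConn hij₃ hij₂ u₂
    obtain rfl := h2.2.2.1.eq_of_isConn hij₄ hij₃ u₃
    exact ⟨_, _, _, _, _, hij₄, hij₃, hij₂, hij₁, hj₁, Or.inr ⟨rfl, rfl, rfl, rfl⟩⟩

variable {n i j k l m : ℕ}

theorem isMonoAdjSeq_three (h₁ : i < j) (h₂ : j < k) (h₃ : k < l) (h₄ : l ≤ n) :
    IsMonoAdjSeq n [Finset.Ioc i j, Finset.Ioc j k, Finset.Ioc k l] := by
  refine ⟨?_, Or.inl ?_, ?_⟩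
  · simp only [List.mem_cons, List.not_mem_nil, or_false, forall_eq_or_imp, forall_eq]
    exact ⟨isConn_Ioc h₁ (by omega), isConn_Ioc h₂ (by omega), isConn_Ioc h₃ h₄⟩
  · simp [setLT_Ioc, h₂.le]
  · simp [Ioc_union, h₁, h₂, h₃, isConn_Ioc (h₁.trans h₂) (by omega : k ≤ n),
      isConn_Ioc (h₂.trans h₃) h₄]

theorem isMonoAdjSeq_three' (h₁ : i < j) (h₂ : j < k) (h₃ : k < l) (h₄ : l ≤ n) :
    IsMonoAdjSeq n [Finset.Ioc k l, Finset.Ioc j k, Finset.Ioc i j] := by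
  refine ⟨?_, Or.inr ?_, ?_⟩
  · simp only [List.mem_cons, List.not_mem_nil, or_false, forall_eq_or_imp, forall_eq]
    exact ⟨isConn_Ioc h₃ h₄, isConn_Ioc h₂ (by omega), isConn_Ioc h₁ (by omega)⟩
  · simp [setLT_Ioc, h₂.le]
  · simp [Ioc_union', h₁, h₂, h₃, isConn_Ioc (h₁.trans h₂) (by omega : k ≤ n),
      isConn_Ioc (h₂.trans h₃) h₄]

theorem isMonoAdjSeq_four (h₁ : i < j) (h₂ : j < k) (h₃ : k < l) (h₄ : l < m) (h₅ : m ≤ n) :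
    IsMonoAdjSeq n [Finset.Ioc i j, Finset.Ioc j k, Finset.Ioc k l, Finset.Ioc l m] := by
  refine ⟨?_, Or.inl ?_, ?_⟩
  · simp only [List.mem_cons, List.not_mem_nil, or_false, forall_eq_or_imp, forall_eq]
    exact ⟨isConn_Ioc h₁ (by omega), isConn_Ioc h₂ (by omega), isConn_Ioc h₃ (by omega),
      isConn_Ioc h₄ h₅⟩
  · simp [setLT_Ioc, h₂.le, h₃.le, (h₂.trans h₃).le]
  · simp [Ioc_union, h₁, h₂, h₃, h₄, isConn_Ioc (h₁.trans h₂) (by omega : k ≤ n),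
      isConn_Ioc (h₂.trans h₃) (by omega : l ≤ n), isConn_Ioc (h₃.trans h₄) h₅]

theorem isMonoAdjSeq_four' (h₁ : i < j) (h₂ : j < k) (h₃ : k < l) (h₄ : l < m) (h₅ : m ≤ n) :
    IsMonoAdjSeq n [Finset.Ioc l m, Finset.Ioc k l, Finset.Ioc j k, Finset.Ioc i j] := by
  refine ⟨?_, Or.inr ?_, ?_⟩
  · simp only [List.mem_cons, List.not_mem_nil, or_false, forall_eq_or_imp, forall_eq]
    exact ⟨isConn_Ioc h₄ h₅, isConn_Ioc h₃ (by omega), isConn_Ioc h₂ (by omega),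
      isConn_Ioc h₁ (by omega)⟩
  · simp [setLT_Ioc, h₂.le, h₃.le, (h₂.trans h₃).le]
  · simp [Ioc_union', h₁, h₂, h₃, h₄, isConn_Ioc (h₁.trans h₂) (by omega : k ≤ n),
      isConn_Ioc (h₂.trans h₃) (by omega : l ≤ n), isConn_Ioc (h₃.trans h₄) h₅]

end Blocks

/-! ### The algebra `aw(n)` and its universal property -/

section Presentation

variable {K : Type*} [Field K] {A : Type*} [Ring A] [Algebra K A] {q : K} {n : ℕ}

/-- Substituting `C_{I₁I₃}` turns the three-block relation into the cubic one: `r` and `s` are the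
products in its definition, and both commute with the repeated diagonal `b`. -/
theorem three_iff (hq : q - q⁻¹ ≠ 0) {a b r s t u : A} (hr : Commute r b) (hs : Commute s b) :
    a = -qComm q b (-qComm q a b + r + s) + t + u ↔
      qComm q b (qComm q a b) = a + r * b + s * b - t - u := by
  rw [qComm_add_right, qComm_add_right, qComm_neg_right, qComm_of_commute hq hr.symm,
    qComm_of_commute hq hs.symm, hr.eq, hs.eq]
  constructor <;> intro h
  · nth_rewrite 2 [h]; abel
  · rw [h]; abel

/-- After substitution the terms `c₁ * c₄` cancel, as do those in `c₁`, `c₃` and `c`; what is left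
is the pentagon relation. The side `c₁` disappears, and so does `c₄`. -/
theorem four_iff (hq : q - q⁻¹ ≠ 0) {a b c d e c₀ c₁ c₂ c₃ c₄ : A} (hc : PentComm a b c d e)
    (hs : PentSides a b c d e c₀ c₁ c₂ c₃ c₄) :
    -qComm q d e + c₁ * c₄ + b * c₀ =
      -qComm q (-qComm q a b + c₁ * c₃ + c₂ * d) c + c₁ * c₄ +
        c₃ * (-qComm q a e + c₁ * c + c₂ * c₀) ↔
      MulPentRel q a b c d e c₀ c₂ c₃ := by
  have h1 : Commute c₁ c := hs.diag _ (by simp) _ (by simp)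
  have h2 : Commute c₂ c := hs.diag _ (by simp) _ (by simp)
  have h3 : Commute c₃ c := hs.diag _ (by simp) _ (by simp)
  have h13 : Commute c₁ c₃ := hs.side _ (by simp) _ (by simp)
  have h0b : Commute c₀ b := hs.diag _ (by simp) _ (by simp)
  have h4 : c₃ * (c₂ * c₀) = c₀ * (c₂ * c₃) := by
    rw [(hs.side c₂ (by simp) c₃ (by simp)).eq, (hs.side c₀ (by simp) _ (by simp)).left_comm,
      (hs.side c₂ (by simp) c₀ (by simp)).eq]
  rw [qComm_add_left, qComm_add_left, qComm_neg_left, qComm_assoc hc.ac,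
    qComm_of_commute hq (h1.mul_left h3), qComm_mul_left h2, h13.eq, ← h0b.eq, MulPentRel]
  simp only [mul_add, mul_neg, mul_assoc, h4]
  rw [← sub_eq_zero, ← sub_eq_zero (b := c₀ * b + _ + _ - _), ← neg_eq_zero]
  have : ∀ x y : A, x = y → (x = 0 ↔ y = 0) := fun x y h => by rw [h]
  apply this
  abel

theorem pentComm_of_nat {x : ℕ → ℕ → A}
    (h : ∀ i j k l, i < j → j ≤ k → k < l → l ≤ n → Commute (x i j) (x k l))
    (h' : ∀ i j k l, i ≤ k → k < l → l ≤ j → j ≤ n → Commute (x i j) (x k l))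
    {i j k l m : ℕ} (h₁ : i < j) (h₂ : j < k) (h₃ : k < l) (h₄ : l < m) (h₅ : m ≤ n) :
    PentComm (x i k) (x j l) (x k m) (x i l) (x j m) where
  ac := h _ _ _ _ (by omega) le_rfl (by omega) h₅
  ad := (h' _ _ _ _ le_rfl (by omega) h₃.le (by omega)).symm
  bd := (h' _ _ _ _ h₁.le (by omega) le_rfl (by omega)).symm
  be := (h' _ _ _ _ le_rfl (by omega) h₄.le (by omega)).symm
  ce := (h' _ _ _ _ h₂.le (by omega) le_rfl (by omega)).symm

theorem pentSides_of_nat {x : ℕ → ℕ → A}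
    (h : ∀ i j k l, i < j → j ≤ k → k < l → l ≤ n → Commute (x i j) (x k l))
    (h' : ∀ i j k l, i ≤ k → k < l → l ≤ j → j ≤ n → Commute (x i j) (x k l))
    {i j k l m : ℕ} (h₁ : i < j) (h₂ : j < k) (h₃ : k < l) (h₄ : l < m) (h₅ : m ≤ n) :
    PentSides (x i k) (x j l) (x k m) (x i l) (x j m) (x i m) (x i j) (x j k) (x k l)
      (x l m) := by
  constructor <;> intro s hs y hy <;>
    simp only [List.mem_cons, List.not_mem_nil, or_false] at hs hy <;>
    rcases hs with rfl | rfl | rfl | rfl | rfl <;> rcases hy with rfl | rfl | rfl | rfl | rfl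
  all_goals first
    | exact h _ _ _ _ (by omega) (by omega) (by omega) (by omega)
    | exact (h _ _ _ _ (by omega) (by omega) (by omega) (by omega)).symm
    | exact h' _ _ _ _ (by omega) (by omega) (by omega) (by omega)
    | exact (h' _ _ _ _ (by omega) (by omega) (by omega) (by omega)).symm

theorem twoBlock_eq {c : Finset ℕ → A} {I H J : Finset ℕ} (hI : I.Nonempty) (hH : H.Nonempty)
    (hJ : J.Nonempty) : twoBlock q c I H J =
      -qComm q (c (I ∪ H)) (c (H ∪ J)) + c I * c J + c H * c (I ∪ H ∪ J) := by
  rw [twoBlock, if_neg]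
  simp [hI.ne_empty, hH.ne_empty, hJ.ne_empty]

theorem twoBlock_Ioc {c : Finset ℕ → A} {i j k l : ℕ} (h₁ : i < j) (h₂ : j < k) (h₃ : k < l) :
    twoBlock q c (Finset.Ioc i j) (Finset.Ioc j k) (Finset.Ioc k l) =
      -qComm q (c (Finset.Ioc i k)) (c (Finset.Ioc j l)) +
        c (Finset.Ioc i j) * c (Finset.Ioc k l) + c (Finset.Ioc j k) * c (Finset.Ioc i l) := by
  rw [twoBlock_eq (Finset.nonempty_Ioc.2 h₁) (Finset.nonempty_Ioc.2 h₂)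
    (Finset.nonempty_Ioc.2 h₃), Ioc_union h₁ h₂, Ioc_union h₂ h₃, Ioc_union (h₁.trans h₂) h₃]

theorem twoBlock_Ioc' {c : Finset ℕ → A} {i j k l : ℕ} (h₁ : i < j) (h₂ : j < k) (h₃ : k < l) :
    twoBlock q c (Finset.Ioc k l) (Finset.Ioc j k) (Finset.Ioc i j) =
      -qComm q (c (Finset.Ioc j l)) (c (Finset.Ioc i k)) +
        c (Finset.Ioc k l) * c (Finset.Ioc i j) + c (Finset.Ioc j k) * c (Finset.Ioc i l) := by
  rw [twoBlock_eq (Finset.nonempty_Ioc.2 h₃) (Finset.nonempty_Ioc.2 h₂)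
    (Finset.nonempty_Ioc.2 h₁), Ioc_union' h₂ h₃, Ioc_union' h₁ h₂, Ioc_union' h₁ (h₂.trans h₃)]

theorem isAW_C (hq : q - q⁻¹ ≠ 0) : IsAW q n (fun i j => C K q n (Finset.Ioc i j)) := by
  have hd : ∀ i j k l, i < j → j ≤ k → k < l → l ≤ n →
      Commute (C K q n (Finset.Ioc i j)) (C K q n (Finset.Ioc k l)) := by
    intro i j k l h₁ h₂ h₃ h₄
    have := RingQuot.mkAlgHom_rel K (Rel.comm (q := q) (n := n) (Finset.Ioc i j) (Finset.Ioc k l)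
      (isConn_Ioc h₁ (by omega)) (isConn_Ioc h₃ h₄)
      (Or.inl (Finset.disjoint_left.2 fun x hx hy => by simp at hx hy; omega)))
    rw [map_mul, map_mul] at this
    exact this
  have hn : ∀ i j k l, i ≤ k → k < l → l ≤ j → j ≤ n →
      Commute (C K q n (Finset.Ioc i j)) (C K q n (Finset.Ioc k l)) := by
    intro i j k l h₁ h₂ h₃ h₄
    have := RingQuot.mkAlgHom_rel K (Rel.comm (q := q) (n := n) (Finset.Ioc k l) (Finset.Ioc i j)
      (isConn_Ioc h₂ (by omega)) (isConn_Ioc (by omega) h₄)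
      (Or.inr (Finset.Ioc_subset_Ioc h₁ h₃)))
    rw [map_mul, map_mul] at this
    exact this.symm
  refine ⟨hd, hn, ?_, ?_, ?_, ?_⟩
  · intro i j k l h₁ h₂ h₃ h₄
    have := RingQuot.mkAlgHom_rel K (Rel.three (q := q) _ _ _ (isMonoAdjSeq_three h₁ h₂ h₃ h₄))
    simp only [map_add, map_neg, map_mul, map_qComm, Ioc_union h₁ h₂,
      Ioc_union h₂ h₃, Ioc_union (h₁.trans h₂) h₃, twoBlock_Ioc h₁ h₂ h₃] at this
    exact (three_iff hq ((hd i j j l h₁ le_rfl (by omega) h₄).mul_left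
      (hn j l k l h₂.le h₃ le_rfl h₄).symm) ((hn j l j k le_rfl h₂ h₃.le h₄).symm.mul_left
        (hn i l j l h₁.le (by omega) le_rfl h₄))).1 this
  · intro i j k l h₁ h₂ h₃ h₄
    have := RingQuot.mkAlgHom_rel K (Rel.three (q := q) _ _ _ (isMonoAdjSeq_three' h₁ h₂ h₃ h₄))
    simp only [map_add, map_neg, map_mul, map_qComm, Ioc_union' h₁ h₂,
      Ioc_union' h₂ h₃, Ioc_union' h₁ (h₂.trans h₃), twoBlock_Ioc' h₁ h₂ h₃] at this
    rw [(hd i j k l h₁ h₂.le h₃ h₄).eq]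
    exact (three_iff hq ((hd i k k l (by omega) le_rfl h₃ h₄).symm.mul_left
      (hn i k i j le_rfl h₁ h₂.le (by omega)).symm) ((hn i k j k h₁.le h₂ le_rfl
        (by omega)).symm.mul_left (hn i l i k le_rfl (by omega) h₃.le h₄))).1 this
  · intro i j k l m h₁ h₂ h₃ h₄ h₅
    have := RingQuot.mkAlgHom_rel K (Rel.four (q := q) _ _ _ _
      (isMonoAdjSeq_four h₁ h₂ h₃ h₄ h₅))
    simp only [map_add, map_neg, map_mul, map_qComm, Ioc_union h₂ h₃,
      Ioc_union h₃ h₄, twoBlock_Ioc h₁ h₂ h₃, twoBlock_Ioc h₁ (h₂.trans h₃) h₄,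
      twoBlock_Ioc h₁ h₂ (h₃.trans h₄)] at this
    exact (four_iff hq (pentComm_of_nat hd hn h₁ h₂ h₃ h₄ h₅)
      (pentSides_of_nat hd hn h₁ h₂ h₃ h₄ h₅)).1 this
  · intro i j k l m h₁ h₂ h₃ h₄ h₅
    have := RingQuot.mkAlgHom_rel K (Rel.four (q := q) _ _ _ _
      (isMonoAdjSeq_four' h₁ h₂ h₃ h₄ h₅))
    simp only [map_add, map_neg, map_mul, map_qComm, Ioc_union' h₂ h₃,
      Ioc_union' h₁ h₂, twoBlock_Ioc' h₂ h₃ h₄, twoBlock_Ioc' h₁ (h₂.trans h₃) h₄,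
      twoBlock_Ioc' (h₁.trans h₂) h₃ h₄] at this
    exact (four_iff hq (pentComm_of_nat hd hn h₁ h₂ h₃ h₄ h₅).reflect
      (pentSides_of_nat hd hn h₁ h₂ h₃ h₄ h₅).reflect).1 this

/-- The value of a family `x i j` at the block `{i + 1, …, j}`. -/
def blockVal (x : ℕ → ℕ → A) (I : Finset ℕ) : A :=
  if h : I.Nonempty then x (I.min' h - 1) (I.max' h) else 1

theorem blockVal_Ioc (x : ℕ → ℕ → A) {i j : ℕ} (h : i < j) :
    blockVal x (Finset.Ioc i j) = x i j := by
  have hne := Finset.nonempty_Ioc.2 h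
  have e1 : (Finset.Ioc i j).min' hne = i + 1 := by
    refine le_antisymm (Finset.min'_le _ _ (by simp; omega)) (Finset.le_min' _ _ _ fun y hy => ?_)
    simp at hy
    omega
  have e2 : (Finset.Ioc i j).max' hne = j := by
    refine le_antisymm (Finset.max'_le _ _ _ fun y hy => ?_) (Finset.le_max' _ _ (by simp; omega))
    simp at hy
    omega
  rw [blockVal, dif_pos hne, e1, e2, Nat.add_sub_cancel]

/-- The homomorphism from the free algebra given by a family `x i j`. -/
noncomputable def freeLift (K : Type*) [Field K] [Algebra K A] (n : ℕ) (x : ℕ → ℕ → A) :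
    FreeAlgebra K {I : Finset ℕ // IsConn n I} →ₐ[K] A :=
  FreeAlgebra.lift K fun I => blockVal x I.1

theorem freeLift_freeC (x : ℕ → ℕ → A) {i j : ℕ} (h : i < j) (hj : j ≤ n) :
    freeLift K n x (freeC K n (Finset.Ioc i j)) = x i j := by
  rw [freeC, dif_pos (isConn_Ioc h hj), freeLift, FreeAlgebra.lift_ι_apply, blockVal_Ioc x h]

theorem IsAW.freeLift_rel (hq : q - q⁻¹ ≠ 0) {x : ℕ → ℕ → A} (H : IsAW q n x)
    {a b : FreeAlgebra K {I : Finset ℕ // IsConn n I}} (h : Rel K q n a b) :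
    freeLift K n x a = freeLift K n x b := by
  have hd := H.comm_disj
  have hn := H.comm_nest
  have hv : ∀ i j, i < j → j ≤ n → freeLift K n x (freeC K n (Finset.Ioc i j)) = x i j :=
    fun i j h hj => freeLift_freeC x h hj
  induction h with
  | comm I J hI hJ h =>
    obtain ⟨i, j, hij, hj, rfl⟩ := isConn_iff.1 hI
    obtain ⟨k, l, hkl, hl, rfl⟩ := isConn_iff.1 hJ
    rw [map_mul, map_mul, hv _ _ hij hj, hv _ _ hkl hl]
    rcases h with h | h
    · have : j ≤ k ∨ l ≤ i := by
        by_contra! hc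
        have h1 : max i k + 1 ∈ Finset.Ioc i j := by simp; omega
        exact Finset.disjoint_left.1 h h1 (by simp; omega)
      rcases this with h | h
      · exact hd i j k l hij h hkl hl
      · exact (hd k l i j hkl h hij hj).symm
    · have h1 := h (show i + 1 ∈ Finset.Ioc i j by simp; omega)
      have h2 := h (show j ∈ Finset.Ioc i j by simp; omega)
      simp only [Finset.mem_Ioc] at h1 h2
      exact (hn k l i j (by omega) hij h2.2 hl).symm
  | three I₁ I₂ I₃ h =>
    obtain ⟨i, j, k, l, h₁, h₂, h₃, h₄, ⟨rfl, rfl, rfl⟩ | ⟨rfl, rfl, rfl⟩⟩ := h.exists_three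
    · simp only [map_add, map_neg, map_mul, map_qComm, Ioc_union h₁ h₂,
        Ioc_union h₂ h₃, Ioc_union (h₁.trans h₂) h₃, twoBlock_Ioc h₁ h₂ h₃]
      simp only [hv i j h₁ (by omega), hv i k (by omega) (by omega), hv i l (by omega) h₄,
        hv j k h₂ (by omega), hv j l (by omega) h₄, hv k l h₃ h₄]
      exact (three_iff hq ((hd i j j l h₁ le_rfl (by omega) h₄).mul_left
        (hn j l k l h₂.le h₃ le_rfl h₄).symm) ((hn j l j k le_rfl h₂ h₃.le h₄).symm.mul_left
          (hn i l j l h₁.le (by omega) le_rfl h₄))).2 (H.cubic i j k l h₁ h₂ h₃ h₄)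
    · simp only [map_add, map_neg, map_mul, map_qComm, Ioc_union' h₁ h₂,
        Ioc_union' h₂ h₃, Ioc_union' h₁ (h₂.trans h₃), twoBlock_Ioc' h₁ h₂ h₃]
      simp only [hv i j h₁ (by omega), hv i k (by omega) (by omega), hv i l (by omega) h₄,
        hv j k h₂ (by omega), hv j l (by omega) h₄, hv k l h₃ h₄]
      refine (three_iff hq ((hd i k k l (by omega) le_rfl h₃ h₄).symm.mul_left
        (hn i k i j le_rfl h₁ h₂.le (by omega)).symm) ((hn i k j k h₁.le h₂ le_rfl
          (by omega)).symm.mul_left (hn i l i k le_rfl (by omega) h₃.le h₄))).2 ?_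
      rw [H.cubic' i j k l h₁ h₂ h₃ h₄, (hd i j k l h₁ h₂.le h₃ h₄).eq]
  | four I₁ I₂ I₃ I₄ h =>
    obtain ⟨i, j, k, l, m, h₁, h₂, h₃, h₄, h₅, ⟨rfl, rfl, rfl, rfl⟩ | ⟨rfl, rfl, rfl, rfl⟩⟩ :=
      h.exists_four
    · simp only [map_add, map_neg, map_mul, map_qComm, Ioc_union h₂ h₃,
        Ioc_union h₃ h₄, twoBlock_Ioc h₁ h₂ h₃, twoBlock_Ioc h₁ (h₂.trans h₃) h₄,
        twoBlock_Ioc h₁ h₂ (h₃.trans h₄)]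
      simp only [hv i j h₁ (by omega), hv i k (by omega) (by omega), hv i l (by omega) (by omega),
        hv i m (by omega) h₅, hv j k h₂ (by omega), hv j l (by omega) (by omega),
        hv j m (by omega) h₅, hv k l h₃ (by omega), hv k m (by omega) h₅, hv l m h₄ h₅]
      exact (four_iff hq (pentComm_of_nat hd hn h₁ h₂ h₃ h₄ h₅)
        (pentSides_of_nat hd hn h₁ h₂ h₃ h₄ h₅)).2 (H.pent i j k l m h₁ h₂ h₃ h₄ h₅)
    · simp only [map_add, map_neg, map_mul, map_qComm, Ioc_union' h₂ h₃,
        Ioc_union' h₁ h₂, twoBlock_Ioc' h₂ h₃ h₄, twoBlock_Ioc' h₁ (h₂.trans h₃) h₄,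
        twoBlock_Ioc' (h₁.trans h₂) h₃ h₄]
      simp only [hv i j h₁ (by omega), hv i k (by omega) (by omega), hv i l (by omega) (by omega),
        hv i m (by omega) h₅, hv j k h₂ (by omega), hv j l (by omega) (by omega),
        hv j m (by omega) h₅, hv k l h₃ (by omega), hv k m (by omega) h₅, hv l m h₄ h₅]
      exact (four_iff hq (pentComm_of_nat hd hn h₁ h₂ h₃ h₄ h₅).reflect
        (pentSides_of_nat hd hn h₁ h₂ h₃ h₄ h₅).reflect).2 (H.pent' i j k l m h₁ h₂ h₃ h₄ h₅)

/-- The homomorphism from `aw(n)` given by a family that satisfies the relations. -/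
noncomputable def IsAW.lift (hq : q - q⁻¹ ≠ 0) {x : ℕ → ℕ → A} (H : IsAW q n x) :
    AW K q n →ₐ[K] A :=
  RingQuot.liftAlgHom K ⟨freeLift K n x, fun _ _ h => H.freeLift_rel hq h⟩

theorem IsAW.lift_C (hq : q - q⁻¹ ≠ 0) {x : ℕ → ℕ → A} (H : IsAW q n x) {i j : ℕ} (h : i < j)
    (hj : j ≤ n) : H.lift hq (C K q n (Finset.Ioc i j)) = x i j := by
  rw [IsAW.lift, C, RingQuot.liftAlgHom_mkAlgHom_apply, freeLift_freeC x h hj]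

theorem AW.algHom_ext {f g : AW K q n →ₐ[K] A}
    (h : ∀ i j, i < j → j ≤ n → f (C K q n (Finset.Ioc i j)) = g (C K q n (Finset.Ioc i j))) :
    f = g := by
  refine RingQuot.ringQuot_ext' _ _ _ (FreeAlgebra.hom_ext (funext fun I => ?_))
  obtain ⟨i, j, hij, hj, hI⟩ := isConn_iff.1 I.2
  have := h i j hij hj
  simp only [C, freeC, dif_pos (isConn_Ioc hij hj), ← hI] at this
  exact this

/-- Reversing products reverses the order of `a`, `b`, `c`. By `qComm_assoc` the nested bracket can
be regrouped, so the opposite of a pentagon relation is its mirror image. -/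
theorem MulPentRel.op {a b c d e c₀ c₁ c₂ c₃ c₄ : A} (h : MulPentRel q a b c d e c₀ c₂ c₃)
    (hc : PentComm a b c d e) (hs : PentSides a b c d e c₀ c₁ c₂ c₃ c₄) :
    MulPentRel q (MulOpposite.op c) (MulOpposite.op b) (MulOpposite.op a) (MulOpposite.op e)
      (MulOpposite.op d) (MulOpposite.op c₀) (MulOpposite.op c₃) (MulOpposite.op c₂) := by
  have h0 : Commute c₀ b := hs.diag _ (by simp) _ (by simp)
  have h2 : Commute c₂ (qComm q d c) :=
    (hs.diag _ (by simp) _ (by simp)).qComm_right (hs.diag _ (by simp) _ (by simp))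
  have h3 : Commute c₃ (qComm q a e) :=
    (hs.diag _ (by simp) _ (by simp)).qComm_right (hs.diag _ (by simp) _ (by simp))
  have h4 : c₀ * c₂ * c₃ = c₂ * (c₃ * c₀) := by
    rw [(hs.side c₀ (by simp) c₂ (by simp)).eq, mul_assoc,
      (hs.side c₀ (by simp) c₃ (by simp)).eq]
  unfold MulPentRel at *
  simp only [qComm_op, ← MulOpposite.op_mul, ← MulOpposite.op_add, ← MulOpposite.op_sub]
  rw [qComm_assoc hc.ac, h, h0.eq, h2.eq, h3.eq, h4]
  congr 1
  abel

theorem IsAW.op {x : ℕ → ℕ → A} (H : IsAW q n x) : IsAW q n fun i j => MulOpposite.op (x i j) where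
  comm_disj i j k l h₁ h₂ h₃ h₄ := (H.comm_disj i j k l h₁ h₂ h₃ h₄).op
  comm_nest i j k l h₁ h₂ h₃ h₄ := (H.comm_nest i j k l h₁ h₂ h₃ h₄).op
  cubic i j k l h₁ h₂ h₃ h₄ := by
    have c1 := H.comm_disj i j k l h₁ h₂.le h₃ h₄
    have c2 := H.comm_nest i l j k h₁.le h₂ h₃.le h₄
    have c3 := H.comm_disj i j j k h₁ le_rfl h₂ (by omega)
    have c4 := H.comm_nest i l k l (by omega) h₃ le_rfl h₄
    have c5 : Commute (x i j * x k l) (x j l) :=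
      (H.comm_disj i j j l h₁ le_rfl (by omega) h₄).mul_left
        (H.comm_nest j l k l h₂.le h₃ le_rfl h₄).symm
    have c6 : Commute (x j k * x i l) (x j l) :=
      (H.comm_nest j l j k le_rfl h₂ h₃.le h₄).symm.mul_left
        (H.comm_nest i l j l h₁.le (by omega) le_rfl h₄)
    simp only [qComm_op, ← MulOpposite.op_mul, ← MulOpposite.op_add, ← MulOpposite.op_sub]
    rw [qComm_assoc (Commute.refl _), H.cubic i j k l h₁ h₂ h₃ h₄, c5.eq, c6.eq, c1.eq, c3.eq,
      c2.eq, c4.eq]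
  cubic' i j k l h₁ h₂ h₃ h₄ := by
    have c1 := H.comm_disj i j k l h₁ h₂.le h₃ h₄
    have c2 := H.comm_nest i l j k h₁.le h₂ h₃.le h₄
    have c3 := H.comm_disj j k k l h₂ le_rfl h₃ h₄
    have c4 := H.comm_nest i l i j le_rfl h₁ (by omega) h₄
    have c5 : Commute (x i j * x k l) (x i k) :=
      (H.comm_nest i k i j le_rfl h₁ h₂.le (by omega)).symm.mul_left
        (H.comm_disj i k k l (by omega) le_rfl h₃ h₄).symm
    have c6 : Commute (x j k * x i l) (x i k) :=
      (H.comm_nest i k j k h₁.le h₂ le_rfl (by omega)).symm.mul_left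
        (H.comm_nest i l i k le_rfl (by omega) h₃.le h₄)
    simp only [qComm_op, ← MulOpposite.op_mul, ← MulOpposite.op_add, ← MulOpposite.op_sub]
    rw [qComm_assoc (Commute.refl _), H.cubic' i j k l h₁ h₂ h₃ h₄, c5.eq, c6.eq, c1.eq, ← c3.eq,
      c2.eq, ← c4.eq]
  pent i j k l m h₁ h₂ h₃ h₄ h₅ := by
    have hc := pentComm_of_nat H.comm_disj H.comm_nest h₁ h₂ h₃ h₄ h₅
    have hs := pentSides_of_nat H.comm_disj H.comm_nest h₁ h₂ h₃ h₄ h₅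
    exact (H.pent' i j k l m h₁ h₂ h₃ h₄ h₅).op hc.reflect hs.reflect
  pent' i j k l m h₁ h₂ h₃ h₄ h₅ := by
    have hc := pentComm_of_nat H.comm_disj H.comm_nest h₁ h₂ h₃ h₄ h₅
    have hs := pentSides_of_nat H.comm_disj H.comm_nest h₁ h₂ h₃ h₄ h₅
    exact (H.pent i j k l m h₁ h₂ h₃ h₄ h₅).op hc hs

end Presentation

/-! ### Relabelling vertices and evaluating twisted chords -/

section Restriction

variable {K : Type*} [Field K] {A : Type*} [Ring A] [Algebra K A] {q : K} {N : ℤ}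
  {X : ℤ → ℤ → A}

/-- The relations mention only the cyclic order of the vertices, so any increasing choice of
vertices within one full turn inherits them. Both the coproduct maps and the translations in the
braid maps are of this kind. -/
theorem CycAW.isAW_comp (H : CycAW q N X) {n : ℕ} {σ : ℕ → ℤ}
    (hσ : ∀ i j, i < j → j ≤ n → σ i < σ j) (hn : σ n ≤ σ 0 + N) :
    IsAW q n fun i j => X (σ i) (σ j) := by
  have hle : ∀ i j, i ≤ j → j ≤ n → σ i ≤ σ j := fun i j h hj => by
    rcases h.eq_or_lt with rfl | h
    · exact le_rfl
    · exact (hσ i j h hj).le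
  have hN : ∀ i j, i ≤ n → j ≤ n → σ j ≤ σ i + N := fun i j hi hj => by
    have := hle 0 i (by omega) hi
    have := hle j n hj le_rfl
    omega
  refine ⟨?_, ?_, ?_, ?_, ?_, ?_⟩
  · intro i j k l h₁ h₂ h₃ h₄
    exact H.comm _ _ _ _ (hle _ _ h₁.le (by omega)) (hle _ _ h₂ (by omega))
      (hle _ _ h₃.le h₄) (hN _ _ (by omega) h₄)
  · intro i j k l h₁ h₂ h₃ h₄
    exact H.comm' (hle _ _ h₁ (by omega)) (hle _ _ h₂.le (by omega))
      (hle _ _ h₃ h₄) (hN _ _ (by omega) h₄)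
  · intro i j k l h₁ h₂ h₃ h₄
    exact H.cubic _ _ _ _ (hle _ _ h₁.le (by omega)) (hle _ _ h₂.le (by omega))
      (hle _ _ h₃.le h₄) (hN _ _ (by omega) h₄)
  · intro i j k l h₁ h₂ h₃ h₄
    have e1 := H.mulPentCubic' (hle _ _ h₁.le (by omega)) (hle _ _ h₂.le (by omega))
      (hle _ _ h₃.le h₄) (hN i _ (by omega) h₄)
    have e2 := H.comm _ _ _ _ (hle _ _ h₁.le (by omega)) (hle _ _ h₂.le (by omega))
      (hle _ _ h₃.le h₄) (hN i _ (by omega) h₄)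
    rw [e1, e2.eq]
    simp only [mul_assoc]
  · intro i j k l m h₁ h₂ h₃ h₄ h₅
    exact H.pent _ _ _ _ _ (hle _ _ h₁.le (by omega)) (hle _ _ h₂.le (by omega))
      (hle _ _ h₃.le (by omega)) (hle _ _ h₄.le h₅) (hN _ _ (by omega) h₅)
  · intro i j k l m h₁ h₂ h₃ h₄ h₅
    exact H.pent' _ _ _ _ _ (hle _ _ h₁.le (by omega)) (hle _ _ h₂.le (by omega))
      (hle _ _ h₃.le (by omega)) (hle _ _ h₄.le h₅) (hN _ _ (by omega) h₅)

theorem CycAW.shift (H : CycAW q N X) (s : ℤ) : CycAW q N fun i j => X (i + s) (j + s) where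
  symm _ _ := H.symm _ _
  periodic i j := by rw [add_right_comm, H.periodic]
  diag _ := H.diag _
  comm _ _ _ _ h₁ h₂ h₃ h₄ := H.comm _ _ _ _ (by omega) (by omega) (by omega) (by omega)
  cubic _ _ _ _ h₁ h₂ h₃ h₄ := H.cubic _ _ _ _ (by omega) (by omega) (by omega) (by omega)
  pent _ _ _ _ _ h₁ h₂ h₃ h₄ h₅ :=
    H.pent _ _ _ _ _ (by omega) (by omega) (by omega) (by omega) (by omega)
  pent' _ _ _ _ _ h₁ h₂ h₃ h₄ h₅ :=
    H.pent' _ _ _ _ _ (by omega) (by omega) (by omega) (by omega) (by omega)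

theorem CycComm.periodic_mul (H : CycComm N X) (t i j : ℤ) : X (i + t * N) j = X i j := by
  induction t with
  | zero => simp
  | succ t ih => rw [← ih, add_mul, one_mul, ← add_assoc, H.periodic]
  | pred t ih => rw [← ih, sub_mul, one_mul, ← add_sub_assoc, H.periodic_sub]

theorem CycComm.emod_left (H : CycComm N X) (i j : ℤ) : X (i % N) j = X i j := by
  rw [← H.periodic_mul (i / N) (i % N) j, mul_comm, Int.emod_add_mul_ediv]

theorem CycComm.emod_right (H : CycComm N X) (i j : ℤ) : X i (j % N) = X i j := by
  rw [H.symm, H.emod_left, H.symm]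

theorem not_dvd_sub {i j : ℤ} (h : i ≠ j) (h₁ : i < j + N) (h₂ : j < i + N) : ¬ N ∣ i - j := by
  intro hd
  have := Int.eq_zero_of_abs_lt_dvd hd (abs_lt.2 ⟨by omega, by omega⟩)
  omega

variable {n : ℕ}

/-- The action of the half twist on a chord that ends at the vertex `0`. -/
theorem chordExt_twistFamily_zero {X : ℤ → ℤ → A} (H : CycComm (n + 1) X) {y : ℤ}
    (hy : ¬ (n + 1 : ℤ) ∣ y) : chordExt n (twistFamily q X) 0 y = chordTwist q X y := by
  have h0 : 0 ≤ y % (n + 1) := Int.emod_nonneg y (by omega)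
  have h1 : y % (n + 1) ≠ 0 := fun h => hy (Int.dvd_of_emod_eq_zero h)
  have h2 : ((y % (n + 1)).toNat : ℤ) = y % (n + 1) := Int.toNat_of_nonneg h0
  rw [chordExt, Int.zero_emod, Int.toNat_zero, if_neg (by omega), Nat.zero_min, Nat.zero_max,
    twistFamily, if_pos rfl, h2, chordTwist, chordTwist, H.emod_right, H.emod_right, H.emod_right]

/-- The half twist at the vertex `0` fixes the chords that do not end there. -/
theorem chordExt_twistFamily {X : ℤ → ℤ → A} (H : CycComm (n + 1) X) {x y : ℤ}
    (hx : ¬ (n + 1 : ℤ) ∣ x) (hy : ¬ (n + 1 : ℤ) ∣ y) :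
    chordExt n (twistFamily q X) x y = X x y := by
  have h1 : x % (n + 1) ≠ 0 := fun h => hx (Int.dvd_of_emod_eq_zero h)
  have h2 : y % (n + 1) ≠ 0 := fun h => hy (Int.dvd_of_emod_eq_zero h)
  have h3 : ((x % (n + 1)).toNat : ℤ) = x % (n + 1) :=
    Int.toNat_of_nonneg (Int.emod_nonneg x (by omega))
  have h4 : ((y % (n + 1)).toNat : ℤ) = y % (n + 1) :=
    Int.toNat_of_nonneg (Int.emod_nonneg y (by omega))
  rw [← H.emod_left x, ← H.emod_right _ y, chordExt]
  split_ifs with h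
  · rw [← h3, h, h4, H.diag]
  · rw [twistFamily, if_neg (by omega)]
    rcases le_total (x % (n + 1)).toNat (y % (n + 1)).toNat with h' | h'
    · rw [min_eq_left h', max_eq_right h', h3, h4]
    · rw [min_eq_right h', max_eq_left h', h3, h4, H.symm]

end Restriction

/-! ### The coproduct maps and the braid maps -/

section Maps

variable {K : Type*} [Field K] {q : K} {n : ℕ}

/-- The generators of `aw(n)` as a family indexed by the chords of an `(n + 1)`-gon. -/
noncomputable def chord (q : K) (n : ℕ) (i j : ℤ) : AW K q n :=
  chordExt n (fun i j => C K q n (Finset.Ioc i j)) i j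

theorem cycAW_chord (hq : q - q⁻¹ ≠ 0) : CycAW q (n + 1) (chord q n) :=
  (isAW_C hq).cycAW hq

theorem chord_coe {i j : ℕ} (h : i < j) (hj : j ≤ n) :
    chord q n i j = C K q n (Finset.Ioc i j) :=
  chordExt_coe h hj

theorem AW.algHom_ext_chord {A : Type*} [Ring A] [Algebra K A] {f g : AW K q n →ₐ[K] A}
    (h : ∀ i j : ℕ, i < j → j ≤ n → f (chord q n i j) = g (chord q n i j)) : f = g :=
  AW.algHom_ext fun i j h₁ h₂ => by rw [← chord_coe h₁ h₂, h i j h₁ h₂]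

theorem map_chord_of_coe {A : Type*} [Ring A] [Algebra K A] {N : ℤ} {Y : ℤ → ℤ → A}
    (H : CycComm N Y) (f : AW K q n →ₐ[K] A) (σ : ℤ → ℤ)
    (h : ∀ i j : ℕ, i < j → j ≤ n → f (C K q n (Finset.Ioc i j)) = Y (σ i) (σ j)) {i j : ℤ}
    (hi : 0 ≤ i) (hi' : i ≤ n) (hj : 0 ≤ j) (hj' : j ≤ n) :
    f (chord q n i j) = Y (σ i) (σ j) := by
  lift i to ℕ using hi
  lift j to ℕ using hj
  rcases lt_trichotomy i j with hij | rfl | hij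
  · rw [chord_coe hij (by omega), h i j hij (by omega)]
  · rw [chord, chordExt_diag, H.diag, map_one]
  · rw [chord, chordExt_symm, H.symm, ← chord, chord_coe hij (by omega), h j i hij (by omega)]

/-- The injection of the vertices of a polygon that omits the vertex `a`. -/
def skip (a i : ℤ) : ℤ := if i < a then i else i + 1

/-- The morphism `δ_a`. -/
noncomputable def coproduct (hq : q - q⁻¹ ≠ 0) (n a : ℕ) : AW K q n →ₐ[K] AW K q (n + 1) :=
  IsAW.lift (n := n) (x := fun i j => chord q (n + 1) (skip a i) (skip a j)) hq
    ((cycAW_chord hq).isAW_comp (σ := fun i => skip a i)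
      (fun i j _ _ => by unfold skip; split_ifs <;> omega)
      (by simp only [skip]; push_cast; split_ifs <;> omega))

theorem coproduct_chord_of_nonneg (hq : q - q⁻¹ ≠ 0) (a : ℕ) {i j : ℤ}
    (hi : 0 ≤ i) (hi' : i ≤ n) (hj : 0 ≤ j) (hj' : j ≤ n) :
    coproduct hq n a (chord q n i j) = chord q (n + 1) (skip a i) (skip a j) :=
  map_chord_of_coe (cycAW_chord hq).toCycComm _ _
    (fun _ _ h hj => IsAW.lift_C hq _ h hj) hi hi' hj hj'

/-- The vertex `-1` is admitted since the half twist at `0` uses it as a neighbour. It stands for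
`n`, which goes to `n + 1`, again the vertex `-1`, provided that `a ≤ n`. -/
theorem coproduct_chord (hq : q - q⁻¹ ≠ 0) {a : ℕ} (ha : a ≤ n) {i j : ℤ}
    (hi : -1 ≤ i) (hi' : i ≤ n) (hj : -1 ≤ j) (hj' : j ≤ n) :
    coproduct hq n a (chord q n i j) = chord q (n + 1) (skip a i) (skip a j) := by
  have H := (cycAW_chord (n := n) hq).toCycComm
  have H' := (cycAW_chord (n := n + 1) hq).toCycComm
  have h : ∀ j : ℤ, 0 ≤ j → j ≤ n → coproduct hq n a (chord q n (-1) j) =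
      chord q (n + 1) (-1) (skip a j) := by
    intro j hj hj'
    rw [← H.periodic, coproduct_chord_of_nonneg hq a (by omega) (by omega) hj hj',
      ← H'.periodic (-1)]
    congr 1
    unfold skip
    split_ifs <;> push_cast <;> omega
  have e : skip a (-1) = -1 := if_pos (by omega)
  rcases hi.eq_or_lt with rfl | hi <;> rcases hj.eq_or_lt with rfl | hj
  · rw [H.diag, H'.diag, map_one]
  · rw [h j (by omega) hj', e]
  · rw [H.symm, H'.symm, h i (by omega) hi', e]
  · exact coproduct_chord_of_nonneg hq a (by omega) hi' (by omega) hj'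

theorem isCoproductMap_coproduct (hq : q - q⁻¹ ≠ 0) (n a : ℕ) :
    IsCoproductMap a (coproduct hq n a) := by
  intro j k hj hjk hk
  have e : ∀ j k : ℕ, 1 ≤ j → Finset.Icc j k = Finset.Ioc (j - 1) k := by
    intro j k hj; ext; simp; omega
  rw [e j k hj, e _ (k + 1) hj, e (j + 1) _ (by omega),
    ← chord_coe (i := j - 1) (j := k) (n := n) (by omega) hk,
    coproduct_chord_of_nonneg hq a (by omega) (by omega) (by omega) (by omega),
    ← chord_coe (by omega) (by omega), ← chord_coe (by omega) (by omega),
    ← chord_coe (by omega) (by omega)]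
  have e1 : ((j - 1 : ℕ) : ℤ) = j - 1 := by omega
  rw [e1]
  unfold skip
  push_cast
  split_ifs <;> first | omega | congr 1
  ring

/-- The braid map `r_k`. -/
noncomputable def braid (hq : q - q⁻¹ ≠ 0) (hq' : q + q⁻¹ ≠ 0) (n k : ℕ) :
    AW K q n →ₐ[K] AW K q n :=
  IsAW.lift (n := n) (x := fun i j =>
      chordExt n (twistFamily q fun i j => chord q n (i + k) (j + k)) (i - k) (j - k)) hq
    ((((cycAW_chord hq).shift k).isAW_twistFamily hq hq').cycAW hq |>.isAW_comp
      (σ := fun i => i - k) (fun i j _ _ => by omega) (by push_cast; omega))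

theorem braid_chord (hq : q - q⁻¹ ≠ 0) (hq' : q + q⁻¹ ≠ 0) (k : ℕ) (i j : ℤ) :
    braid hq hq' n k (chord q n i j) =
      chordExt n (twistFamily q fun i j => chord q n (i + k) (j + k)) (i - k) (j - k) := by
  have H := (cycAW_chord (n := n) hq).toCycComm
  have H' := ((((cycAW_chord (n := n) hq).shift k).isAW_twistFamily hq hq').cycAW
    hq).toCycComm
  rw [← H.emod_left, ← H.emod_right, map_chord_of_coe H' (braid hq hq' n k) (fun i => i - k)
    (fun _ _ h hj => IsAW.lift_C hq _ h hj) (Int.emod_nonneg _ (by omega))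
    (Int.le_of_lt_add_one (Int.emod_lt_of_pos _ (by omega))) (Int.emod_nonneg _ (by omega))
    (Int.le_of_lt_add_one (Int.emod_lt_of_pos _ (by omega))), ← H'.emod_left (i - k),
    ← H'.emod_right _ (j - k), ← H'.emod_left (_ - _), ← H'.emod_right _ (_ - _),
    Int.emod_sub_emod, Int.emod_sub_emod]

theorem braid_chord_of_ne (hq : q - q⁻¹ ≠ 0) (hq' : q + q⁻¹ ≠ 0) {k : ℕ} {i j : ℤ}
    (hi : ¬ (n + 1 : ℤ) ∣ i - k) (hj : ¬ (n + 1 : ℤ) ∣ j - k) :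
    braid hq hq' n k (chord q n i j) = chord q n i j := by
  rw [braid_chord, chordExt_twistFamily ((cycAW_chord hq).shift k).toCycComm hi hj,
    sub_add_cancel, sub_add_cancel]

/-- The neighbours `a`, `c` and the vertex `b` are separate integers tied by equations, so that the
formula applies however these vertices are written. -/
theorem braid_chord_left (hq : q - q⁻¹ ≠ 0) (hq' : q + q⁻¹ ≠ 0) {k : ℕ} {a b c y : ℤ}
    (ha : a + 1 = k) (hb : b = k) (hc : c = k + 1) (hy : ¬ (n + 1 : ℤ) ∣ y - b) :
    braid hq hq' n k (chord q n b y) =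
      -qComm q (chord q n a c) (chord q n b y) +
        chord q n a b * chord q n c y + chord q n b c * chord q n a y := by
  subst hb hc
  obtain rfl : a = k - 1 := by omega
  rw [braid_chord, sub_self,
    chordExt_twistFamily_zero ((cycAW_chord hq).shift k).toCycComm hy, chordTwist, halfTwist]
  simp only [sub_add_cancel, zero_add, add_comm (-1 : ℤ), add_comm (1 : ℤ), ← sub_eq_add_neg]

theorem braid_chord_side (hq : q - q⁻¹ ≠ 0) (hq' : q + q⁻¹ ≠ 0) (hn : 1 ≤ n) {k : ℕ} {a b c : ℤ}
    (ha : a + 1 = k) (hb : b = k) (hc : c = k + 1) :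
    braid hq hq' n k (chord q n a b) = chord q n b c := by
  have H := (cycAW_chord (n := n) hq).toCycComm
  have h : Commute (chord q n a c) (chord q n a b) :=
    (H.comm' le_rfl (by omega) (by omega) (by omega))
  rw [H.symm a b, braid_chord_left hq hq' ha hb hc (not_dvd_sub (by omega) (by omega) (by omega)),
    H.symm b a, qComm_of_commute hq h, h.eq, H.symm c a, H.diag]
  noncomm_ring

theorem braid_chord_side' (hq : q - q⁻¹ ≠ 0) (hq' : q + q⁻¹ ≠ 0) (hn : 1 ≤ n) {k : ℕ} {a b c : ℤ}
    (ha : a + 1 = k) (hb : b = k) (hc : c = k + 1) :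
    braid hq hq' n k (chord q n b c) = chord q n a b := by
  have H := (cycAW_chord (n := n) hq).toCycComm
  have h : Commute (chord q n a c) (chord q n b c) :=
    (H.comm' (by omega) (by omega) le_rfl (by omega))
  rw [braid_chord_left hq hq' ha hb hc (not_dvd_sub (by omega) (by omega) (by omega)),
    qComm_of_commute hq h, h.eq, H.diag]
  noncomm_ring

theorem AW.algHom_ext_braid {A : Type*} [Ring A] [Algebra K A] {f g : AW K q n →ₐ[K] A}
    (hq : q - q⁻¹ ≠ 0) (k : ℕ)
    (h : ∀ y : ℤ, 0 ≤ y → y ≤ n → y ≠ k → f (chord q n k y) = g (chord q n k y))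
    (h' : ∀ i j : ℤ, 0 ≤ i → i < j → j ≤ n → i ≠ k → j ≠ k →
      f (chord q n i j) = g (chord q n i j)) : f = g := by
  refine AW.algHom_ext_chord fun i j hij hj => ?_
  by_cases hi : i = k
  · subst hi
    exact h j (by omega) (by omega) (by omega)
  by_cases hj' : j = k
  · subst hj'
    rw [(cycAW_chord hq).symm]
    exact h i (by omega) (by omega) (by omega)
  exact h' i j (by omega) (by omega) (by omega) (by omega) (by omega)

end Maps

/-! ### The braid maps have the prescribed values -/

section BraidMap

variable {K : Type*} [Field K] {q : K} {n : ℕ}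

theorem isBraidMap_braid (hq : q - q⁻¹ ≠ 0) (hq' : q + q⁻¹ ≠ 0) {i : ℕ} (hi : i < n) :
    IsBraidMap i (braid hq hq' n i) := by
  have H := (cycAW_chord (n := n) hq).toCycComm
  have hC : ∀ {i j : ℕ}, i < j → j ≤ n → C K q n (Finset.Ioc i j) = chord q n i j :=
    fun h h' => (chord_coe h h').symm
  have hI : ∀ j k : ℕ, Finset.Icc (j + 1) k = Finset.Ioc j k := fun j k => by ext; simp
  have hs : ∀ j : ℕ, {j + 1} = Finset.Ioc j (j + 1) := fun j => by ext; simp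
  intro j k hj hjk hk
  obtain ⟨j, rfl⟩ : ∃ j', j = j' + 1 := ⟨j - 1, by omega⟩
  have hjk' : j < k := hjk
  rw [hI]
  rcases i with _ | i
  · rw [if_pos rfl]
    split_ifs with h
    · obtain rfl : j = 0 := by omega
      rw [hI, hI 1 k, hs]
      rcases hjk.eq_or_lt with rfl | h1
      -- For `k = 1` the hole is empty and the value is `C_{1…n}`; for `k = n` the first block is
      -- empty and the value is `C_1`. Both cases say that the sides at the vertex `0` are
      -- exchanged.
      · simp only [zero_add, twoBlock, Finset.Ioc_self, true_or, or_true, if_true]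
        rw [Finset.union_comm, Finset.Ioc_union_Ioc_eq_Ioc (by omega) (by omega), hC (by omega) hk,
          hC (by omega) le_rfl]
        have := braid_chord_side' (n := n) (k := 0) (a := -1) (b := 0) (c := 1) hq hq' (by omega)
          (by omega) rfl rfl
        refine this.trans ?_
        rw [← H.periodic, H.symm]
        congr 1
        omega
      rcases hk.eq_or_lt with rfl | h2
      · simp only [zero_add, twoBlock, Finset.Ioc_self, true_or, if_true, Finset.empty_union]
        rw [hC (by omega) le_rfl, hC (by omega) (by omega)]
        have := braid_chord_side (n := k) (k := 0) (a := -1) (b := 0) (c := 1) hq hq' (by omega)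
          (by omega) rfl rfl
        rw [← H.periodic, H.symm] at this
        refine Eq.trans ?_ this
        congr 2
        omega
      · have c1 := H.comm 0 1 k n (by omega) (by omega) (by omega) (by omega)
        have c2 := H.comm' (i := 0) (j := 1) (k := k) (l := n) (by omega) (by omega) (by omega)
          (by omega)
        rw [twoBlock_Ioc' (by omega) (by omega) h2, hC (by omega) hk, hC (by omega) le_rfl,
          hC h2 le_rfl, hC (by omega) (by omega), hC (by omega) (by omega), hC (by omega) le_rfl]
        refine (braid_chord_left (k := 0) (a := -1) (b := 0) (c := 1) hq hq' (by omega) rfl rfl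
          (not_dvd_sub (by omega) (by omega) (by omega))).trans ?_
        -- The left neighbour of the vertex `0` is the vertex `n`.
        have e : ∀ x, chord q n (-1) x = chord q n n x := fun x => by
          rw [← H.periodic]
          congr 1
          omega
        simp only [e]
        rw [H.symm n 0, H.symm n 1, H.symm n k, c1.eq, c2.eq]
        norm_cast
        abel
    · rw [hC hjk' hk]
      exact braid_chord_of_ne hq hq' (not_dvd_sub (by omega) (by omega) (by omega))
        (not_dvd_sub (by omega) (by omega) (by omega))
  · rw [if_neg (by omega), hs, hs, hI]
    split_ifs with h h'
    · obtain rfl : j = i + 1 := by omega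
      rcases hjk.eq_or_lt with rfl | h1
      · simp only [twoBlock, Finset.Ioc_self, or_true, if_true, Finset.union_empty]
        rw [hC (by omega) hk, hC (by omega) (by omega)]
        exact braid_chord_side' hq hq' (by omega) (by omega) rfl (by omega)
      · rw [twoBlock_Ioc (by omega) (by omega) (by omega), hC hjk' hk, hC (by omega) (by omega),
          hC (by omega) (by omega), hC (by omega) (by omega), hC (by omega) (by omega),
          hC (by omega) (by omega)]
        exact braid_chord_left hq hq' (by omega) rfl (by omega)
          (not_dvd_sub (by omega) (by omega) (by omega))
    · subst h'
      rw [Nat.add_sub_cancel, hI]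
      obtain rfl | h1 := eq_or_ne j i
      · simp only [twoBlock, Finset.Ioc_self, or_true, if_true, Finset.union_empty]
        rw [hC (by omega) hk, hC (by omega) (by omega)]
        exact braid_chord_side hq hq' (by omega) (by omega) rfl (by omega)
      · rw [twoBlock_Ioc' (by omega) (by omega) (by omega), hC hjk' hk, hC (by omega) (by omega),
          hC (by omega) (by omega), hC (by omega) (by omega), hC (by omega) (by omega),
          hC (by omega) (by omega), H.symm j]
        refine (braid_chord_left (a := i) (c := (i + 1 + 1 : ℕ)) hq hq' (by omega) rfl (by omega)
          (not_dvd_sub (by omega) (by omega) (by omega))).trans ?_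
        rw [H.symm _ j, H.symm _ j, H.symm i j]
        abel
    · rw [hC hjk' hk]
      exact braid_chord_of_ne hq hq' (not_dvd_sub (by omega) (by omega) (by omega))
        (not_dvd_sub (by omega) (by omega) (by omega))

end BraidMap

/-! ### The anti-automorphism and the inverse braid maps -/

section Bar

variable {K : Type*} [Field K] {q : K} {n m : ℕ}

/-- The anti-morphism that fixes the generators. -/
noncomputable def up (hq : q - q⁻¹ ≠ 0) (n : ℕ) : AW K q n →ₐ[K] (AW K q n)ᵐᵒᵖ :=
  (isAW_C hq).op.lift hq

theorem up_C (hq : q - q⁻¹ ≠ 0) {i j : ℕ} (h : i < j) (hj : j ≤ n) :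
    up hq n (C K q n (Finset.Ioc i j)) = MulOpposite.op (C K q n (Finset.Ioc i j)) :=
  IsAW.lift_C hq _ h hj

theorem up_up (hq : q - q⁻¹ ≠ 0) (x : AW K q n) :
    up hq n (up hq n x).unop = MulOpposite.op x := by
  have : (AlgHom.opComm (up hq n)).comp (up hq n) = AlgHom.id K _ :=
    AW.algHom_ext fun i j h hj => by simp [AlgHom.opComm, up_C hq h hj]
  exact congrArg MulOpposite.op (DFunLike.congr_fun this x)

theorem bijective_up (hq : q - q⁻¹ ≠ 0) (n : ℕ) : Function.Bijective (up hq n (K := K)) :=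
  Function.bijective_iff_has_inverse.2 ⟨fun x => (up hq n x.unop).unop,
    fun x => by simp [up_up], fun x => by simp [up_up]⟩

theorem isUpMap_up (hq : q - q⁻¹ ≠ 0) (n : ℕ) : IsUpMap (up hq n (K := K)) := by
  intro j k hj hjk hk
  obtain ⟨i, rfl⟩ : ∃ i, j = i + 1 := ⟨j - 1, by omega⟩
  have hI : Finset.Icc (i + 1) k = Finset.Ioc i k := by ext; simp
  rw [hI, up_C hq (by omega) hk]

/-- The conjugate of a morphism by the anti-morphisms that fix the generators. -/
noncomputable def conj (hq : q - q⁻¹ ≠ 0) (f : AW K q n →ₐ[K] AW K q m) :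
    AW K q n →ₐ[K] AW K q m :=
  ((AlgHom.opComm (up hq m)).comp (AlgHom.op f)).comp (up hq n)

theorem conj_apply (hq : q - q⁻¹ ≠ 0) (f : AW K q n →ₐ[K] AW K q m) (x : AW K q n) :
    conj hq f x = (up hq m (f (up hq n x).unop)).unop := rfl

/-- Conjugation is multiplicative because `up` is an involution; it thus carries any identity
between compositions to its barred form. -/
theorem conj_comp (hq : q - q⁻¹ ≠ 0) {l : ℕ} (f : AW K q m →ₐ[K] AW K q l)
    (g : AW K q n →ₐ[K] AW K q m) : conj hq (f.comp g) = (conj hq f).comp (conj hq g) := by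
  ext x
  simp [conj_apply, up_up]

theorem conj_conj (hq : q - q⁻¹ ≠ 0) (f : AW K q n →ₐ[K] AW K q m) : conj hq (conj hq f) = f := by
  ext x
  simp [conj_apply, up_up]

theorem conj_C (hq : q - q⁻¹ ≠ 0) (f : AW K q n →ₐ[K] AW K q m) {i j : ℕ} (h : i < j)
    (hj : j ≤ n) : conj hq f (C K q n (Finset.Ioc i j)) =
      (up hq m (f (C K q n (Finset.Ioc i j)))).unop := by
  rw [conj_apply, up_C hq h hj, MulOpposite.unop_op]

theorem isBarBraidMap_conj (hq : q - q⁻¹ ≠ 0) (f : AW K q n →ₐ[K] AW K q n) :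
    IsBarBraidMap (up hq n) f (conj hq f) := by
  intro j k hj hjk hk
  obtain ⟨i, rfl⟩ : ∃ i, j = i + 1 := ⟨j - 1, by omega⟩
  have hI : Finset.Icc (i + 1) k = Finset.Ioc i k := by ext; simp
  rw [hI, conj_C hq f (by omega) hk]

theorem up_chord (hq : q - q⁻¹ ≠ 0) (i j : ℤ) :
    up hq n (chord q n i j) = MulOpposite.op (chord q n i j) := by
  have H := (cycAW_chord (n := n) hq).toCycComm
  rw [← H.emod_left, ← H.emod_right]
  have hi := Int.emod_nonneg i (b := n + 1) (by omega)
  have hj := Int.emod_nonneg j (b := n + 1) (by omega)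
  have hi' := Int.emod_lt_of_pos i (b := n + 1) (by omega)
  have hj' := Int.emod_lt_of_pos j (b := n + 1) (by omega)
  generalize i % (n + 1 : ℤ) = i at *
  generalize j % (n + 1 : ℤ) = j at *
  lift i to ℕ using hi
  lift j to ℕ using hj
  rcases lt_trichotomy i j with hij | rfl | hij
  · rw [chord_coe hij (by omega), up_C hq hij (by omega)]
  · rw [H.diag, map_one, MulOpposite.op_one]
  · rw [H.symm, chord_coe hij (by omega), up_C hq hij (by omega)]

theorem conj_coproduct (hq : q - q⁻¹ ≠ 0) (n a : ℕ) :
    conj hq (coproduct hq n a) = coproduct hq n a (K := K) := by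
  refine AW.algHom_ext_chord fun i j h hj => ?_
  rw [conj_apply, up_chord, MulOpposite.unop_op,
    coproduct_chord_of_nonneg hq a (by omega) (by omega) (by omega) (by omega), up_chord,
    MulOpposite.unop_op]

theorem conj_chord (hq : q - q⁻¹ ≠ 0) (f : AW K q n →ₐ[K] AW K q m) (i j : ℤ) :
    conj hq f (chord q n i j) = (up hq m (f (chord q n i j))).unop := by
  rw [conj_apply, up_chord, MulOpposite.unop_op]

theorem up_qComm (hq : q - q⁻¹ ≠ 0) (x y : AW K q n) :
    (up hq n (qComm q x y)).unop = qComm q (up hq n y).unop (up hq n x).unop := by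
  rw [map_qComm, ← MulOpposite.op_unop (up hq n x), ← MulOpposite.op_unop (up hq n y), qComm_op]
  simp

/-- The barred map has the bracket in the other order and exchanges the sides `p` and `r`. The
composition produces the double bracket `[e, [x, e]]`, and the cubic relation reduces it to `x`,
with all other terms cancelling. -/
theorem conj_braid_braid (hq : q - q⁻¹ ≠ 0) (hq' : q + q⁻¹ ≠ 0) {k : ℕ} (hk : k < n) :
    (conj hq (braid hq hq' n k)).comp (braid hq hq' n k) = AlgHom.id K _ := by
  have H := cycAW_chord (n := n) hq
  have hc : ∀ i j : ℤ, ¬ (n + 1 : ℤ) ∣ i - k → ¬ (n + 1 : ℤ) ∣ j - k →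
      conj hq (braid hq hq' n k) (chord q n i j) = chord q n i j := fun i j hi hj => by
    rw [conj_chord, braid_chord_of_ne hq hq' hi hj, up_chord, MulOpposite.unop_op]
  -- The window for `y` is one turn starting after `k`, so that `k - 1, k, k + 1, y` are in cyclic
  -- order and the relations apply; vertices below `k` are reached by adding `n + 1`.
  have key : ∀ y : ℤ, k + 1 ≤ y → y ≤ k - 1 + (n + 1) →
      conj hq (braid hq hq' n k) (braid hq hq' n k (chord q n k y)) = chord q n k y := by
    intro y h₁ h₂
    have hy : ¬ (n + 1 : ℤ) ∣ y - k := not_dvd_sub (by omega) (by omega) (by omega)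
    have ha : ¬ (n + 1 : ℤ) ∣ (k - 1 : ℤ) - k := not_dvd_sub (by omega) (by omega) (by omega)
    have hb : ¬ (n + 1 : ℤ) ∣ (k + 1 : ℤ) - k := not_dvd_sub (by omega) (by omega) (by omega)
    have e := braid_chord_left (a := k - 1) (b := k) (c := k + 1) hq hq' (by omega) rfl rfl hy
    have c1 : Commute (chord q n (k - 1) k) (chord q n (k - 1) (k + 1)) :=
      (H.comm' le_rfl (by omega) (by omega) (by omega)).symm
    have c2 : Commute (chord q n k (k + 1)) (chord q n (k - 1) (k + 1)) :=
      (H.comm' (by omega) (by omega) le_rfl (by omega)).symm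
    have c3 : Commute (chord q n (k - 1) (k + 1)) (chord q n (k + 1) y) :=
      H.comm _ _ _ _ (by omega) le_rfl h₁ (by omega)
    have c4 : Commute (chord q n (k - 1) y) (chord q n (k - 1) (k + 1)) :=
      H.comm' le_rfl (by omega) h₁ (by omega)
    have c5 : Commute (chord q n (k - 1) k) (chord q n (k + 1) y) :=
      H.comm _ _ _ _ (by omega) (by omega) h₁ (by omega)
    have c6 : Commute (chord q n (k - 1) y) (chord q n k (k + 1)) :=
      H.comm' (by omega) (by omega) h₁ (by omega)
    have c7 : Commute (chord q n k (k + 1)) (chord q n (k + 1) y) :=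
      H.comm _ _ _ _ (by omega) le_rfl h₁ (by omega)
    have hcub := H.mulPentCubic' (i := k - 1) (j := k) (k := k + 1) (l := y) (by omega) (by omega)
      h₁ (by omega)
    rw [MulPentCubic] at hcub
    have ex : conj hq (braid hq hq' n k) (chord q n k y) =
        -qComm q (chord q n k y) (chord q n (k - 1) (k + 1)) +
          chord q n (k - 1) k * chord q n (k + 1) y +
          chord q n k (k + 1) * chord q n (k - 1) y := by
      rw [conj_chord, e]
      simp only [map_add, map_neg, map_mul, MulOpposite.unop_add, MulOpposite.unop_neg,
        MulOpposite.unop_mul, up_qComm, up_chord, MulOpposite.unop_op, c5.eq, c6.eq]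
    have ep : conj hq (braid hq hq' n k) (chord q n (k - 1) k) = chord q n k (k + 1) := by
      rw [conj_chord, braid_chord_side (c := k + 1) hq hq' (by omega) (by omega) rfl rfl, up_chord,
        MulOpposite.unop_op]
    have er : conj hq (braid hq hq' n k) (chord q n k (k + 1)) = chord q n (k - 1) k := by
      rw [conj_chord, braid_chord_side' (a := k - 1) hq hq' (by omega) (by omega) rfl rfl, up_chord,
        MulOpposite.unop_op]
    rw [e]
    simp only [map_add, map_neg, map_mul, map_qComm, ex, ep, er, hc _ _ ha hb, hc _ _ hb hy,
      hc _ _ ha hy, qComm_add_right, qComm_neg_right]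
    rw [hcub, qComm_mul_right c1, qComm_mul_right c2, qComm_of_commute hq c3,
      qComm_of_commute hq c4.symm, c3.eq, c4.eq, ← c5.eq, c7.eq]
    simp only [mul_assoc]
    abel
  refine AW.algHom_ext_braid hq k (fun y h₁ h₂ h₃ => ?_) fun i j h₁ h₂ h₃ h₄ h₅ => ?_
  · rcases lt_or_gt_of_ne h₃ with h | h
    · have := key (y + (n + 1)) (by omega) (by omega)
      rwa [H.periodic'] at this
    · exact key y (by omega) (by omega)
  · have hi : ¬ (n + 1 : ℤ) ∣ i - k := not_dvd_sub (by omega) (by omega) (by omega)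
    have hj : ¬ (n + 1 : ℤ) ∣ j - k := not_dvd_sub (by omega) (by omega) (by omega)
    rw [AlgHom.comp_apply, braid_chord_of_ne hq hq' hi hj, hc _ _ hi hj, AlgHom.id_apply]

theorem braid_conj_braid (hq : q - q⁻¹ ≠ 0) (hq' : q + q⁻¹ ≠ 0) {k : ℕ} (hk : k < n) :
    (braid hq hq' n k).comp (conj hq (braid hq hq' n k)) = AlgHom.id K _ := by
  have := congrArg (conj hq) (conj_braid_braid hq hq' hk)
  rw [conj_comp, conj_conj] at this
  rw [this]
  ext x
  simp [conj_apply, up_up]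

theorem bijective_braid (hq : q - q⁻¹ ≠ 0) (hq' : q + q⁻¹ ≠ 0) {k : ℕ} (hk : k < n) :
    Function.Bijective (braid hq hq' n k) :=
  Function.bijective_iff_has_inverse.2 ⟨conj hq (braid hq hq' n k),
    DFunLike.congr_fun (conj_braid_braid hq hq' hk),
    DFunLike.congr_fun (braid_conj_braid hq hq' hk)⟩

theorem bijective_conj_braid (hq : q - q⁻¹ ≠ 0) (hq' : q + q⁻¹ ≠ 0) {k : ℕ} (hk : k < n) :
    Function.Bijective (conj hq (braid hq hq' n k)) :=
  Function.bijective_iff_has_inverse.2 ⟨braid hq hq' n k,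
    DFunLike.congr_fun (braid_conj_braid hq hq' hk),
    DFunLike.congr_fun (conj_braid_braid hq hq' hk)⟩

end Bar

/-! ### Relations between the coproduct maps and the braid maps -/

section BraidCoproduct

variable {K : Type*} [Field K] {q : K} {n : ℕ}

theorem skip_of_lt {a i : ℤ} (h : i < a) : skip a i = i := if_pos h

theorem skip_of_le {a i : ℤ} (h : a ≤ i) : skip a i = i + 1 := if_neg (not_lt.2 h)

/-- The image of `δ_i` is generated by chords that avoid the vertex `i`, and the half twist at `i`
fixes those. -/
theorem braid_comp_coproduct (hq : q - q⁻¹ ≠ 0) (hq' : q + q⁻¹ ≠ 0) {i : ℕ} (hi : i ≤ n) :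
    (braid hq hq' (n + 1) i).comp (coproduct hq n i) = coproduct hq n i := by
  have h : ∀ x : ℤ, 0 ≤ x → x ≤ n → ¬ (((n + 1 : ℕ) : ℤ) + 1) ∣ skip i x - i := by
    intro x h₁ h₂
    unfold skip
    split_ifs <;> exact not_dvd_sub (by omega) (by omega) (by omega)
  refine AW.algHom_ext_chord fun j k hjk hk => ?_
  rw [AlgHom.comp_apply, coproduct_chord hq hi (by omega) (by omega) (by omega) (by omega),
    braid_chord_of_ne hq hq' (h _ (by omega) (by omega)) (h _ (by omega) (by omega))]

/-- Compatibility of a coproduct map and a braid map that act at places which do not meet. -/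
theorem coproduct_comp_braid (hq : q - q⁻¹ ≠ 0) (hq' : q + q⁻¹ ≠ 0) {i j k : ℕ} (hi : i ≤ n)
    (hj : j < n) (h₁ : skip i j = k) (h₂ : skip i (j - 1) + 1 = k) (h₃ : skip i (j + 1) = k + 1) :
    (coproduct hq n i).comp (braid hq hq' n j) =
      (braid hq hq' (n + 1) k).comp (coproduct hq n i) := by
  have hk : k ≤ j + 1 := by
    have : skip i j ≤ j + 1 := by unfold skip; split_ifs <;> omega
    omega
  have hd : ∀ x : ℤ, 0 ≤ x → x ≤ n → x ≠ j → ¬ (((n + 1 : ℕ) : ℤ) + 1) ∣ skip i x - k := by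
    intro x hx hx' hne
    have : skip i x ≠ skip i j := by
      unfold skip
      split_ifs <;> omega
    have : 0 ≤ skip i x ∧ skip i x ≤ n + 1 := by
      unfold skip
      split_ifs <;> omega
    exact not_dvd_sub (by omega) (by omega) (by omega)
  -- The three assumptions on `skip` say that `j - 1, j, j + 1` are sent to the consecutive vertices
  -- `k - 1, k, k + 1`, so the relabelling carries one half twist to the other.
  refine AW.algHom_ext_braid hq j (fun y hy hy' hne => ?_) fun x y hx hxy hy hne hne' => ?_
  · have hy'' := hd y hy hy' hne
    rw [AlgHom.comp_apply, AlgHom.comp_apply,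
      braid_chord_left (a := j - 1) (c := j + 1) hq hq' (by omega) rfl rfl
        (not_dvd_sub hne (by omega) (by omega)),
      coproduct_chord hq hi (by omega) (by omega) (by omega) hy', h₁,
      braid_chord_left (a := skip i (j - 1)) (c := k + 1) hq hq' h₂ rfl rfl hy'']
    simp only [map_add, map_neg, map_mul, map_qComm]
    repeat rw [coproduct_chord hq hi (by omega) (by omega) (by omega) (by omega)]
    rw [h₁, h₃]
  · rw [AlgHom.comp_apply, AlgHom.comp_apply,
      braid_chord_of_ne hq hq' (not_dvd_sub (by omega) (by omega) (by omega))
        (not_dvd_sub (by omega) (by omega) (by omega)),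
      coproduct_chord hq hi (by omega) (by omega) (by omega) (by omega),
      braid_chord_of_ne hq hq' (hd _ (by omega) (by omega) (by omega))
        (hd _ (by omega) (by omega) (by omega))]

theorem skip_succ {i x : ℤ} (h : x ≠ i) : skip (i + 1) x = skip i x := by
  unfold skip
  split_ifs <;> omega

theorem skip_spec {i : ℕ} {x : ℤ} (h₀ : 0 ≤ x) (h₁ : x ≤ n) (h : x ≠ i) :
    skip i x ≠ i ∧ skip i x ≠ i + 1 ∧ 0 ≤ skip i x ∧ skip i x ≤ n + 1 := by
  unfold skip
  split_ifs <;> omega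

/-- Both sides of the two mixed relations agree on the chords that do not end at the vertex of the
braid map. -/
theorem coproduct_comp_braid_of_ne (hq : q - q⁻¹ ≠ 0) (hq' : q + q⁻¹ ≠ 0) {i : ℕ} (hi : i < n)
    {x y : ℤ} (hx : 0 ≤ x) (hxy : x < y) (hy : y ≤ n) (hne : x ≠ i) (hne' : y ≠ i) :
    ((coproduct hq n i).comp (braid hq hq' n i) (chord q n x y) =
      chord q (n + 1) (skip i x) (skip i y)) ∧
    ((coproduct hq n (i + 1)).comp (braid hq hq' n i) (chord q n x y) =
      chord q (n + 1) (skip i x) (skip i y)) ∧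
    (coproduct hq n (i + 1) (chord q n x y) = chord q (n + 1) (skip i x) (skip i y)) ∧
    (coproduct hq n i (chord q n x y) = chord q (n + 1) (skip i x) (skip i y)) ∧
    (braid hq hq' (n + 1) i (chord q (n + 1) (skip i x) (skip i y)) =
      chord q (n + 1) (skip i x) (skip i y)) ∧
    (braid hq hq' (n + 1) (i + 1) (chord q (n + 1) (skip i x) (skip i y)) =
      chord q (n + 1) (skip i x) (skip i y)) := by
  have e1 := skip_spec (n := n) hx (by omega) hne
  have e2 := skip_spec (n := n) (by omega) hy hne'
  have e3 : coproduct hq n (i + 1) (chord q n x y) = chord q (n + 1) (skip i x) (skip i y) := by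
    rw [coproduct_chord hq (by omega) (by omega) (by omega) (by omega) (by omega), Nat.cast_succ,
      skip_succ hne, skip_succ hne']
  have e4 : coproduct hq n i (chord q n x y) = chord q (n + 1) (skip i x) (skip i y) :=
    coproduct_chord hq (by omega) (by omega) (by omega) (by omega) (by omega)
  have e5 : braid hq hq' n i (chord q n x y) = chord q n x y :=
    braid_chord_of_ne hq hq' (not_dvd_sub (by omega) (by omega) (by omega))
        (not_dvd_sub (by omega) (by omega) (by omega))
  refine ⟨by rw [AlgHom.comp_apply, e5, e4], by rw [AlgHom.comp_apply, e5, e3], e3, e4, ?_, ?_⟩ <;>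
  exact braid_chord_of_ne hq hq' (not_dvd_sub (by omega) (by omega) (by omega))
        (not_dvd_sub (by omega) (by omega) (by omega))

/-- A half twist past a doubled side is a product of two half twists. On a chord at the vertex `i`
the two sides of the identity are the two sides of a decreasing four-block relation for `i - 1, i, i
+ 1, i + 2` and the other end of the chord. -/
theorem coproduct_comp_braid_self (hq : q - q⁻¹ ≠ 0) (hq' : q + q⁻¹ ≠ 0) {i : ℕ} (hi : i < n) :
    (coproduct hq n i).comp (braid hq hq' n i) =
      ((braid hq hq' (n + 1) (i + 1)).comp (braid hq hq' (n + 1) i)).comp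
        (coproduct hq n (i + 1)) := by
  have H := cycAW_chord (n := n + 1) hq
  refine AW.algHom_ext_braid hq i (fun y hy hy' hne => ?_) fun x y hx hxy hy hne hne' => ?_
  · have hz := skip_spec hy hy' hne
    rw [AlgHom.comp_apply, AlgHom.comp_apply, AlgHom.comp_apply,
      braid_chord_left (a := i - 1) (c := i + 1) hq hq' (by omega) rfl rfl
        (not_dvd_sub hne (by omega) (by omega)),
      coproduct_chord hq (by omega) (by omega) (by omega) (by omega) hy', Nat.cast_succ,
      skip_succ hne, skip_of_lt (by omega : (i : ℤ) < i + 1)]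
    simp only [map_add, map_neg, map_mul, map_qComm]
    repeat rw [coproduct_chord hq (by omega) (by omega) (by omega) (by omega) (by omega)]
    rw [skip_of_le (le_refl (i : ℤ)), skip_of_lt (by omega : (i - 1 : ℤ) < i),
      skip_of_le (by omega : (i : ℤ) ≤ i + 1)]
    generalize skip i y = z at hz ⊢
    have d1 : ¬ (((n + 1 : ℕ) : ℤ) + 1) ∣ z - i := not_dvd_sub (by omega) (by omega) (by omega)
    have d2 : ¬ (((n + 1 : ℕ) : ℤ) + 1) ∣ z - (i + 1) :=
      not_dvd_sub (by omega) (by omega) (by omega)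
    have d3 : ¬ (((n + 1 : ℕ) : ℤ) + 1) ∣ z - (i + 1 : ℕ) :=
      not_dvd_sub (by omega) (by omega) (by omega)
    have d4 : ¬ (((n + 1 : ℕ) : ℤ) + 1) ∣ (i : ℤ) - (i + 1 : ℕ) :=
      not_dvd_sub (by omega) (by omega) (by omega)
    have d5 : ¬ (((n + 1 : ℕ) : ℤ) + 1) ∣ (i - 1 : ℤ) - (i + 1 : ℕ) :=
      not_dvd_sub (by omega) (by omega) (by omega)
    have d6 : ¬ (((n + 1 : ℕ) : ℤ) + 1) ∣ (i - 1 : ℤ) - (i + 1) :=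
      not_dvd_sub (by omega) (by omega) (by omega)
    rw [braid_chord_left (a := i - 1) (b := i) (c := i + 1) hq hq' (by omega) rfl rfl d1]
    simp only [map_add, map_neg, map_mul, map_qComm]
    rw [H.symm (i - 1) (i + 1), braid_chord_left (a := i) (b := i + 1) (c := i + 1 + 1) hq hq'
        (by omega) (by omega) (by omega) d6,
      braid_chord_left (a := i) (b := i + 1) (c := i + 1 + 1) (y := z) hq hq' (by omega)
        (by omega) (by omega) d2,
      braid_chord_of_ne hq hq' d4 d3, braid_chord_of_ne hq hq' d5 d4,
      braid_chord_of_ne hq hq' d5 d3,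
      braid_chord_side (a := i) (b := i + 1) (c := i + 1 + 1) hq hq' (by omega) (by omega)
        (by omega) (by omega)]
    -- `w` represents `z` modulo the number of vertices, chosen before `i - 1` so that the five
    -- vertices are in cyclic order.
    obtain ⟨w, hw, hw', hX⟩ : ∃ w : ℤ, w ≤ i - 1 ∧ i + 1 + 1 ≤ w + ((n + 1 : ℕ) + 1) ∧
        ∀ x, chord q (n + 1) x z = chord q (n + 1) w x := by
      rcases lt_or_gt_of_ne hz.1 with h | h
      · exact ⟨z, by omega, by omega, fun x => H.symm _ _⟩
      · exact ⟨z - ((n + 1 : ℕ) + 1), by omega, by omega,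
          fun x => by rw [H.periodic_sub, H.symm]⟩
    simp only [hX]
    have := (four_iff hq (H.pentComm hw (by omega : (i - 1 : ℤ) ≤ i) (by omega : (i : ℤ) ≤ i + 1)
      (by omega : (i + 1 : ℤ) ≤ i + 1 + 1) hw').reflect
        (H.pentSides hw (by omega) (by omega) (by omega) hw').reflect).2
          (H.pent' _ _ _ _ _ hw (by omega) (by omega) (by omega) hw')
    rw [H.symm (i + 1) (i - 1), H.symm (i + 1 + 1) (i - 1), H.symm i (i - 1)]
    rw [add_right_comm, this,
      add_right_comm (-qComm q (chord q (n + 1) i (i + 1 + 1)) _)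
        (chord q (n + 1) (i + 1) (i + 1 + 1) * _),
      add_right_comm (-qComm q (chord q (n + 1) i (i + 1 + 1)) _)
        (chord q (n + 1) (i + 1) (i + 1 + 1) * _), add_right_comm]
  · obtain ⟨e1, -, e2, -, e3, e4⟩ := coproduct_comp_braid_of_ne hq hq' hi hx hxy hy hne hne'
    rw [e1, AlgHom.comp_apply, AlgHom.comp_apply, e2, e3, e4]

/-- The mirror image of the previous identity, resting on the increasing four-block relation, with
the fifth vertex chosen after `i + 2`. -/
theorem coproduct_succ_comp_braid (hq : q - q⁻¹ ≠ 0) (hq' : q + q⁻¹ ≠ 0) {i : ℕ} (hi : i < n) :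
    (coproduct hq n (i + 1)).comp (braid hq hq' n i) =
      ((braid hq hq' (n + 1) i).comp (braid hq hq' (n + 1) (i + 1))).comp
        (coproduct hq n i) := by
  have H := cycAW_chord (n := n + 1) hq
  refine AW.algHom_ext_braid hq i (fun y hy hy' hne => ?_) fun x y hx hxy hy hne hne' => ?_
  · have hz := skip_spec hy hy' hne
    rw [AlgHom.comp_apply, AlgHom.comp_apply, AlgHom.comp_apply,
      braid_chord_left (a := i - 1) (c := i + 1) hq hq' (by omega) rfl rfl
        (not_dvd_sub hne (by omega) (by omega)),
      coproduct_chord hq (by omega) (by omega) (by omega) (by omega) hy',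
      skip_of_le (le_refl (i : ℤ))]
    simp only [map_add, map_neg, map_mul, map_qComm]
    repeat rw [coproduct_chord hq (by omega) (by omega) (by omega) (by omega) (by omega)]
    rw [Nat.cast_succ, skip_succ hne, skip_of_lt (by omega : (i : ℤ) < i + 1),
      skip_of_lt (by omega : (i - 1 : ℤ) < i + 1), skip_of_le (by omega : (i + 1 : ℤ) ≤ i + 1)]
    generalize skip i y = z at hz ⊢
    have d1 : ¬ (((n + 1 : ℕ) : ℤ) + 1) ∣ z - i := not_dvd_sub (by omega) (by omega) (by omega)
    have d2 : ¬ (((n + 1 : ℕ) : ℤ) + 1) ∣ z - (i + 1) :=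
      not_dvd_sub (by omega) (by omega) (by omega)
    have d3 : ¬ (((n + 1 : ℕ) : ℤ) + 1) ∣ (i + 1 + 1 : ℤ) - i :=
      not_dvd_sub (by omega) (by omega) (by omega)
    have d4 : ¬ (((n + 1 : ℕ) : ℤ) + 1) ∣ (i + 1 : ℤ) - i :=
      not_dvd_sub (by omega) (by omega) (by omega)
    rw [braid_chord_left (a := i) (b := i + 1) (c := i + 1 + 1) hq hq' (by omega) (by omega)
      (by omega) d2]
    simp only [map_add, map_neg, map_mul, map_qComm]
    rw [braid_chord_left (a := i - 1) (b := i) (c := i + 1) (y := i + 1 + 1) hq hq'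
        (by omega) rfl rfl d3,
      braid_chord_left (a := i - 1) (b := i) (c := i + 1) (y := z) hq hq' (by omega)
        rfl rfl d1,
      braid_chord_of_ne hq hq' d4 d1, braid_chord_of_ne hq hq' d3 d1,
      braid_chord_of_ne hq hq' d4 d3,
      braid_chord_side' (a := i - 1) (b := i) (c := i + 1) hq hq' (by omega) (by omega) rfl rfl]
    obtain ⟨w, hw, hw', hX⟩ : ∃ w : ℤ, i + 1 + 1 ≤ w ∧ w ≤ i - 1 + ((n + 1 : ℕ) + 1) ∧
        ∀ x, chord q (n + 1) x z = chord q (n + 1) x w := by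
      rcases lt_or_gt_of_ne hz.1 with h | h
      · exact ⟨z + ((n + 1 : ℕ) + 1), by omega, by omega, fun x => by rw [H.periodic']⟩
      · exact ⟨z, by omega, by omega, fun x => rfl⟩
    simp only [hX]
    exact (four_iff hq (H.pentComm (by omega : (i - 1 : ℤ) ≤ i) (by omega : (i : ℤ) ≤ i + 1)
      (by omega : (i + 1 : ℤ) ≤ i + 1 + 1) hw hw')
        (H.pentSides (by omega) (by omega) (by omega) hw hw')).2
          (H.pent _ _ _ _ _ (by omega) (by omega) (by omega) hw hw')
  · obtain ⟨-, e1, -, e2, e3, e4⟩ := coproduct_comp_braid_of_ne hq hq' hi hx hxy hy hne hne'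
    rw [e1, AlgHom.comp_apply, AlgHom.comp_apply, e2, e4, e3]

end BraidCoproduct

end AskeyWilson

/-! ### Assembly of the theorem -/

theorem mainTheorem3 {K : Type*} [Field K] (q : K) (hq : q ≠ 0) (hq2 : q ^ 2 ≠ 1) :
    ∃ δ : ∀ n _a : ℕ, AskeyWilson.AW K q n →ₐ[K] AskeyWilson.AW K q (n + 1),
      (∀ n a : ℕ, a ≤ n → AskeyWilson.IsCoproductMap a (δ n a)) ∧
      (q ^ 2 ≠ -1 →
        ∃ (up : ∀ n : ℕ, AskeyWilson.AW K q n →ₐ[K] (AskeyWilson.AW K q n)ᵐᵒᵖ)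
          (r rbar : ∀ n _i : ℕ, AskeyWilson.AW K q n →ₐ[K] AskeyWilson.AW K q n),
          (∀ n : ℕ, AskeyWilson.IsUpMap (up n) ∧ Function.Bijective (up n)) ∧
          (∀ n i : ℕ, i < n →
            AskeyWilson.IsBraidMap i (r n i) ∧ Function.Bijective (r n i) ∧
            AskeyWilson.IsBarBraidMap (up n) (r n i) (rbar n i) ∧
            Function.Bijective (rbar n i)) ∧
          (∀ n i : ℕ, i ≤ n →
            (r (n + 1) i).comp (δ n i) = δ n i ∧
            δ n i = (rbar (n + 1) i).comp (δ n i)) ∧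
          (∀ n i : ℕ, i < n →
            (δ n i).comp (r n i) = ((r (n + 1) (i + 1)).comp (r (n + 1) i)).comp (δ n (i + 1)) ∧
            ((rbar (n + 1) i).comp (rbar (n + 1) (i + 1))).comp (δ n i) =
              (δ n (i + 1)).comp (rbar n i)) ∧
          (∀ n i : ℕ, i < n →
            (δ n (i + 1)).comp (r n i) = ((r (n + 1) i).comp (r (n + 1) (i + 1))).comp (δ n i) ∧
            ((rbar (n + 1) (i + 1)).comp (rbar (n + 1) i)).comp (δ n (i + 1)) =
              (δ n i).comp (rbar n i)) ∧
          (∀ n i j : ℕ, i ≤ n → j + 1 < i →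
            (δ n i).comp (r n j) = (r (n + 1) j).comp (δ n i) ∧
            (δ n i).comp (rbar n j) = (rbar (n + 1) j).comp (δ n i)) ∧
          (∀ n i j : ℕ, i ≤ n → i < j → j < n →
            (δ n i).comp (r n j) = (r (n + 1) (j + 1)).comp (δ n i) ∧
            (δ n i).comp (rbar n j) = (rbar (n + 1) (j + 1)).comp (δ n i))) := by
  have hqi : q - q⁻¹ ≠ 0 := fun h => hq2 <| by
    have := congrArg (q * ·) (sub_eq_zero.1 h)
    simpa [sq, hq] using this
  refine ⟨fun n a => AskeyWilson.coproduct hqi n a,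
    fun n a _ => AskeyWilson.isCoproductMap_coproduct hqi n a, fun hq3 => ?_⟩
  have hqi' : q + q⁻¹ ≠ 0 := fun h => hq3 <| by
    have := congrArg (q * ·) (eq_neg_of_add_eq_zero_left h)
    simpa [sq, hq] using this
  have bar : ∀ {n m : ℕ} {f g : AskeyWilson.AW K q n →ₐ[K] AskeyWilson.AW K q m}, f = g →
      AskeyWilson.conj hqi f = AskeyWilson.conj hqi g := fun h => by rw [h]
  refine ⟨fun n => AskeyWilson.up hqi n, fun n i => AskeyWilson.braid hqi hqi' n i,
    fun n i => AskeyWilson.conj hqi (AskeyWilson.braid hqi hqi' n i),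
    fun n => ⟨AskeyWilson.isUpMap_up hqi n, AskeyWilson.bijective_up hqi n⟩,
    fun n i hi => ⟨AskeyWilson.isBraidMap_braid hqi hqi' hi,
      AskeyWilson.bijective_braid hqi hqi' hi, AskeyWilson.isBarBraidMap_conj hqi _,
      AskeyWilson.bijective_conj_braid hqi hqi' hi⟩,
    fun n i hi => ?_, fun n i hi => ?_, fun n i hi => ?_, fun n i j hi hij => ?_,
    fun n i j hi hij hj => ?_⟩
  · have h := AskeyWilson.braid_comp_coproduct hqi hqi' hi
    have h' := bar h
    simp only [AskeyWilson.conj_comp, AskeyWilson.conj_coproduct] at h'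
    exact ⟨h, h'.symm⟩
  · have h := AskeyWilson.coproduct_comp_braid_self hqi hqi' hi
    -- The barred identity paired with this one is the conjugate of the other mixed relation:
    -- conjugation keeps the order of composition, while the two columns of the statement have it
    -- reversed.
    have h' := bar (AskeyWilson.coproduct_succ_comp_braid hqi hqi' hi)
    simp only [AskeyWilson.conj_comp, AskeyWilson.conj_coproduct] at h'
    exact ⟨h, h'.symm⟩
  · have h := AskeyWilson.coproduct_succ_comp_braid hqi hqi' hi
    have h' := bar (AskeyWilson.coproduct_comp_braid_self hqi hqi' hi)
    simp only [AskeyWilson.conj_comp, AskeyWilson.conj_coproduct] at h'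
    exact ⟨h, h'.symm⟩
  · have h := AskeyWilson.coproduct_comp_braid (k := j) hqi hqi' hi (by omega)
      (AskeyWilson.skip_of_lt (by omega))
      (by rw [AskeyWilson.skip_of_lt (by omega), sub_add_cancel])
      (AskeyWilson.skip_of_lt (by omega))
    have h' := bar h
    simp only [AskeyWilson.conj_comp, AskeyWilson.conj_coproduct] at h'
    exact ⟨h, h'⟩
  · have h := AskeyWilson.coproduct_comp_braid (k := j + 1) hqi hqi' hi hj
      (AskeyWilson.skip_of_le (by omega))
      (by rw [AskeyWilson.skip_of_le (by omega), sub_add_cancel]; rfl)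
      (by rw [AskeyWilson.skip_of_le (by omega)]; rfl)
    have h' := bar h
    simp only [AskeyWilson.conj_comp, AskeyWilson.conj_coproduct] at h'
    exact ⟨h, h'⟩
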